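/- Let $k$ be a commutative Artinian ring, let $\Lambda$ be an indecomposable (nonzero) $k$-algebra which is finitely generated and projective as a $k$-module, with Jacobson radical $\mathfrak r$ and enveloping algebra $\Lambda^{e}=\Lambda\otimes_k\Lambda^{op}$. Let $\psi\colon\Lambda\to\Lambda$ be a $k$-algebra automorphism, $t\ge 1$ an integer, and $M$ a nonzero finitely generated left $\Lambda$-module. Conventions. For automorphisms $\phi,\rho$ of $\Lambda$ and a bimodule $B$, ${}_{\phi}B_{\rho}$ is $B$ with the actions $\gamma\cdot b\cdot\gamma'=\phi(\gamma)\,b\,\rho(\gamma')$; likewise ${}_{\phi}X$ for a left module $X$. The twisted Hochschild cohomology ring is $$\mathrm{HH}^{t*}({}_{\psi^*}\Lambda_1,\Lambda)=\bigoplus_{n\ge 0}\mathrm{Ext}^{tn}_{\Lambda^e}({}_{\psi^n}\Lambda_1,\Lambda),\qquad \eta\cdot\theta=\eta\circ{}_{\psi^m}\theta\quad\text{for } |\eta|=tm,$$ where $\circ$ is the Yoneda product; its degree zero part is the centre $Z(\Lambda)$. For left $\Lambda$-modules $M,N$ it acts from the right on $\mathrm{Ext}^{t*}_{\Lambda}({}_{\psi^*}M,N)=\bigoplus_{n\ge0}\mathrm{Ext}_\Lambda^{tn}({}_{\psi^n}M,N)$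 by $\zeta\cdot\eta=\zeta\circ{}_{\psi^m}(\eta\otimes_\Lambda M)$ for $|\zeta|=tm$. For $s\ge 1$ the ring $\mathrm{HH}^{ts*}({}_{(\psi^s)^*}\Lambda_1,\Lambda)$ is identified with the graded subring of $\mathrm{HH}^{t*}({}_{\psi^*}\Lambda_1,\Lambda)$ of the elements whose degrees are multiples of $ts$. A homogeneous element $\eta$ of degree $tn$ is called $\psi$-invariant if $\eta_{\psi^{-1}}={}_{\psi}\eta$, where $\eta_{\psi^{-1}}\in\mathrm{Ext}^{tn}_{\Lambda^e}({}_{\psi^n}\Lambda_{\psi^{-1}},{}_1\Lambda_{\psi^{-1}})$ is regarded as an element of $\mathrm{Ext}^{tn}_{\Lambda^e}({}_{\psi^{n+1}}\Lambda_1,{}_{\psi}\Lambda_1)$ through the isomorphisms $\psi^{-1}\colon{}_{\psi^{n+1}}\Lambda_1\to{}_{\psi^n}\Lambda_{\psi^{-1}}$ and $\psi\colon{}_1\Lambda_{\psi^{-1}}\to{}_{\psi}\Lambda_1$. A commutative graded subalgebra is strongly commutative (with respect to $\psi$) if all its homogeneous elements are $\psi$-invariant. One says that $\mathbf{Fg}(M,H,\psi,t)$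 holds if $H$ is a strongly commutative Noetherian graded subalgebra of $\mathrm{HH}^{t*}({}_{\psi^*}\Lambda_1,\Lambda)$ with $H^0=Z(\Lambda)$ such that $\mathrm{Ext}_\Lambda^{t*}({}_{\psi^*}M,\Lambda/\mathfrak r)$ is a finitely generated $H$-module. Proposition. Suppose that $H$ is a commutative (not necessarily strongly commutative) Noetherian graded subalgebra of $\mathrm{HH}^{t*}({}_{\psi^*}\Lambda_1,\Lambda)$ with $H^0=Z(\Lambda)$ such that $\mathrm{Ext}_\Lambda^{t*}({}_{\psi^*}M,\Lambda/\mathfrak r)$ is a finitely generated $H$-module. Then there exist an integer $s\ge 1$ and a commutative Noetherian graded subalgebra $H'\subseteq H$ of $\mathrm{HH}^{ts*}({}_{(\psi^s)^*}\Lambda_1,\Lambda)$ with $(H')^0=Z(\Lambda)$ such that $\mathrm{Ext}_\Lambda^{ts*}({}_{(\psi^s)^*}M,\Lambda/\mathfrak r)$ is a finitely generated $H'$-module and every homogeneous element of $H'$ of positive degree is $\psi^s$-invariant. If moreover some positive power of $\psi$ fixes every element of $Z(\Lambda)$, then $s$ and $H'$ can be chosen in addition so that $H'$ is strongly commutative with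 respect to $\psi^s$, that is, so that $\mathbf{Fg}(M,H',\psi^s,ts)$ holds. -/

import Mathlib

open CategoryTheory CategoryTheory.Abelian TensorProduct DirectSum

universe u v

section ExtFacts

universe w₁ w₂ w₃ v₁ v₂ v₃

/-- The short exact sequence `0 ⟶ ΩX ⟶ P ⟶ X ⟶ 0` with `P` a chosen projective object. -/
noncomputable def syzSeq {C : Type v₁} [Category.{w₁} C] [Abelian C] [EnoughProjectives C]
    (X : C) : ShortComplex C :=
  ShortComplex.mk (Limits.kernel.ι (Projective.π X)) (Projective.π X) (Limits.kernel.condition _)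

theorem syzSeq_shortExact {C : Type v₁} [Category.{w₁} C] [Abelian C] [EnoughProjectives C]
    (X : C) : (syzSeq X).ShortExact where
  exact := ShortComplex.exact_of_f_is_kernel _ (Limits.kernelIsKernel _)
  mono_f := by dsimp [syzSeq]; infer_instance
  epi_g := by dsimp [syzSeq]; infer_instance

theorem exists_extClass_comp {C : Type v₁} [Category.{w₁} C] [Abelian C] [EnoughProjectives C]
    [HasExt.{w₂} C] {X Y : C} {n : ℕ} (α : Ext X Y (n + 1)) :
    ∃ β : Ext (syzSeq X).X₁ Y n,
      (syzSeq_shortExact X).extClass.comp β (add_comm 1 n) = α := by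
  apply Ext.contravariant_sequence_exact₃ (syzSeq_shortExact X)
  have : Projective (syzSeq X).X₂ := by dsimp [syzSeq]; infer_instance
  apply Ext.eq_zero_of_projective

theorem ext_induction {C : Type v₁} [Category.{w₁} C] [Abelian C] [EnoughProjectives C]
    [HasExt.{w₂} C] {motive : ∀ (X Y : C) (n : ℕ), Ext X Y n → Prop}
    (h₀ : ∀ (X Y : C) (f : X ⟶ Y), motive X Y 0 (Ext.mk₀ f))
    (h₁ : ∀ (S : ShortComplex C) (hS : S.ShortExact), motive S.X₃ S.X₁ 1 hS.extClass)
    (h : ∀ (X Y Z : C) (a b c : ℕ) (α : Ext X Y a) (β : Ext Y Z b) (e : a + b = c),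
      motive X Y a α → motive Y Z b β → motive X Z c (α.comp β e))
    {X Y : C} {n : ℕ} (α : Ext X Y n) : motive X Y n α := by
  induction n generalizing X with
  | zero =>
    obtain ⟨f, rfl⟩ := (Ext.mk₀_bijective X Y).2 α
    exact h₀ _ _ f
  | succ n ih =>
    obtain ⟨β, rfl⟩ := exists_extClass_comp α
    exact h _ _ _ _ _ _ _ β _ (h₁ _ (syzSeq_shortExact X)) (ih β)

theorem mapExactFunctor_naturality {C : Type v₁} [Category.{w₁} C] [Abelian C]
    [EnoughProjectives C] [HasExt.{w₁} C] {D : Type v₂} [Category.{w₂} D] [Abelian D]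
    [HasExt.{w₂} D] (F G : C ⥤ D) [F.Additive] [Limits.PreservesFiniteLimits F]
    [Limits.PreservesFiniteColimits F] [G.Additive] [Limits.PreservesFiniteLimits G]
    [Limits.PreservesFiniteColimits G] (τ : F ⟶ G) {n : ℕ} {X Y : C} (α : Ext X Y n) :
    (α.mapExactFunctor F).comp (Ext.mk₀ (τ.app Y)) (add_zero n) =
      (Ext.mk₀ (τ.app X)).comp (α.mapExactFunctor G) (zero_add n) := by
  induction α using ext_induction with
  | h₀ X Y f => simp [Ext.mapExactFunctor_mk₀]
  | h₁ S hS =>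
    let φ : S.map F ⟶ S.map G := S.mapNatTrans τ
    have h := ShortComplex.ShortExact.extClass_naturality (hS.map_of_exact F)
      (hS.map_of_exact G) φ
    rw [Ext.mapExactFunctor_extClass, Ext.mapExactFunctor_extClass]
    exact h
  | h X Y Z a b c α β e hα hβ =>
    subst e
    rw [Ext.mapExactFunctor_comp, Ext.mapExactFunctor_comp, Ext.comp_assoc_of_third_deg_zero, hβ,
      ← Ext.comp_assoc (a₁₂ := a) (a₂₃ := b) _ _ _ (by lia) (by lia) (by lia), hα,
      ← Ext.comp_assoc (a₁₂ := a) (a₂₃ := a + b) _ _ _ (by lia) (by lia) (by lia)]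

theorem mapExactFunctor_mapExactFunctor {C : Type v₁} [Category.{w₁} C] [Abelian C]
    [EnoughProjectives C] [HasExt.{w₁} C] {D : Type v₂} [Category.{w₂} D] [Abelian D]
    [HasExt.{w₂} D] {D' : Type v₃} [Category.{w₃} D'] [Abelian D'] [HasExt.{w₃} D']
    (F : C ⥤ D) (G : D ⥤ D') [F.Additive] [Limits.PreservesFiniteLimits F]
    [Limits.PreservesFiniteColimits F] [G.Additive] [Limits.PreservesFiniteLimits G]
    [Limits.PreservesFiniteColimits G] [(F ⋙ G).Additive]
    [Limits.PreservesFiniteLimits (F ⋙ G)] [Limits.PreservesFiniteColimits (F ⋙ G)]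
    {n : ℕ} {X Y : C} (α : Ext X Y n) :
    (α.mapExactFunctor F).mapExactFunctor G = α.mapExactFunctor (F ⋙ G) := by
  induction α using ext_induction with
  | h₀ X Y f => simp [Ext.mapExactFunctor_mk₀]
  | h₁ S hS =>
    rw [Ext.mapExactFunctor_extClass, Ext.mapExactFunctor_extClass]
    exact Ext.mapExactFunctor_extClass G (hS.map_of_exact F)
  | h X Y Z a b c α β e hα hβ =>
    rw [Ext.mapExactFunctor_comp, Ext.mapExactFunctor_comp, Ext.mapExactFunctor_comp, hα, hβ]

theorem mapExactFunctor_id {C : Type v₁} [Category.{w₁} C] [Abelian C]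
    [EnoughProjectives C] [HasExt.{w₁} C] {n : ℕ} {X Y : C} (α : Ext X Y n) :
    α.mapExactFunctor (𝟭 C) = α := by
  induction α using ext_induction with
  | h₀ X Y f => simp [Ext.mapExactFunctor_mk₀]
  | h₁ S hS => rw [Ext.mapExactFunctor_extClass]; rfl
  | h X Y Z a b c α β e hα hβ => rw [Ext.mapExactFunctor_comp, hα, hβ]

end ExtFacts

section TwistedExt

/-- The functor `X ↦ _f X`: on the twisted module `_f X` the scalar `r` acts as `f r` does
on `X`. -/
noncomputable abbrev tw {R : Type u} [Ring R] (f : R →+* R) : ModuleCat.{u} R ⥤ ModuleCat.{u} R :=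
  ModuleCat.restrictScalars f

theorem tw_exact {R : Type u} [Ring R] (f : R →+* R) (S : ShortComplex (ModuleCat.{u} R))
    (h : S.Exact) : (S.map (tw f)).Exact := by
  rw [ShortComplex.ShortExact.moduleCat_exact_iff_function_exact] at h ⊢
  exact h

instance {R : Type u} [Ring R] (f : R →+* R) : Limits.PreservesFiniteLimits (tw f) := by
  have h := ((Functor.exact_tfae (tw f)).out 1 3).mp (tw_exact f)
  exact h.1

instance {R : Type u} [Ring R] (f : R →+* R) : Limits.PreservesFiniteColimits (tw f) := by
  have h := ((Functor.exact_tfae (tw f)).out 1 3).mp (tw_exact f)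
  exact h.2

/-- The canonical identification `_{gf} X = _f (_g X)` (the identity map). -/
noncomputable def twComp {R : Type u} [Ring R] {f g gf : R →+* R} (h : gf = g.comp f)
    (X : ModuleCat.{u} R) : (tw gf).obj X ⟶ (tw f).obj ((tw g).obj X) :=
  (ModuleCat.restrictScalarsComp'App f g gf h X).hom

/-- The canonical identification `_f X = X` for `f = 1` (the identity map). -/
noncomputable def twOne {R : Type u} [Ring R] {f : R →+* R} (h : f = RingHom.id R)
    (X : ModuleCat.{u} R) : (tw f).obj X ⟶ X :=
  (ModuleCat.restrictScalarsId'App f h X).hom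

/-- The canonical identification `_f X = _g X` for `f = g` (the identity map). -/
noncomputable def twCongr {R : Type u} [Ring R] {f g : R →+* R} (h : f = g)
    (X : ModuleCat.{u} R) : (tw f).obj X ⟶ (tw g).obj X :=
  (ModuleCat.restrictScalarsCongr h).hom.app X

/-- The map `Ext_R^n(X, Y) → Ext_R^n(_f X, _f Y)`, `α ↦ _f α`. -/
noncomputable def twExt {R : Type u} [Ring R] (f : R →+* R) {X Y : ModuleCat.{u} R} {n : ℕ}
    (α : Ext X Y n) : Ext ((tw f).obj X) ((tw f).obj Y) n :=
  α.mapExactFunctor (tw f)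

theorem twExt_add {R : Type u} [Ring R] (f : R →+* R) {X Y : ModuleCat.{u} R} {n : ℕ}
    (α β : Ext X Y n) : twExt f (α + β) = twExt f α + twExt f β :=
  Ext.mapExactFunctor_add _ _ _ _ _ _

theorem twExt_zero {R : Type u} [Ring R] (f : R →+* R) {X Y : ModuleCat.{u} R} {n : ℕ} :
    twExt f (0 : Ext X Y n) = 0 :=
  Ext.mapExactFunctor_zero _ _ _ _

theorem twExt_mk₀ {R : Type u} [Ring R] (f : R →+* R) {X Y : ModuleCat.{u} R}
    (g : X ⟶ Y) : twExt f (Ext.mk₀ g) = Ext.mk₀ ((tw f).map g) :=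
  Ext.mapExactFunctor_mk₀ _ _

theorem twExt_comp {R : Type u} [Ring R] (f : R →+* R) {X Y Z : ModuleCat.{u} R} {a b c : ℕ}
    (α : Ext X Y a) (β : Ext Y Z b) (h : a + b = c) :
    twExt f (α.comp β h) = (twExt f α).comp (twExt f β) h :=
  Ext.mapExactFunctor_comp _ _ _ _

theorem twExt_twExt {R : Type u} [Ring R] {f g gf : R →+* R} (h : gf = g.comp f)
    {X Y : ModuleCat.{u} R} {n : ℕ} (α : Ext X Y n) :
    (twExt gf α).comp (Ext.mk₀ (twComp h Y)) (add_zero n) =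
      (Ext.mk₀ (twComp h X)).comp (twExt f (twExt g α)) (zero_add n) := by
  have := mapExactFunctor_naturality (tw gf) (tw g ⋙ tw f)
    (ModuleCat.restrictScalarsComp' f g gf h).hom α
  rw [← mapExactFunctor_mapExactFunctor] at this
  exact this

theorem twExt_one {R : Type u} [Ring R] {f : R →+* R} (h : f = RingHom.id R)
    {X Y : ModuleCat.{u} R} {n : ℕ} (α : Ext X Y n) :
    (twExt f α).comp (Ext.mk₀ (twOne h Y)) (add_zero n) =
      (Ext.mk₀ (twOne h X)).comp α (zero_add n) := by
  have := mapExactFunctor_naturality (tw f) (𝟭 _) (ModuleCat.restrictScalarsId' f h).hom α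
  rw [mapExactFunctor_id] at this
  exact this

/-- `Ext_R^{tn}(_{fⁿ} X, Y)`, the degree `tn` part of `Ext_R^{t*}(_{f^*} X, Y)`. -/
abbrev TwExt {R : Type u} [Ring R] (f : R →+* R) (t : ℕ) (X Y : ModuleCat.{u} R)
    (n : ℕ) : Type u :=
  Ext ((tw (f ^ n)).obj X) Y (t * n)

theorem pow_add_eq_comp {R : Type u} [Ring R] (f : R →+* R) (m n : ℕ) :
    f ^ (m + n) = (f ^ n).comp (f ^ m) := by
  rw [add_comm, pow_add]; rfl

/-- The product `η · θ = η ∘ _{fᵐ}θ` (Yoneda product) of `η ∈ Ext^{tm}(_{fᵐ} X, Y)` and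
`θ ∈ Ext^{tn}(_{fⁿ} Z, X)`. -/
noncomputable def TwExt.mul {R : Type u} [Ring R] {f : R →+* R} {t : ℕ} {X Y Z : ModuleCat.{u} R}
    {m n : ℕ} (η : TwExt f t X Y m) (θ : TwExt f t Z X n) : TwExt f t Z Y (m + n) :=
  (Ext.mk₀ (twComp (pow_add_eq_comp f m n) Z)).comp
    ((twExt (f ^ m) θ).comp η rfl)
    (show 0 + (t * n + t * m) = t * (m + n) by ring)

/-- The identity of `X` as an element of `Ext^0(_{f⁰} X, X)`. -/
noncomputable def TwExt.one {R : Type u} [Ring R] (f : R →+* R) (t : ℕ) (X : ModuleCat.{u} R) :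
    TwExt f t X X 0 :=
  Ext.mk₀ (twOne (pow_zero f) X)

theorem TwExt.mul_add' {R : Type u} [Ring R] {f : R →+* R} {t : ℕ} {X Y Z : ModuleCat.{u} R}
    {m n : ℕ} (η : TwExt f t X Y m) (θ θ' : TwExt f t Z X n) :
    TwExt.mul η (θ + θ') = TwExt.mul η θ + TwExt.mul η θ' := by
  unfold TwExt.mul
  rw [twExt_add, Ext.add_comp, Ext.comp_add]

theorem TwExt.add_mul' {R : Type u} [Ring R] {f : R →+* R} {t : ℕ} {X Y Z : ModuleCat.{u} R}
    {m n : ℕ} (η η' : TwExt f t X Y m) (θ : TwExt f t Z X n) :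
    TwExt.mul (η + η') θ = TwExt.mul η θ + TwExt.mul η' θ := by
  unfold TwExt.mul
  rw [Ext.comp_add, Ext.comp_add]

theorem TwExt.mul_zero' {R : Type u} [Ring R] {f : R →+* R} {t : ℕ} {X Y Z : ModuleCat.{u} R}
    {m n : ℕ} (η : TwExt f t X Y m) :
    TwExt.mul η (0 : TwExt f t Z X n) = 0 := by
  unfold TwExt.mul
  rw [twExt_zero, Ext.zero_comp, Ext.comp_zero]

theorem TwExt.zero_mul' {R : Type u} [Ring R] {f : R →+* R} {t : ℕ} {X Y Z : ModuleCat.{u} R}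
    {m n : ℕ} (θ : TwExt f t Z X n) :
    TwExt.mul (0 : TwExt f t X Y m) θ = 0 := by
  unfold TwExt.mul
  rw [Ext.comp_zero, Ext.comp_zero]

theorem TwExt.mk_eq {R : Type u} [Ring R] {f : R →+* R} {t : ℕ} {X Y : ModuleCat.{u} R}
    {m n : ℕ} (h : m = n) (x : TwExt f t X Y m) (y : TwExt f t X Y n)
    (hxy : x = (Ext.mk₀ (twCongr (congrArg (f ^ ·) h) X)).comp y (by subst h; simp)) :
    GradedMonoid.mk (A := TwExt f t X Y) m x = GradedMonoid.mk n y := by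
  subst h
  congr 1
  rw [hxy]
  exact Ext.mk₀_id_comp (X := (tw (f ^ m)).obj X) _

theorem TwExt.one_mul' {R : Type u} [Ring R] {f : R →+* R} {t : ℕ} {X Y : ModuleCat.{u} R}
    {n : ℕ} (θ : TwExt f t X Y n) :
    GradedMonoid.mk (A := TwExt f t X Y) (0 + n) (TwExt.mul (TwExt.one f t Y) θ) =
      GradedMonoid.mk n θ := by
  apply TwExt.mk_eq (zero_add n)
  unfold TwExt.one TwExt.mul
  have h := twExt_one (pow_zero f) θ
  refine (congrArg (fun z => Ext.comp _ z _) h).trans ?_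
  refine (Ext.comp_assoc _ _ _ (zero_add 0) (zero_add _) (by ring)).symm.trans ?_
  rw [Ext.mk₀_comp_mk₀]
  rfl

theorem TwExt.mul_one' {R : Type u} [Ring R] {f : R →+* R} {t : ℕ} {X Y : ModuleCat.{u} R}
    {n : ℕ} (θ : TwExt f t X Y n) :
    GradedMonoid.mk (A := TwExt f t X Y) (n + 0) (TwExt.mul θ (TwExt.one f t X)) =
      GradedMonoid.mk n θ := by
  apply TwExt.mk_eq (add_zero n)
  unfold TwExt.one TwExt.mul
  have h := twExt_mk₀ (f ^ n) (twOne (pow_zero f) X)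
  refine (congrArg (fun z => Ext.comp _ (Ext.comp (a := t * 0) z _ _) _) h).trans ?_
  refine (Ext.comp_assoc (a₁ := 0) (a₂ := t * 0) (a₁₂ := 0) _ _ _ rfl _ (by ring)).symm.trans ?_
  refine (congrArg (fun z => Ext.comp (a := 0) z _ _) (Ext.mk₀_comp_mk₀ _ _)).trans ?_
  rfl

theorem twComp_assoc {R : Type u} [Ring R] {f : R →+* R} {W : ModuleCat.{u} R} {a b c : ℕ} :
    twComp (pow_add_eq_comp f (a + b) c) W ≫ twComp (pow_add_eq_comp f a b) _ =
      twCongr (congrArg (f ^ ·) (add_assoc a b c)) W ≫ twComp (pow_add_eq_comp f a (b + c)) W ≫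
        (tw (f ^ a)).map (twComp (pow_add_eq_comp f b c) W) := rfl

theorem ext_assoc_aux {C : Type v} [Category.{u} C] [Abelian C] [HasExt.{u} C]
    {W₁ W₂ W₃ V₁ V₂ Z₁ Z₂ X Y : C} {a b c ba ab cb bc d d' n n' : ℕ} (p₁ : Ext W₁ W₂ 0)
    (z₁ : Ext W₂ Z₁ c)
    (p₂ : Ext Z₁ Z₂ 0) (y : Ext Z₂ X b) (x : Ext X Y a) (p₃ : Ext W₂ W₃ 0) (z₂ : Ext W₃ Z₂ c)
    (q₁ : Ext W₁ V₁ 0) (q₂ : Ext V₁ V₂ 0) (q₃ : Ext V₂ W₃ 0)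
    (h : z₁.comp p₂ (add_zero c) = p₃.comp z₂ (zero_add c))
    (h' : p₁.comp p₃ (add_zero 0) = q₁.comp (q₂.comp q₃ (add_zero 0)) (add_zero 0))
    (e₀ : b + a = ba) (e₁ : 0 + ba = ab) (e₂ : c + ab = d) (e₃ : 0 + d = n') (e₄ : c + b = cb)
    (e₅ : 0 + cb = bc) (e₆ : bc + a = d') (e₇ : 0 + d' = n) (e₈ : 0 + n = n') :
    p₁.comp (z₁.comp (p₂.comp (y.comp x e₀) e₁) e₂) e₃ =
      q₁.comp (q₂.comp ((q₃.comp (z₂.comp y e₄) e₅).comp x e₆) e₇) e₈ := by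
  obtain rfl : n' = d := by lia
  obtain rfl : n = n' := by lia
  obtain rfl : d' = n := by lia
  obtain rfl : ba = ab := by lia
  obtain rfl : bc = cb := by lia
  rw [← Ext.comp_assoc (a₁₂ := c) z₁ p₂ _ (by lia) (by lia) (by lia), h,
    Ext.comp_assoc (a₁₂ := c) (a₂₃ := d') p₃ z₂ _ (by lia) (by lia) (by lia),
    ← Ext.comp_assoc (a₁₂ := 0) p₁ p₃ _ (by lia) (by lia) (by lia), h',
    Ext.comp_assoc (a₁₂ := bc) (a₂₃ := d') q₃ _ _ (by lia) (by lia) (by lia),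
    Ext.comp_assoc (a₁₂ := bc) (a₂₃ := ba) z₂ y x (by lia) (by lia) (by lia),
    Ext.comp_assoc (a₁₂ := 0) (a₂₃ := d') q₁ _ _ (by lia) (by lia) (by lia),
    Ext.comp_assoc (a₁₂ := 0) (a₂₃ := d') q₂ _ _ (by lia) (by lia) (by lia)]

theorem TwExt.mul_assoc' {R : Type u} [Ring R] {f : R →+* R} {t : ℕ} {X Y Z W : ModuleCat.{u} R}
    {a b c : ℕ} (x : TwExt f t X Y a) (y : TwExt f t Z X b) (z : TwExt f t W Z c) :
    GradedMonoid.mk (A := TwExt f t W Y) (a + b + c) (TwExt.mul (TwExt.mul x y) z) =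
      GradedMonoid.mk (a + (b + c)) (TwExt.mul x (TwExt.mul y z)) := by
  apply TwExt.mk_eq (add_assoc a b c)
  unfold TwExt.mul
  rw [twExt_comp, twExt_mk₀, twExt_comp]
  have hh : (Ext.mk₀ (twComp (pow_add_eq_comp f (a + b) c) W)).comp
      (Ext.mk₀ (twComp (pow_add_eq_comp f a b) ((tw (f ^ c)).obj W))) (add_zero 0) =
      (Ext.mk₀ (twCongr (congrArg (f ^ ·) (add_assoc a b c)) W)).comp
        ((Ext.mk₀ (twComp (pow_add_eq_comp f a (b + c)) W)).comp
          (Ext.mk₀ ((tw (f ^ a)).map (twComp (pow_add_eq_comp f b c) W))) (add_zero 0))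
          (add_zero 0) := by
    rw [Ext.mk₀_comp_mk₀, Ext.mk₀_comp_mk₀, Ext.mk₀_comp_mk₀]
    exact congrArg Ext.mk₀ twComp_assoc
  exact ext_assoc_aux (a := t * a) (b := t * b) (c := t * c) (n := t * (a + (b + c))) (n' := t * (a + b + c))
    _ (twExt (f ^ (a + b)) z) _ (twExt (f ^ a) y) x _ (twExt (f ^ a) (twExt (f ^ b) z)) _ _ _
    (twExt_twExt (pow_add_eq_comp f a b) z) hh _ _ _ _ _ _ _ _ _

noncomputable instance TwExt.gmul {R : Type u} [Ring R] (f : R →+* R) (t : ℕ)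
    (X : ModuleCat.{u} R) : GradedMonoid.GMul (TwExt f t X X) where
  mul := TwExt.mul

noncomputable instance TwExt.gone {R : Type u} [Ring R] (f : R →+* R) (t : ℕ)
    (X : ModuleCat.{u} R) : GradedMonoid.GOne (TwExt f t X X) where
  one := TwExt.one f t X

noncomputable instance TwExt.gmonoid {R : Type u} [Ring R] (f : R →+* R) (t : ℕ)
    (X : ModuleCat.{u} R) : GradedMonoid.GMonoid (TwExt f t X X) where
  one_mul a := TwExt.one_mul' a.2
  mul_one a := TwExt.mul_one' a.2
  mul_assoc a b c := TwExt.mul_assoc' a.2 b.2 c.2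

noncomputable instance TwExt.gring {R : Type u} [Ring R] (f : R →+* R) (t : ℕ)
    (X : ModuleCat.{u} R) : DirectSum.GRing (TwExt f t X X) where
  toGMonoid := TwExt.gmonoid f t X
  mul_zero := TwExt.mul_zero'
  zero_mul := TwExt.zero_mul'
  mul_add := TwExt.mul_add'
  add_mul := TwExt.add_mul'
  natCast n := n • TwExt.one f t X
  natCast_zero := zero_nsmul _
  natCast_succ n := succ_nsmul _ n
  intCast z := z • TwExt.one f t X
  intCast_ofNat n := natCast_zsmul _ n
  intCast_negSucc_ofNat n := negSucc_zsmul _ n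
end TwistedExt

section Bimodules

/-- The enveloping algebra `Λᵉ = Λ ⊗_k Λᵒᵖ`; its modules are the `Λ`-`Λ`-bimodules on which
`k` acts centrally. -/
abbrev Env (k : Type v) (Λ : Type u) [CommRing k] [Ring Λ] [Algebra k Λ] : Type u :=
  Λ ⊗[k] Λᵐᵒᵖ

/-- `λ ↦ λ ⊗ 1`, through which a bimodule is a left module. -/
abbrev leftInc (k : Type v) (Λ : Type u) [CommRing k] [Ring Λ] [Algebra k Λ] :
    Λ →+* Env k Λ :=
  (Algebra.TensorProduct.includeLeft : Λ →ₐ[k] Λ ⊗[k] Λᵐᵒᵖ).toRingHom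

/-- `λ ↦ 1 ⊗ λ`, through which a bimodule is a right module. -/
abbrev rightInc (k : Type v) (Λ : Type u) [CommRing k] [Ring Λ] [Algebra k Λ] :
    Λᵐᵒᵖ →+* Env k Λ :=
  (Algebra.TensorProduct.includeRight : Λᵐᵒᵖ →ₐ[k] Λ ⊗[k] Λᵐᵒᵖ).toRingHom

variable {k : Type v} {Λ : Type u} [CommRing k] [Ring Λ] [Algebra k Λ]

/-- The left `Λ`-module underlying a bimodule. -/
noncomputable abbrev leftMod (B : ModuleCat.{u} (Env k Λ)) : ModuleCat.{u} Λ :=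
  (ModuleCat.restrictScalars (leftInc k Λ)).obj B

/-- The right `Λ`-module underlying a bimodule. -/
noncomputable abbrev rightMod (B : ModuleCat.{u} (Env k Λ)) : ModuleCat.{u} Λᵐᵒᵖ :=
  (ModuleCat.restrictScalars (rightInc k Λ)).obj B

/-- The right multiplication `b ↦ b λ` on a bimodule. -/
noncomputable def rightMul (B : ModuleCat.{u} (Env k Λ)) (b : leftMod B) (l : Λ) : leftMod B :=
  (rightInc k Λ (MulOpposite.op l) • (show B from b) : B)

theorem rightMul_smul (B : ModuleCat.{u} (Env k Λ)) (a : Λ) (b : leftMod B) (l : Λ) :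
    rightMul B (a • b) l = a • rightMul B b l := by
  change rightInc k Λ (MulOpposite.op l) • (leftInc k Λ a • (show B from b)) =
    leftInc k Λ a • (rightInc k Λ (MulOpposite.op l) • (show B from b))
  rw [smul_smul, smul_smul]
  simp

/-- The submodule of `B ⊗_ℤ M` generated by the elements `bλ ⊗ m - b ⊗ λm`. -/
noncomputable def balancedRel (B : ModuleCat.{u} (Env k Λ)) (M : ModuleCat.{u} Λ) :
    Submodule Λ (leftMod B ⊗[ℤ] M) :=
  Submodule.span Λ {x | ∃ (b : leftMod B) (l : Λ) (m : M),
    x = rightMul B b l ⊗ₜ[ℤ] m - b ⊗ₜ[ℤ] (l • m)}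

/-- The left `Λ`-module `B ⊗_Λ M`. -/
abbrev BalTensor (B : ModuleCat.{u} (Env k Λ)) (M : ModuleCat.{u} Λ) : Type u :=
  (leftMod B ⊗[ℤ] M) ⧸ balancedRel B M

theorem mem_balancedRel (B : ModuleCat.{u} (Env k Λ)) (M : ModuleCat.{u} Λ)
    {x : leftMod B ⊗[ℤ] M} (hx : x ∈ balancedRel B M) :
    x ∈ AddSubgroup.closure {x | ∃ (b : leftMod B) (l : Λ) (m : M),
      x = rightMul B b l ⊗ₜ[ℤ] m - b ⊗ₜ[ℤ] (l • m)} := by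
  suffices h : ∀ a : Λ, a • x ∈ AddSubgroup.closure {x | ∃ (b : leftMod B) (l : Λ) (m : M),
      x = rightMul B b l ⊗ₜ[ℤ] m - b ⊗ₜ[ℤ] (l • m)} by simpa using h 1
  induction hx using Submodule.span_induction with
  | mem x hx =>
    intro a
    obtain ⟨b, l, m, rfl⟩ := hx
    refine AddSubgroup.subset_closure ⟨a • b, l, m, ?_⟩
    rw [smul_sub, TensorProduct.smul_tmul', TensorProduct.smul_tmul', rightMul_smul]
  | zero => intro a; rw [smul_zero]; exact zero_mem _
  | add x y _ _ hx hy => intro a; rw [smul_add]; exact add_mem (hx a) (hy a)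
  | smul c x _ hx => intro a; rw [smul_smul]; exact hx _

/-- The element `b ⊗ m` of `B ⊗_Λ M`. -/
noncomputable def balTmul {B : ModuleCat.{u} (Env k Λ)} {M : ModuleCat.{u} Λ} (b : leftMod B)
    (m : M) : BalTensor B M :=
  (balancedRel B M).mkQ (b ⊗ₜ[ℤ] m)

theorem balTmul_rightMul {B : ModuleCat.{u} (Env k Λ)} {M : ModuleCat.{u} Λ} (b : leftMod B)
    (l : Λ) (m : M) : balTmul (rightMul B b l) m = balTmul b (l • m) :=
  (Submodule.Quotient.eq _).2 (Submodule.subset_span ⟨b, l, m, rfl⟩)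

theorem balTmul_add_left {B : ModuleCat.{u} (Env k Λ)} {M : ModuleCat.{u} Λ} (b b' : leftMod B)
    (m : M) : balTmul (b + b') m = balTmul b m + balTmul b' m := by
  rw [balTmul, TensorProduct.add_tmul, map_add]; rfl

theorem balTmul_add_right {B : ModuleCat.{u} (Env k Λ)} {M : ModuleCat.{u} Λ} (b : leftMod B)
    (m m' : M) : balTmul b (m + m') = balTmul b m + balTmul b m' := by
  rw [balTmul, TensorProduct.tmul_add, map_add]; rfl

theorem balTensor_ext {B : ModuleCat.{u} (Env k Λ)} {M : ModuleCat.{u} Λ} {A : Type u}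
    [AddCommGroup A] {F G : BalTensor B M →+ A}
    (h : ∀ (b : leftMod B) (m : M), F (balTmul b m) = G (balTmul b m)) : F = G := by
  ext x
  obtain ⟨x, rfl⟩ := Submodule.mkQ_surjective _ x
  induction x using TensorProduct.induction_on with
  | zero => simp
  | tmul b m => exact h b m
  | add x y hx hy => rw [map_add, map_add, hx, hy, map_add]

/-- The additive map `B ⊗_Λ M → B' ⊗_Λ M` induced by a map of right modules. -/
noncomputable def balMap {B B' : ModuleCat.{u} (Env k Λ)} (g : rightMod B →ₗ[Λᵐᵒᵖ] rightMod B')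
    (M : ModuleCat.{u} Λ) : BalTensor B M →+ BalTensor B' M :=
  let g' : leftMod B →+ leftMod B' := g.toAddMonoidHom
  let φ : leftMod B ⊗[ℤ] M →+ leftMod B' ⊗[ℤ] M :=
    (TensorProduct.map g'.toIntLinearMap (LinearMap.id (R := ℤ) (M := M))).toAddMonoidHom
  QuotientAddGroup.map (balancedRel B M).toAddSubgroup (balancedRel B' M).toAddSubgroup φ (by
    intro x hx
    have hle : AddSubgroup.closure {x | ∃ (b : leftMod B) (l : Λ) (m : M),
        x = rightMul B b l ⊗ₜ[ℤ] m - b ⊗ₜ[ℤ] (l • m)} ≤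
        ((balancedRel B' M).toAddSubgroup).comap φ := by
      rw [AddSubgroup.closure_le]
      rintro _ ⟨b, l, m, rfl⟩
      refine Submodule.subset_span ⟨g b, l, m, ?_⟩
      have h : g (rightMul B b l) = rightMul B' (g b) l := g.map_smul (MulOpposite.op l) b
      rw [← h, map_sub]
      rfl
    exact hle (mem_balancedRel B M hx))

theorem balMap_balTmul {B B' : ModuleCat.{u} (Env k Λ)} (g : rightMod B →ₗ[Λᵐᵒᵖ] rightMod B')
    (M : ModuleCat.{u} Λ) (b : leftMod B) (m : M) :
    balMap g M (balTmul b m) = balTmul (B := B') (g b) m := rfl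

/-- The map `B ⊗_Λ M → B' ⊗_Λ M` induced by a map of bimodules. -/
noncomputable def balLin {B B' : ModuleCat.{u} (Env k Λ)} (f : B ⟶ B')
    (M : ModuleCat.{u} Λ) : BalTensor B M →ₗ[Λ] BalTensor B' M :=
  Submodule.mapQ _ _ (TensorProduct.AlgebraTensorModule.map
    ((ModuleCat.restrictScalars (leftInc k Λ)).map f).hom (LinearMap.id (R := ℤ) (M := M))) (by
      rw [balancedRel, Submodule.span_le]
      rintro _ ⟨b, l, m, rfl⟩
      refine Submodule.subset_span ⟨f.hom b, l, m, ?_⟩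
      have h : f.hom (rightMul B b l) = rightMul B' (f.hom b) l := f.hom.map_smul _ _
      rw [← h, map_sub]
      rfl)

theorem balLin_balTmul {B B' : ModuleCat.{u} (Env k Λ)} (f : B ⟶ B')
    (M : ModuleCat.{u} Λ) (b : leftMod B) (m : M) :
    balLin f M (balTmul b m) = balTmul (B := B') (f.hom b) m := rfl

theorem balLin_ext {B : ModuleCat.{u} (Env k Λ)} {M : ModuleCat.{u} Λ} {A : Type u}
    [AddCommGroup A] [Module Λ A] {F G : BalTensor B M →ₗ[Λ] A}
    (h : ∀ (b : leftMod B) (m : M), F (balTmul b m) = G (balTmul b m)) : F = G :=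
  LinearMap.toAddMonoidHom_injective (balTensor_ext h)

/-- The functor `- ⊗_Λ M` from bimodules to left modules. -/
noncomputable def tensorFunctor (k : Type v) {Λ : Type u} [CommRing k] [Ring Λ] [Algebra k Λ]
    (M : ModuleCat.{u} Λ) : ModuleCat.{u} (Env k Λ) ⥤ ModuleCat.{u} Λ where
  obj B := ModuleCat.of Λ (BalTensor B M)
  map f := ModuleCat.ofHom (balLin f M)
  map_id _ := ModuleCat.hom_ext (balLin_ext fun _ _ => rfl)
  map_comp _ _ := ModuleCat.hom_ext (balLin_ext fun _ _ => rfl)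

instance (M : ModuleCat.{u} Λ) : (tensorFunctor k M).Additive where
  map_add := ModuleCat.hom_ext (balLin_ext fun _ _ => balTmul_add_left _ _ _)

/-- A short exact sequence of bimodules ending in a bimodule which is projective on the right
splits as a sequence of right modules. -/
theorem exists_right_splitting {S : ShortComplex (ModuleCat.{u} (Env k Λ))}
    (hS : S.ShortExact) (h₃ : Module.Projective Λᵐᵒᵖ (rightMod S.X₃))
    (i : rightMod S.X₁ →ₗ[Λᵐᵒᵖ] rightMod S.X₂)
    (hi' : i = ((ModuleCat.restrictScalars (rightInc k Λ)).map S.f).hom)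
    (p : rightMod S.X₂ →ₗ[Λᵐᵒᵖ] rightMod S.X₃)
    (hp' : p = ((ModuleCat.restrictScalars (rightInc k Λ)).map S.g).hom) :
    ∃ (r : rightMod S.X₂ →ₗ[Λᵐᵒᵖ] rightMod S.X₁) (s : rightMod S.X₃ →ₗ[Λᵐᵒᵖ] rightMod S.X₂),
      (∀ x, r (i x) = x) ∧ (∀ x, i (r x) + s (p x) = x) ∧ ∀ y, p (s y) = y := by
  have hp : Function.Surjective p := by rw [hp']; exact hS.moduleCat_surjective_g
  have hi : Function.Injective i := by rw [hi']; exact hS.moduleCat_injective_f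
  have hex : Function.Exact i p := by
    rw [hi', hp']
    exact (ShortComplex.ShortExact.moduleCat_exact_iff_function_exact S).1 hS.exact
  obtain ⟨s, hs⟩ := p.exists_rightInverse_of_surjective (LinearMap.range_eq_top.2 hp)
  have hs' : ∀ y, p (s y) = y := fun y => LinearMap.congr_fun hs y
  let q : rightMod S.X₂ →ₗ[Λᵐᵒᵖ] rightMod S.X₂ := LinearMap.id - s.comp p
  have hmem : ∀ x, q x ∈ LinearMap.range i := by
    intro x
    rw [LinearMap.mem_range]
    refine (hex _).1 ?_
    simp [q, hs']
  let r : rightMod S.X₂ →ₗ[Λᵐᵒᵖ] rightMod S.X₁ :=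
    (LinearEquiv.ofInjective i hi).symm.toLinearMap.comp
      (LinearMap.codRestrict (LinearMap.range i) q hmem)
  have hr : ∀ x, i (r x) = x - s (p x) := fun x =>
    LinearEquiv.ofInjective_symm_apply (f := i) (h := hi)
      (LinearMap.codRestrict (LinearMap.range i) q hmem x)
  refine ⟨r, s, fun x => hi ?_, fun x => ?_, hs'⟩
  · rw [hr, hex.apply_apply_eq_zero, map_zero, sub_zero]
  · rw [hr, sub_add_cancel]

/-- `- ⊗_Λ M` keeps a short exact sequence of bimodules exact if its last term is projective
as a right module. -/
theorem tensorFunctor_shortExact (M : ModuleCat.{u} Λ) {S : ShortComplex (ModuleCat.{u} (Env k Λ))}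
    (hS : S.ShortExact) (h₃ : Module.Projective Λᵐᵒᵖ (rightMod S.X₃)) :
    (S.map (tensorFunctor k M)).ShortExact := by
  obtain ⟨r, s, hri, hirs, hps⟩ := exists_right_splitting hS h₃ _ rfl _ rfl
  let i : rightMod S.X₁ →ₗ[Λᵐᵒᵖ] rightMod S.X₂ :=
    ((ModuleCat.restrictScalars (rightInc k Λ)).map S.f).hom
  let p : rightMod S.X₂ →ₗ[Λᵐᵒᵖ] rightMod S.X₃ :=
    ((ModuleCat.restrictScalars (rightInc k Λ)).map S.g).hom
  have e₁ : (balMap r M).comp (balMap i M) = AddMonoidHom.id _ := balTensor_ext fun b m =>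
    congrArg (fun z => balTmul (B := S.X₁) z m) (hri b)
  have e₂ : (balMap i M).comp (balMap r M) + (balMap s M).comp (balMap p M) =
      AddMonoidHom.id _ := balTensor_ext fun b m =>
    (balTmul_add_left (B := S.X₂) (i (r b)) (s (p b)) m).symm.trans
      (congrArg (fun z => balTmul (B := S.X₂) z m) (hirs b))
  have e₃ : (balMap p M).comp (balMap s M) = AddMonoidHom.id _ := balTensor_ext fun b m =>
    congrArg (fun z => balTmul (B := S.X₃) z m) (hps b)
  have hT₁ : Function.Injective (balMap i M) := by
    intro x y hxy
    have := congrArg (balMap r M) hxy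
    rwa [← AddMonoidHom.comp_apply, ← AddMonoidHom.comp_apply, e₁] at this
  have hT₂ : ∀ x, balMap p M x = 0 → balMap i M (balMap r M x) = x := by
    intro x hx
    have h := DFunLike.congr_fun e₂ x
    simpa [hx] using h
  have hT₃ : Function.Surjective (balMap p M) := fun y =>
    ⟨balMap s M y, DFunLike.congr_fun e₃ y⟩
  have f₁ : ∀ x, balMap i M x = balLin S.f M x := fun x => DFunLike.congr_fun
    (balTensor_ext (G := (balLin S.f M).toAddMonoidHom) fun b m => rfl) x
  have f₂ : ∀ x, balMap p M x = balLin S.g M x := fun x => DFunLike.congr_fun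
    (balTensor_ext (G := (balLin S.g M).toAddMonoidHom) fun b m => rfl) x
  have m₁ : Mono (S.map (tensorFunctor k M)).f := by
    rw [ModuleCat.mono_iff_injective]
    intro x y hxy
    exact hT₁ ((f₁ x).trans (Eq.trans hxy (f₁ y).symm))
  have m₂ : Epi (S.map (tensorFunctor k M)).g := by
    rw [ModuleCat.epi_iff_surjective]
    intro y
    obtain ⟨x, hx⟩ := hT₃ y
    exact ⟨x, (f₂ x).symm.trans hx⟩
  refine { exact := ?_ }
  rw [ShortComplex.moduleCat_exact_iff]
  intro x hx
  exact ⟨balMap r M x, (f₁ _).symm.trans (hT₂ x ((f₂ x).trans hx))⟩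

/-- A projective bimodule is projective as a right module, when `Λ` is projective over `k`. -/
theorem rightMod_projective [Module.Projective k Λ] (P : ModuleCat.{u} (Env k Λ))
    (hP : Projective P) : Module.Projective Λᵐᵒᵖ (rightMod P) := by
  have hE : Module.Projective Λᵐᵒᵖ (rightMod (ModuleCat.of (Env k Λ) (Env k Λ))) := by
    have e : (Λᵐᵒᵖ ⊗[k] Λ) ≃ₗ[Λᵐᵒᵖ] rightMod (ModuleCat.of (Env k Λ) (Env k Λ)) :=
      { (TensorProduct.comm k Λᵐᵒᵖ Λ).toAddEquiv with
        map_smul' := fun a x => by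
          change TensorProduct.comm k Λᵐᵒᵖ Λ (a • x) =
            ((1 : Λ) ⊗ₜ[k] a) * (TensorProduct.comm k Λᵐᵒᵖ Λ x)
          induction x using TensorProduct.induction_on with
          | zero => simp
          | tmul y z => simp [TensorProduct.smul_tmul']
          | add x y hx hy => rw [smul_add, map_add, map_add, hx, hy, mul_add] }
    exact Module.Projective.of_equiv' e
  have hP' : Module.Projective (Env k Λ) P := (IsProjective.iff_projective P).2 hP
  obtain ⟨s, hs⟩ := hP'
  classical
  let E := rightMod (ModuleCat.of (Env k Λ) (Env k Λ))
  have : Module.Projective Λᵐᵒᵖ (P →₀ E) := Module.Projective.of_equiv' (finsuppLequivDFinsupp Λᵐᵒᵖ).symm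
  refine Module.Projective.of_split (M := P →₀ E)
    { toFun := fun x => s x
      map_add' := fun x y => s.map_add x y
      map_smul' := fun a x => s.map_smul (rightInc k Λ a) x }
    { toFun := fun x => Finsupp.linearCombination (Env k Λ) id x
      map_add' := fun x y => (Finsupp.linearCombination (Env k Λ) id).map_add x y
      map_smul' := fun a x => (Finsupp.linearCombination (Env k Λ) id).map_smul (rightInc k Λ a) x }
    (LinearMap.ext hs)

/-- The syzygy of a right projective bimodule is right projective. -/
theorem syz_rightProjective [Module.Projective k Λ] (B : ModuleCat.{u} (Env k Λ))
    (hB : Module.Projective Λᵐᵒᵖ (rightMod B)) :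
    Module.Projective Λᵐᵒᵖ (rightMod (syzSeq B).X₁) := by
  obtain ⟨r, s, hri, -, -⟩ := exists_right_splitting (syzSeq_shortExact B) hB _ rfl _ rfl
  have : Module.Projective Λᵐᵒᵖ (rightMod (syzSeq B).X₂) :=
    rightMod_projective _ (Projective.projective_over B)
  exact Module.Projective.of_split _ r (LinearMap.ext hri)

/-- The map `Ext_{Λᵉ}^n(B, B') → Ext_Λ^n(B ⊗_Λ M, B' ⊗_Λ M)`, `η ↦ η ⊗_Λ M`, for a bimodule `B`
which is projective as a right module. In degree `0` this is the functor `- ⊗_Λ M` on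
homomorphisms. For `n + 1`, the element `η` is the Yoneda product of the class of
`0 ⟶ ΩB ⟶ P ⟶ B ⟶ 0`, with `P` projective, with an element of `Ext^n(ΩB, B')`; the tensored
sequence `0 ⟶ ΩB ⊗ M ⟶ P ⊗ M ⟶ B ⊗ M ⟶ 0` is again exact, and `η ⊗_Λ M` is the Yoneda product of
its class with the tensored element of `Ext^n(ΩB, B')`. -/
noncomputable def tensorExt [Module.Projective k Λ] (M : ModuleCat.{u} Λ) :
    ∀ (n : ℕ) {B B' : ModuleCat.{u} (Env k Λ)} (_ : Module.Projective Λᵐᵒᵖ (rightMod B)),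
      Ext B B' n → Ext ((tensorFunctor k M).obj B) ((tensorFunctor k M).obj B') n
  | 0, _, _, _, η => Ext.mk₀ ((tensorFunctor k M).map (Ext.homEquiv₀ η))
  | n + 1, B, _, hB, η =>
    (tensorFunctor_shortExact M (syzSeq_shortExact B) hB).extClass.comp
      (tensorExt M n (syz_rightProjective B hB) (exists_extClass_comp η).choose) (add_comm 1 n)

end Bimodules

section TwistedHochschild

/-- `Λ` as a bimodule over itself. -/
noncomputable def regBimod (k : Type v) (Λ : Type u) [CommRing k] [Ring Λ] [Algebra k Λ] :
    ModuleCat.{u} (Env k Λ) :=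
  letI : Module (Env k Λ) Λ := TensorProduct.Algebra.module
  ModuleCat.of (Env k Λ) Λ

variable {k : Type v} {Λ : Type u} [CommRing k] [Ring Λ] [Algebra k Λ]

/-- The identity map from `Λ` to the underlying set of the bimodule `Λ`. -/
def toReg (k : Type v) (Λ : Type u) [CommRing k] [Ring Λ] [Algebra k Λ] :
    Λ ≃+ regBimod k Λ :=
  AddEquiv.refl Λ

theorem smul_toReg (a : Λ) (b : Λᵐᵒᵖ) (x : Λ) :
    (show Env k Λ from a ⊗ₜ[k] b) • toReg k Λ x = toReg k Λ (a * x * b.unop) := by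
  let _ : Module (Env k Λ) Λ := TensorProduct.Algebra.module
  refine (TensorProduct.Algebra.smul_def a b x).trans ?_
  rw [smul_eq_mul, MulOpposite.smul_eq_mul_unop, ← mul_assoc]
  rfl

/-- The automorphism `ψ ⊗ 1` of `Λᵉ`. The functor `tw (leftTw ψ)` is `B ↦ _ψ B_1`. -/
noncomputable def leftTw (ψ : Λ ≃ₐ[k] Λ) : Env k Λ →+* Env k Λ :=
  (Algebra.TensorProduct.map (ψ : Λ →ₐ[k] Λ) (AlgHom.id k Λᵐᵒᵖ)).toRingHom

/-- The automorphism `1 ⊗ ψ` of `Λᵉ`. The functor `tw (rightTw ψ)` is `B ↦ _1 B_ψ`. -/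
noncomputable def rightTw (ψ : Λ ≃ₐ[k] Λ) : Env k Λ →+* Env k Λ :=
  (Algebra.TensorProduct.map (AlgHom.id k Λ) (AlgHom.op (ψ : Λ →ₐ[k] Λ))).toRingHom

theorem leftTw_tmul (ψ : Λ ≃ₐ[k] Λ) (a : Λ) (b : Λᵐᵒᵖ) :
    leftTw ψ (a ⊗ₜ b) = ψ a ⊗ₜ b := rfl

theorem rightTw_tmul (ψ : Λ ≃ₐ[k] Λ) (a : Λ) (b : Λ) :
    rightTw ψ (a ⊗ₜ MulOpposite.op b) = a ⊗ₜ MulOpposite.op (ψ b) := rfl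

theorem leftTw_pow_tmul (ψ : Λ ≃ₐ[k] Λ) (n : ℕ) (a : Λ) (b : Λᵐᵒᵖ) :
    (leftTw ψ ^ n) (a ⊗ₜ b) = ((ψ : Λ →+* Λ) ^ n) a ⊗ₜ b := by
  induction n generalizing a with
  | zero => simp
  | succ n ih =>
    rw [pow_succ, pow_succ, RingHom.mul_def, RingHom.mul_def, RingHom.comp_apply,
      RingHom.comp_apply, leftTw_tmul, ih]
    rfl

theorem leftTw_pow (ψ : Λ ≃ₐ[k] Λ) (s n : ℕ) : leftTw (ψ ^ s) ^ n = leftTw ψ ^ (s * n) := by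
  have h : leftTw (ψ ^ s) = leftTw ψ ^ s := by
    refine RingHom.ext fun x => ?_
    induction x using TensorProduct.induction_on with
    | zero => simp
    | tmul a b =>
      rw [leftTw_tmul, leftTw_pow_tmul]
      congr 1
      induction s generalizing a with
      | zero => simp
      | succ s ih =>
        rw [pow_succ, pow_succ, RingHom.mul_def, RingHom.comp_apply, ← ih]
        rfl
    | add x y hx hy => rw [map_add, map_add, hx, hy]
  rw [h, pow_mul]

/-- The twisted bimodule `_{ψⁿ} Λ_1`. -/
noncomputable abbrev twReg (ψ : Λ ≃ₐ[k] Λ) (n : ℕ) : ModuleCat.{u} (Env k Λ) :=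
  (tw (leftTw ψ ^ n)).obj (regBimod k Λ)

theorem twReg_rightProjective (ψ : Λ ≃ₐ[k] Λ) (n : ℕ) :
    Module.Projective Λᵐᵒᵖ (rightMod (twReg ψ n)) := by
  have e : Λᵐᵒᵖ ≃ₗ[Λᵐᵒᵖ] rightMod (twReg ψ n) :=
    { MulOpposite.opAddEquiv.symm.trans (toReg k Λ) with
      map_smul' := fun a x => by
        change toReg k Λ (a * x).unop =
          (leftTw ψ ^ n) ((1 : Λ) ⊗ₜ[k] a) • toReg k Λ x.unop
        rw [leftTw_pow_tmul, smul_toReg]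
        simp }
  exact Module.Projective.of_equiv' e

/-- The degree `tn` part `HH^{tn}(_{ψⁿ}Λ_1, Λ) = Ext_{Λᵉ}^{tn}(_{ψⁿ}Λ_1, Λ)` of the twisted
Hochschild cohomology ring. -/
abbrev HHdeg (ψ : Λ ≃ₐ[k] Λ) (t n : ℕ) : Type u :=
  TwExt (leftTw ψ) t (regBimod k Λ) (regBimod k Λ) n

/-- The twisted Hochschild cohomology ring `HH^{t*}(_{ψ^*}Λ_1, Λ)`, with the product
`η · θ = η ∘ _{ψᵐ}θ` for `η` of degree `tm`. -/
abbrev HHtw (ψ : Λ ≃ₐ[k] Λ) (t : ℕ) : Type u :=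
  ⨁ n, HHdeg ψ t n

/-- The map `_{ψⁿ}M → _{ψⁿ}Λ_1 ⊗_Λ M`, `m ↦ 1 ⊗ m`. -/
noncomputable def toTensor (ψ : Λ ≃ₐ[k] Λ) (n : ℕ) (M : ModuleCat.{u} Λ) :
    (tw ((ψ : Λ →+* Λ) ^ n)).obj M ⟶ (tensorFunctor k M).obj (twReg ψ n) :=
  let f : (tw ((ψ : Λ →+* Λ) ^ n)).obj M →ₗ[Λ] BalTensor (twReg ψ n) M :=
    { toFun := fun m => balTmul (B := twReg ψ n) (toReg k Λ 1) (show M from m)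
      map_add' := fun x y => balTmul_add_right (B := twReg ψ n) (M := M) (toReg k Λ 1) x y
      map_smul' := fun a m => by
        have h : rightMul (twReg ψ n) (toReg k Λ 1) (((ψ : Λ →+* Λ) ^ n) a) =
            (a • (show leftMod (twReg ψ n) from toReg k Λ 1) : leftMod (twReg ψ n)) := by
          change (leftTw ψ ^ n) ((1 : Λ) ⊗ₜ[k] MulOpposite.op (((ψ : Λ →+* Λ) ^ n) a)) • toReg k Λ 1 =
            (leftTw ψ ^ n) (a ⊗ₜ[k] 1) • toReg k Λ 1
          rw [leftTw_pow_tmul, leftTw_pow_tmul, smul_toReg, smul_toReg]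
          simp
        refine (balTmul_rightMul (B := twReg ψ n) (M := M) (toReg k Λ 1)
          (((ψ : Λ →+* Λ) ^ n) a) m).symm.trans ?_
        rw [h]
        rfl }
  ModuleCat.ofHom (X := (tw ((ψ : Λ →+* Λ) ^ n)).obj M) f

/-- The map `Λ ⊗_Λ M → M`, `λ ⊗ m ↦ λm`. -/
noncomputable def ofTensor (k : Type v) {Λ : Type u} [CommRing k] [Ring Λ] [Algebra k Λ]
    (M : ModuleCat.{u} Λ) : (tensorFunctor k M).obj (regBimod k Λ) ⟶ M :=
  let g : leftMod (regBimod k Λ) →ₗ[Λ] M →ₗ[ℤ] M :=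
    { toFun := fun l => (DistribSMul.toAddMonoidHom M ((toReg k Λ).symm l)).toIntLinearMap
      map_add' := fun x y => by
        ext m
        exact (congrArg (· • m) ((toReg k Λ).symm.map_add x y)).trans (add_smul _ _ _)
      map_smul' := fun a x => by
        ext m
        change (toReg k Λ).symm ((a ⊗ₜ[k] (1 : Λᵐᵒᵖ) : Env k Λ) • toReg k Λ ((toReg k Λ).symm x)) • m =
          a • (toReg k Λ).symm x • m
        rw [smul_toReg, smul_smul]
        simp }
  ModuleCat.ofHom (X := BalTensor (regBimod k Λ) M) (Submodule.liftQ _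
    (TensorProduct.AlgebraTensorModule.lift g) (by
      rw [balancedRel, Submodule.span_le]
      rintro _ ⟨b, l, m, rfl⟩
      have h : (toReg k Λ).symm (rightMul (regBimod k Λ) b l) = (toReg k Λ).symm b * l := by
        change (toReg k Λ).symm (((1 : Λ) ⊗ₜ[k] MulOpposite.op l : Env k Λ) •
          toReg k Λ ((toReg k Λ).symm b)) = _
        rw [smul_toReg]
        simp
      change TensorProduct.AlgebraTensorModule.lift g _ = 0
      rw [map_sub]
      change (toReg k Λ).symm (rightMul (regBimod k Λ) b l) • m - (toReg k Λ).symm b • l • m = 0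
      rw [h, mul_smul, sub_self]))

/-- `η ⊗_Λ M ∈ Ext_Λ^{tn}(_{ψⁿ}M, M)` for `η ∈ HH^{tn}(_{ψⁿ}Λ_1, Λ)`. -/
noncomputable def tens [Module.Projective k Λ] {ψ : Λ ≃ₐ[k] Λ} {t n : ℕ} (M : ModuleCat.{u} Λ)
    (η : HHdeg ψ t n) : TwExt (ψ : Λ →+* Λ) t M M n :=
  (Ext.mk₀ (toTensor ψ n M)).comp
    ((tensorExt M (t * n) (twReg_rightProjective ψ n) η).comp
      (Ext.mk₀ (ofTensor k M)) (add_zero _)) (zero_add _)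

/-- The right scalar action of `η ∈ HH^{tn}(_{ψⁿ}Λ_1, Λ)` on
`Ext_Λ^{t*}(_{ψ^*}M, N) = ⨁ Ext_Λ^{tm}(_{ψᵐ}M, N)`: `ζ · η = ζ ∘ _{ψᵐ}(η ⊗_Λ M)` for `ζ` of
degree `tm`. -/
noncomputable def actRight [Module.Projective k Λ] {ψ : Λ ≃ₐ[k] Λ} {t n : ℕ}
    (M N : ModuleCat.{u} Λ) (η : HHdeg ψ t n) :
    (⨁ m, TwExt (ψ : Λ →+* Λ) t M N m) →+ ⨁ m, TwExt (ψ : Λ →+* Λ) t M N m :=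
  DirectSum.toAddMonoid fun m =>
    (DirectSum.of (TwExt (ψ : Λ →+* Λ) t M N) (m + n)).comp
      (AddMonoidHom.mk' (fun ζ => TwExt.mul ζ (tens M η)) fun ζ ζ' => TwExt.add_mul' ζ ζ' _)

/-- The `HH`-module `Ext_Λ^{t*}(_{ψ^*}M, N)` is finitely generated over the graded subring `H`:
some finite subset is contained in no proper additive subgroup that is stable under the action of
the homogeneous elements of `H`. -/
def ExtFG [Module.Projective k Λ] {ψ : Λ ≃ₐ[k] Λ} {t : ℕ} (M N : ModuleCat.{u} Λ)
    (H : Subring (HHtw ψ t)) : Prop :=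
  ∃ S : Finset (⨁ m, TwExt (ψ : Λ →+* Λ) t M N m),
    ∀ V : AddSubgroup (⨁ m, TwExt (ψ : Λ →+* Λ) t M N m), (∀ ζ ∈ S, ζ ∈ V) →
      (∀ (n : ℕ) (η : HHdeg ψ t n), DirectSum.of (HHdeg ψ t) n η ∈ H →
        ∀ ζ ∈ V, actRight M N η ζ ∈ V) → V = ⊤

end TwistedHochschild

section Fg

variable {k : Type v} {Λ : Type u} [CommRing k] [Ring Λ] [Algebra k Λ]

/-- The isomorphism of bimodules `ψ⁻¹ : _{ψⁿ⁺¹}Λ_1 → _{ψⁿ}Λ_{ψ⁻¹}`. -/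
noncomputable def srcTwist (ψ : Λ ≃ₐ[k] Λ) (n : ℕ) :
    twReg ψ (n + 1) ⟶ (tw (rightTw ψ.symm)).obj (twReg ψ n) :=
  let f : twReg ψ (n + 1) →ₗ[Env k Λ] (tw (rightTw ψ.symm)).obj (twReg ψ n) :=
    { toFun := fun x => toReg k Λ (ψ.symm ((toReg k Λ).symm x))
      map_add' := fun x y => by
        refine (congrArg (fun z => toReg k Λ (ψ.symm z)) ((toReg k Λ).symm.map_add x y)).trans ?_
        rw [map_add, map_add]
        rfl
      map_smul' := fun e x => by
        change toReg k Λ (ψ.symm ((toReg k Λ).symm ((leftTw ψ ^ (n + 1)) e •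
          toReg k Λ ((toReg k Λ).symm x)))) =
          (leftTw ψ ^ n) (rightTw ψ.symm e) • toReg k Λ (ψ.symm ((toReg k Λ).symm x))
        generalize (toReg k Λ).symm x = y
        induction e using TensorProduct.induction_on with
        | zero =>
          simp only [map_zero]
          exact congrArg (toReg k Λ) ((congrArg _ (map_zero (toReg k Λ).symm)).trans (map_zero _))
        | tmul a b =>
          induction b using MulOpposite.rec' with
          | h b =>
            rw [rightTw_tmul, leftTw_pow_tmul, leftTw_pow_tmul, smul_toReg, smul_toReg, pow_succ',
              RingHom.mul_def, RingHom.comp_apply]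
            simp
        | add e e' h h' =>
          simp only [map_add, add_smul] at h h' ⊢
          rw [h, h'] }
  ModuleCat.ofHom (X := twReg ψ (n + 1)) (Y := (tw (rightTw ψ.symm)).obj (twReg ψ n)) f

/-- The isomorphism of bimodules `ψ : _1Λ_{ψ⁻¹} → _ψΛ_1`. -/
noncomputable def tgtTwist (ψ : Λ ≃ₐ[k] Λ) :
    (tw (rightTw ψ.symm)).obj (regBimod k Λ) ⟶ (tw (leftTw ψ)).obj (regBimod k Λ) :=
  let f : (tw (rightTw ψ.symm)).obj (regBimod k Λ) →ₗ[Env k Λ]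
      (tw (leftTw ψ)).obj (regBimod k Λ) :=
    { toFun := fun x => toReg k Λ (ψ ((toReg k Λ).symm x))
      map_add' := fun x y => by
        refine (congrArg (fun z => toReg k Λ (ψ z)) ((toReg k Λ).symm.map_add x y)).trans ?_
        rw [map_add, map_add]
        rfl
      map_smul' := fun e x => by
        change toReg k Λ (ψ ((toReg k Λ).symm (rightTw ψ.symm e •
          toReg k Λ ((toReg k Λ).symm x)))) =
          leftTw ψ e • toReg k Λ (ψ ((toReg k Λ).symm x))
        generalize (toReg k Λ).symm x = y
        induction e using TensorProduct.induction_on with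
        | zero =>
          simp only [map_zero]
          exact congrArg (toReg k Λ) ((congrArg _ (map_zero (toReg k Λ).symm)).trans (map_zero _))
        | tmul a b =>
          induction b using MulOpposite.rec' with
          | h b =>
            rw [rightTw_tmul, leftTw_tmul, smul_toReg, smul_toReg]
            simp
        | add e e' h h' =>
          simp only [map_add, add_smul] at h h' ⊢
          rw [h, h'] }
  ModuleCat.ofHom (X := (tw (rightTw ψ.symm)).obj (regBimod k Λ))
    (Y := (tw (leftTw ψ)).obj (regBimod k Λ)) f

/-- The relation `η_{ψ⁻¹} = _ψη` for `η ∈ Ext_{Λᵉ}^{tn}(_{ψⁿ}Λ_1, Λ)`: the element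
`η_{ψ⁻¹} ∈ Ext_{Λᵉ}^{tn}(_{ψⁿ}Λ_{ψ⁻¹}, _1Λ_{ψ⁻¹})` is viewed as an element of
`Ext_{Λᵉ}^{tn}(_{ψⁿ⁺¹}Λ_1, _ψΛ_1)` through the isomorphisms `ψ⁻¹ : _{ψⁿ⁺¹}Λ_1 → _{ψⁿ}Λ_{ψ⁻¹}` and
`ψ : _1Λ_{ψ⁻¹} → _ψΛ_1`. -/
def TwistInvariant {ψ : Λ ≃ₐ[k] Λ} {t n : ℕ} (η : HHdeg ψ t n) : Prop :=
  (Ext.mk₀ (srcTwist ψ n)).comp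
      ((twExt (rightTw ψ.symm) η).comp (Ext.mk₀ (tgtTwist ψ)) (add_zero _)) (zero_add _) =
    (Ext.mk₀ (twComp (show leftTw ψ ^ (n + 1) = (leftTw ψ ^ n).comp (leftTw ψ) from pow_succ _ _)
      (regBimod k Λ))).comp (twExt (leftTw ψ) η) (zero_add _)

/-- A commutative subring `H` of `HH^{t*}(_{ψ^*}Λ_1, Λ)` is strongly commutative if
`η_{ψ⁻¹} = _ψη` for all homogeneous `η ∈ H`. -/
def StronglyCommutative {ψ : Λ ≃ₐ[k] Λ} {t : ℕ} (H : Subring (HHtw ψ t)) : Prop :=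
  (∀ x ∈ H, ∀ y ∈ H, x * y = y * x) ∧
    ∀ (n : ℕ) (η : HHdeg ψ t n), DirectSum.of (HHdeg ψ t) n η ∈ H → TwistInvariant η

/-- `H` is a commutative Noetherian graded subalgebra of `HH^{t*}(_{ψ^*}Λ_1, Λ)` whose degree zero
part is all of `HH^0(Λ, Λ) = Z(Λ)` (so that `H` is closed under scalars from `k`), and
`Ext_Λ^{t*}(_{ψ^*}M, Λ/𝔯)`, with `𝔯` the Jacobson radical, is a finitely generated `H`-module. -/
structure FgCommutative [Module.Projective k Λ] (M : ModuleCat.{u} Λ) {ψ : Λ ≃ₐ[k] Λ} {t : ℕ}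
    (H : Subring (HHtw ψ t)) : Prop where
  graded : ∀ x ∈ H, ∀ n : ℕ, DirectSum.of (HHdeg ψ t) n (x n) ∈ H
  comm : ∀ x ∈ H, ∀ y ∈ H, x * y = y * x
  noetherian : IsNoetherianRing H
  degree_zero : ∀ z : HHdeg ψ t 0, DirectSum.of (HHdeg ψ t) 0 z ∈ H
  finite : ExtFG M (ModuleCat.of Λ (Λ ⧸ Ring.jacobson Λ)) H

/-- The finite generation hypothesis `Fg(M, H, ψ, t)`. -/
def Fg [Module.Projective k Λ] (M : ModuleCat.{u} Λ) (ψ : Λ ≃ₐ[k] Λ) (t : ℕ)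
    (H : Subring (HHtw ψ t)) : Prop :=
  FgCommutative M H ∧ StronglyCommutative H

/-- The identification of the degree `(ts)n` part `Ext_{Λᵉ}^{(ts)n}(_{(ψˢ)ⁿ}Λ_1, Λ)` of
`HH^{ts*}(_{(ψˢ)^*}Λ_1, Λ)` with the degree `t(sn)` part of `HH^{t*}(_{ψ^*}Λ_1, Λ)`. -/
noncomputable def HHincl (ψ : Λ ≃ₐ[k] Λ) (t s n : ℕ) (η : HHdeg (ψ ^ s) (t * s) n) :
    HHdeg ψ t (s * n) :=
  (Ext.mk₀ (twCongr (leftTw_pow ψ s n).symm (regBimod k Λ))).comp η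
    (show 0 + t * s * n = t * (s * n) by ring)

end Fg

/-! Elements of `H` need not be invariant, but a product of two elements of degree `t` always is.
Applied to `ψˢ` and `ts`, this says that the product of two elements of degree `ts` is
`ψˢ`-invariant. It therefore suffices to find `s` such that `H` is finite over the subring that such
products generate over `H⁰`.

Invariance of products. The tensor product `X ⊗_Λ B` is a bifunctor on bimodules, exact in `B` for
right projective `X`, and exact in `X` on short exact sequences whose last term is right projective.
Hence an extension in the left variable and one in the right variable interchange up to the sign
`(-1)^(ab)` (`relExt_comp_mapExactFunctor`); the sign comes from the anticommuting connecting
classes of a `3 × 3` diagram (`extClass_anticommute`). With `Λ ⊗ B = B`, `X ⊗ Λ = X`, `X ⊗ _ψΛ =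
X_{ψ⁻¹}` and `_{ψᵐ}Λ ⊗ B = _{ψᵐ}B`, the law becomes `y ∘ σ(x) = ± x ∘ _{ψᵐ}y`, where `σ(x)` is
`x_{ψ⁻¹}` transported to a class with source `_{ψᵐ⁺¹}Λ_1` and target `_ψΛ_1` (`rightTwist_comp`).
For `x` and `y` both of degree `t`, write `σ(x) = _ψx'`. Then the transport of `(x · y)_{ψ⁻¹}` is
`σ(x) ∘ _ψσ(y) = _ψ(x' ∘ σ(y)) = ± _ψ(y ∘ σ(x)) = _ψ(x ∘ _ψy)`: the relation is used twice and the
signs cancel (`twist_invariant_aux`, `twistInvariant_mul`).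

The subring. A degree zero element need not be invariant, yet `H'` has to contain the whole centre.
So `H'` consists of the elements of `H` in degrees divisible by `ts` whose positive components stay
invariant after multiplication by every element of degree zero (`invariantSubgroup`,
`invariantSubring`). This is a ring because products of invariant elements are invariant
(`TwistInvariant.mul`). It contains the products of two elements of degree `ts`, because multiplying
the first factor by an element of degree zero does not change its degree.

Finiteness. `H` is generated over `H⁰` by finitely many homogeneous `g` of positive degrees `m_g`.
If every `m_g` divides `s`, then `g^(2s/m_g)` is a product of two elements of degree `s`, so `H` is
integral and of finite type, hence finite, over the subalgebra of these powers, which is Noetherian;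
both `H'` and the finiteness of `H` over it follow (`exists_degree_noetherian_subring`). The action
of the Hochschild ring on `Ext` is multiplicative (`tens_mul`, `actHom_mul`), and the part of `Ext`
in degrees divisible by `ts` is the image of a projection compatible with the action
(`exists_veronese_projection`), so finite generation over `H` passes to `H'` (`extFG_of_finite`).

Strong commutativity. In degree zero, invariance is implied by the automorphism fixing the centre
pointwise (`twistInvariant_of_degree_zero`); if `ψʳ` does so, `s` is taken to be a multiple of `r`.
-/

set_option linter.unusedSectionVars false

/-! ### Maps on Ext induced by functors exact only on sequences with a good last term -/

section RelativeExt

universe w₁ w₂ w₃ v₁ v₂ v₃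

variable {C : Type v₁} [Category.{w₁} C] [Abelian C] [EnoughProjectives C] [HasExt.{w₁} C]
  {D : Type v₂} [Category.{w₂} D] [Abelian D] [HasExt.{w₂} D]

/-- The additive functor `F` preserves short exact sequences whose last term satisfies `P`,
and `P` is closed under syzygies. -/
structure RelExact (F : C ⥤ D) [F.Additive] (P : C → Prop) : Prop where
  shortExact : ∀ {S : ShortComplex C}, S.ShortExact → P S.X₃ → (S.map F).ShortExact
  syz : ∀ X : C, P X → P (syzSeq X).X₁

/-- The class of `0 ⟶ ΩX ⟶ P ⟶ X ⟶ 0`. -/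
noncomputable def syzClass (X : C) : Ext X (syzSeq X).X₁ 1 :=
  (syzSeq_shortExact X).extClass

theorem exists_syzClass_comp {X Y : C} {n : ℕ} (α : Ext X Y (n + 1)) :
    ∃ β : Ext (syzSeq X).X₁ Y n, (syzClass X).comp β (add_comm 1 n) = α :=
  exists_extClass_comp α

/-- The class of the image under `F` of a short exact sequence whose last term satisfies `P`. -/
noncomputable def RelExact.extClass {F : C ⥤ D} [F.Additive] {P : C → Prop} (hF : RelExact F P)
    {S : ShortComplex C} (hS : S.ShortExact) (h₃ : P S.X₃) : Ext (F.obj S.X₃) (F.obj S.X₁) 1 :=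
  (hF.shortExact hS h₃).extClass

/-- The class of `0 ⟶ F(ΩX) ⟶ F(P) ⟶ F(X) ⟶ 0`. -/
noncomputable def RelExact.syzClass {F : C ⥤ D} [F.Additive] {P : C → Prop} (hF : RelExact F P)
    {X : C} (hX : P X) : Ext (F.obj X) (F.obj (syzSeq X).X₁) 1 :=
  hF.extClass (syzSeq_shortExact X) hX

theorem RelExact.extClass_naturality {F : C ⥤ D} [F.Additive] {P : C → Prop} (hF : RelExact F P)
    {S S' : ShortComplex C} (hS : S.ShortExact) (hS' : S'.ShortExact) (h₃ : P S.X₃)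
    (h₃' : P S'.X₃) (φ : S ⟶ S') :
    (hF.extClass hS h₃).comp (Ext.mk₀ (F.map φ.τ₁)) (add_zero 1) =
      (Ext.mk₀ (F.map φ.τ₃)).comp (hF.extClass hS' h₃') (zero_add 1) :=
  ShortComplex.ShortExact.extClass_naturality (hF.shortExact hS h₃) (hF.shortExact hS' h₃')
    (F.mapShortComplex.map φ)

theorem RelExact.extClass_natTrans {F G : C ⥤ D} [F.Additive] [G.Additive] {P Q : C → Prop}
    (hF : RelExact F P) (hG : RelExact G Q) (τ : F ⟶ G) {S : ShortComplex C} (hS : S.ShortExact)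
    (h₃ : P S.X₃) (h₃' : Q S.X₃) :
    (hF.extClass hS h₃).comp (Ext.mk₀ (τ.app S.X₁)) (add_zero 1) =
      (Ext.mk₀ (τ.app S.X₃)).comp (hG.extClass hS h₃') (zero_add 1) :=
  ShortComplex.ShortExact.extClass_naturality (hF.shortExact hS h₃) (hG.shortExact hS h₃')
    (S.mapNatTrans τ)

theorem RelExact.syzClass_natTrans {F G : C ⥤ D} [F.Additive] [G.Additive] {P Q : C → Prop}
    (hF : RelExact F P) (hG : RelExact G Q) (τ : F ⟶ G) {X : C} (hX : P X) (hX' : Q X) :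
    (hF.syzClass hX).comp (Ext.mk₀ (τ.app (syzSeq X).X₁)) (add_zero 1) =
      (Ext.mk₀ (τ.app X)).comp (hG.syzClass hX') (zero_add 1) :=
  hF.extClass_natTrans hG τ (syzSeq_shortExact X) hX hX'

/-- The map induced on `Ext^n(X, Y)`, for `X` satisfying `P`, by a functor which preserves short
exact sequences whose last term satisfies `P`. -/
noncomputable def relExt {F : C ⥤ D} [F.Additive] {P : C → Prop} (hF : RelExact F P) :
    ∀ (n : ℕ) {X Y : C} (_ : P X), Ext X Y n → Ext (F.obj X) (F.obj Y) n
  | 0, _, _, _, η => Ext.mk₀ (F.map (Ext.homEquiv₀ η))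
  | n + 1, X, _, hX, η =>
    (hF.syzClass hX).comp
      (relExt hF n (hF.syz X hX) (exists_syzClass_comp η).choose) (add_comm 1 n)

instance (X : C) : Projective (syzSeq X).X₂ := by
  dsimp [syzSeq]; infer_instance

/-- The comparison step for syzygies: projectivity lifts the map to the middle terms, and the kernel
property of the target sequence restricts it to the left terms. -/
theorem exists_shortComplex_hom {S S' : ShortComplex C} [Projective S.X₂]
    (hS' : S'.ShortExact) (h : S.X₃ ⟶ S'.X₃) : ∃ φ : S ⟶ S', φ.τ₃ = h := by
  have := hS'.epi_g
  have := hS'.mono_f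
  let a : S.X₂ ⟶ S'.X₂ := Projective.factorThru (S.g ≫ h) S'.g
  have ha : a ≫ S'.g = S.g ≫ h := Projective.factorThru_comp _ _
  obtain ⟨b, hb⟩ := Limits.KernelFork.IsLimit.lift' hS'.fIsKernel (S.f ≫ a)
    (by rw [Category.assoc, ha, S.zero_assoc, Limits.zero_comp])
  exact ⟨⟨b, a, h, hb, ha⟩, rfl⟩

variable {F : C ⥤ D} [F.Additive] {P : C → Prop} (hF : RelExact F P)

/-- A morphism lifts to the chosen syzygy sequences. -/
theorem RelExact.exists_syz_hom {X' X : C} (hX' : P X') (hX : P X) (f : X' ⟶ X) :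
    ∃ g : (syzSeq X').X₁ ⟶ (syzSeq X).X₁,
      (_root_.syzClass X').comp (Ext.mk₀ g) (add_zero 1) =
        (Ext.mk₀ f).comp (_root_.syzClass X) (zero_add 1) ∧
      (hF.syzClass hX').comp (Ext.mk₀ (F.map g)) (add_zero 1) =
        (Ext.mk₀ (F.map f)).comp (hF.syzClass hX) (zero_add 1) := by
  obtain ⟨φ, rfl⟩ := exists_shortComplex_hom (S := syzSeq X') (syzSeq_shortExact X) f
  exact ⟨φ.τ₁, ShortComplex.ShortExact.extClass_naturality _ _ φ,
    hF.extClass_naturality _ _ hX' hX φ⟩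

theorem relExt_mk₀ {X Y : C} (hX : P X) (f : X ⟶ Y) :
    relExt hF 0 hX (Ext.mk₀ f) = Ext.mk₀ (F.map f) := by
  rw [relExt]
  congr 2
  exact Ext.homEquiv₀.apply_symm_apply f

theorem relExt_zero_add {X Y : C} (hX : P X) (α β : Ext X Y 0) :
    relExt hF 0 hX (α + β) = relExt hF 0 hX α + relExt hF 0 hX β := by
  obtain ⟨f, rfl⟩ := (Ext.mk₀_bijective X Y).2 α
  obtain ⟨g, rfl⟩ := (Ext.mk₀_bijective X Y).2 β
  rw [← Ext.mk₀_add, relExt_mk₀, relExt_mk₀, relExt_mk₀, F.map_add, Ext.mk₀_add]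

/-- This removes the choice in the recursive definition of `relExt`. Two lifts of the same class
differ by the restriction of a class on the projective middle term. In positive degree that class is
zero; in degree zero the difference factors through the inclusion of the syzygy, and `F` of that
inclusion is killed by the connecting class of the image sequence. -/
theorem relExt_wellDefined (n : ℕ) {X Y : C} (hX : P X) (β β' : Ext (syzSeq X).X₁ Y n)
    (h : (syzClass X).comp β (add_comm 1 n) = (syzClass X).comp β' (add_comm 1 n)) :
    (hF.syzClass hX).comp (relExt hF n (hF.syz X hX) β) (add_comm 1 n) =
      (hF.syzClass hX).comp (relExt hF n (hF.syz X hX) β') (add_comm 1 n) := by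
  have h' : (syzClass X).comp (β - β') (add_comm 1 n) = 0 := by
    rw [sub_eq_add_neg, Ext.comp_add, Ext.comp_neg, h, add_neg_cancel]
  obtain ⟨γ, hγ⟩ := Ext.contravariant_sequence_exact₁ (syzSeq_shortExact X) _ (β - β')
    (add_comm 1 n) h'
  cases n with
  | zero =>
    obtain ⟨g, rfl⟩ := (Ext.mk₀_bijective _ _).2 γ
    obtain rfl : β = β' + Ext.mk₀ ((syzSeq X).f ≫ g) := by
      rw [← Ext.mk₀_comp_mk₀, hγ]; abel
    rw [relExt_zero_add, Ext.comp_add, relExt_mk₀, F.map_comp, ← Ext.mk₀_comp_mk₀,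
      add_eq_left]
    exact (hF.shortExact (syzSeq_shortExact X) hX).extClass_comp_assoc _
  | succ n =>
    rw [Ext.eq_zero_of_projective γ, Ext.comp_zero] at hγ
    rw [sub_eq_zero.1 hγ.symm]

theorem relExt_syz (n : ℕ) {X Y : C} (hX : P X) (β : Ext (syzSeq X).X₁ Y n) {m : ℕ}
    (hm : 1 + n = m) :
    relExt hF m hX ((syzClass X).comp β hm) =
      (hF.syzClass hX).comp (relExt hF n (hF.syz X hX) β) hm := by
  obtain rfl : m = n + 1 := by lia
  exact relExt_wellDefined hF n hX _ β (exists_syzClass_comp _).choose_spec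

theorem relExt_add (n : ℕ) {X Y : C} (hX : P X) (α β : Ext X Y n) :
    relExt hF n hX (α + β) = relExt hF n hX α + relExt hF n hX β := by
  induction n generalizing X with
  | zero => exact relExt_zero_add hF hX α β
  | succ n ih =>
    obtain ⟨α, rfl⟩ := exists_syzClass_comp α
    obtain ⟨β, rfl⟩ := exists_syzClass_comp β
    rw [← Ext.comp_add, relExt_syz, relExt_syz, relExt_syz, ih, Ext.comp_add]

theorem relExt_mk₀_comp {n : ℕ} {X' X Y : C} (hX' : P X') (hX : P X) (f : X' ⟶ X)
    (α : Ext X Y n) :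
    relExt hF n hX' ((Ext.mk₀ f).comp α (zero_add n)) =
      (Ext.mk₀ (F.map f)).comp (relExt hF n hX α) (zero_add n) := by
  induction n generalizing X X' with
  | zero =>
    obtain ⟨g, rfl⟩ := (Ext.mk₀_bijective _ _).2 α
    rw [Ext.mk₀_comp_mk₀, relExt_mk₀, relExt_mk₀, F.map_comp, Ext.mk₀_comp_mk₀]
  | succ n ih =>
    obtain ⟨α, rfl⟩ := exists_syzClass_comp α
    obtain ⟨g, h₁, h₂'⟩ := hF.exists_syz_hom hX' hX f
    rw [relExt_syz, ← Ext.comp_assoc (a₁₂ := 1) _ _ _ (by lia) (by lia) (by lia), ← h₁,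
      Ext.comp_assoc (a₂₃ := n) _ _ _ (by lia) (by lia) (by lia), relExt_syz,
      ih (hF.syz _ hX') (hF.syz _ hX),
      ← Ext.comp_assoc (a₁₂ := 1) _ _ _ (by lia) (by lia) (by lia), h₂',
      Ext.comp_assoc (a₂₃ := n + 1) _ _ _ (by lia) (by lia) (by lia)]

/-- Peeling syzygy classes off the first factor leaves a morphism in degree zero, which is handled
by lifting it to the syzygy sequences (`relExt_mk₀_comp`). Both sources have to satisfy `P`; the
final target does not. -/
theorem relExt_comp {a b c : ℕ} {X Y Z : C} (hX : P X) (hY : P Y) (α : Ext X Y a)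
    (β : Ext Y Z b) (h : a + b = c) :
    relExt hF c hX (α.comp β h) = (relExt hF a hX α).comp (relExt hF b hY β) h := by
  induction a generalizing X c with
  | zero =>
    obtain ⟨f, rfl⟩ := (Ext.mk₀_bijective _ _).2 α
    obtain rfl : b = c := by lia
    rw [relExt_mk₀, relExt_mk₀_comp hF hX hY]
  | succ a ih =>
    obtain ⟨α, rfl⟩ := exists_syzClass_comp α
    rw [Ext.comp_assoc (a₂₃ := a + b) _ _ _ (by lia) (by lia) (by lia), relExt_syz, relExt_syz,
      ih (hF.syz _ hX), Ext.comp_assoc (a₂₃ := a + b) _ _ _ (by lia) (by lia) (by lia)]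

/-- A natural transformation gives a compatibility between the induced maps on `Ext`. -/
theorem relExt_naturality {G : C ⥤ D} [G.Additive] (hG : RelExact G P) (τ : F ⟶ G) {n : ℕ}
    {X Y : C} (hX : P X) (α : Ext X Y n) :
    (relExt hF n hX α).comp (Ext.mk₀ (τ.app Y)) (add_zero n) =
      (Ext.mk₀ (τ.app X)).comp (relExt hG n hX α) (zero_add n) := by
  induction n generalizing X with
  | zero =>
    obtain ⟨f, rfl⟩ := (Ext.mk₀_bijective _ _).2 α
    rw [relExt_mk₀, relExt_mk₀, Ext.mk₀_comp_mk₀, Ext.mk₀_comp_mk₀, τ.naturality]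
  | succ n ih =>
    obtain ⟨α, rfl⟩ := exists_syzClass_comp α
    have h := hF.syzClass_natTrans hG τ hX hX
    rw [relExt_syz, relExt_syz, Ext.comp_assoc (a₂₃ := n) _ _ _ (by lia) (by lia) (by lia),
      ih, ← Ext.comp_assoc (a₁₂ := 1) _ _ _ (by lia) (by lia) (by lia), h,
      Ext.comp_assoc (a₂₃ := n + 1) _ _ _ (by lia) (by lia) (by lia)]

theorem mapExactFunctor_syzClass [Limits.PreservesFiniteLimits F]
    [Limits.PreservesFiniteColimits F] {X : C} (hX : P X) :
    (syzClass X).mapExactFunctor F = hF.syzClass hX :=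
  Ext.mapExactFunctor_extClass F (syzSeq_shortExact X)

/-- For a functor that is exact outright nothing new is obtained, so `relExt_naturality` can compare
a relatively exact functor with a twist or with the identity. -/
theorem relExt_eq_mapExactFunctor [Limits.PreservesFiniteLimits F]
    [Limits.PreservesFiniteColimits F] {n : ℕ} {X Y : C} (hX : P X) (α : Ext X Y n) :
    relExt hF n hX α = α.mapExactFunctor F := by
  induction n generalizing X with
  | zero =>
    obtain ⟨f, rfl⟩ := (Ext.mk₀_bijective _ _).2 α
    rw [relExt_mk₀, Ext.mapExactFunctor_mk₀]
  | succ n ih =>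
    obtain ⟨α, rfl⟩ := exists_syzClass_comp α
    rw [relExt_syz, Ext.mapExactFunctor_comp, mapExactFunctor_syzClass hF hX, ih]

variable {E : Type v₃} [Category.{w₃} E] [Abelian E] [HasExt.{w₃} E]

theorem RelExact.comp_exact (hF : RelExact F P) (G : D ⥤ E) [G.Additive] [Limits.PreservesFiniteLimits G]
    [Limits.PreservesFiniteColimits G] : RelExact (F ⋙ G) P where
  shortExact hS h := (hF.shortExact hS h).map_of_exact G
  syz := hF.syz

theorem RelExact.mapExactFunctor_syzClass (G : D ⥤ E) [G.Additive]
    [Limits.PreservesFiniteLimits G] [Limits.PreservesFiniteColimits G]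
    (hFG : RelExact (F ⋙ G) P) {X : C} (hX : P X) :
    (hF.syzClass hX).mapExactFunctor G = hFG.syzClass hX :=
  Ext.mapExactFunctor_extClass G (hF.shortExact (syzSeq_shortExact X) hX)

theorem relExt_comp_exact (G : D ⥤ E) [G.Additive] [Limits.PreservesFiniteLimits G]
    [Limits.PreservesFiniteColimits G] (hFG : RelExact (F ⋙ G) P) {n : ℕ} {X Y : C} (hX : P X)
    (α : Ext X Y n) :
    relExt hFG n hX α = (relExt hF n hX α).mapExactFunctor G := by
  induction n generalizing X with
  | zero =>
    obtain ⟨f, rfl⟩ := (Ext.mk₀_bijective _ _).2 α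
    rw [relExt_mk₀, relExt_mk₀, Ext.mapExactFunctor_mk₀]
    rfl
  | succ n ih =>
    obtain ⟨α, rfl⟩ := exists_syzClass_comp α
    rw [relExt_syz, relExt_syz, Ext.mapExactFunctor_comp, hF.mapExactFunctor_syzClass G hFG hX,
      ih]

/-- The recursion defining `relExt` uses the chosen syzygy sequence, but any short exact sequence
with end terms satisfying `P` may replace it: the syzygy sequence maps to it over the identity, and
both connecting classes are pushed forward accordingly. This is needed because an exact functor
sends chosen syzygy sequences to sequences that are not chosen. -/
theorem relExt_extClass_comp {n m : ℕ} {S : ShortComplex C} (hS : S.ShortExact) {Y : C}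
    (h₃ : P S.X₃) (h₁ : P S.X₁) (β : Ext S.X₁ Y n) (hm : 1 + n = m) :
    relExt hF m h₃ (hS.extClass.comp β hm) =
      (hF.extClass hS h₃).comp (relExt hF n h₁ β) hm := by
  obtain ⟨φ, hφ⟩ := exists_shortComplex_hom (S := syzSeq S.X₃) hS (𝟙 S.X₃)
  have e₁ : (syzClass S.X₃).comp (Ext.mk₀ φ.τ₁) (add_zero 1) = hS.extClass := by
    refine (ShortComplex.ShortExact.extClass_naturality (syzSeq_shortExact S.X₃) hS φ).trans ?_
    rw [hφ]
    exact Ext.mk₀_id_comp hS.extClass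
  have e₂ : (hF.syzClass h₃).comp (Ext.mk₀ (F.map φ.τ₁)) (add_zero 1) = hF.extClass hS h₃ := by
    refine (hF.extClass_naturality (syzSeq_shortExact S.X₃) hS h₃ h₃ φ).trans ?_
    rw [hφ]
    refine (congrArg (fun f => (Ext.mk₀ f).comp _ _) (F.map_id _)).trans ?_
    exact Ext.mk₀_id_comp _
  rw [← e₁, ← e₂, Ext.comp_assoc (a₂₃ := n) _ _ _ (by lia) (by lia) (by lia), relExt_syz,
    relExt_mk₀_comp hF (hF.syz _ h₃) h₁, Ext.comp_assoc (a₂₃ := n) _ _ _ (by lia) (by lia) (by lia)]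

theorem RelExact.exact_comp {C' : Type v₃} [Category.{w₃} C'] [Abelian C'] [EnoughProjectives C']
    {P' : C' → Prop} (hF : RelExact F P) (K : C' ⥤ C) [K.Additive]
    [Limits.PreservesFiniteLimits K] [Limits.PreservesFiniteColimits K]
    (hK : ∀ X, P' X → P (K.obj X)) (hP' : ∀ X, P' X → P' (syzSeq X).X₁) :
    RelExact (K ⋙ F) P' where
  shortExact hS h := hF.shortExact (hS.map_of_exact K) (hK _ h)
  syz := hP'

theorem relExt_exact_comp {C' : Type v₃} [Category.{w₃} C'] [Abelian C'] [EnoughProjectives C']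
    [HasExt.{w₃} C'] {P' : C' → Prop} (K : C' ⥤ C) [K.Additive]
    [Limits.PreservesFiniteLimits K] [Limits.PreservesFiniteColimits K]
    (hK : ∀ X, P' X → P (K.obj X)) (hKF : RelExact (K ⋙ F) P') {n : ℕ} {X Y : C'} (hX : P' X)
    (α : Ext X Y n) :
    relExt hKF n hX α = relExt hF n (hK X hX) (α.mapExactFunctor K) := by
  induction n generalizing X with
  | zero =>
    obtain ⟨f, rfl⟩ := (Ext.mk₀_bijective _ _).2 α
    rw [relExt_mk₀, Ext.mapExactFunctor_mk₀, relExt_mk₀]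
    rfl
  | succ n ih =>
    obtain ⟨α, rfl⟩ := exists_syzClass_comp α
    rw [relExt_syz, ih]
    -- The image under `K` of the chosen sequence of `X` is not the chosen sequence of `K X`, so
    -- `relExt_extClass_comp` takes the place of `relExt_syz`.
    refine Eq.trans ?_ (congrArg (relExt hF _ (hK X hX)) ((Ext.mapExactFunctor_comp K (syzClass X)
      α (add_comm 1 n)).trans (congrArg (fun z => Ext.comp z _ _)
      (Ext.mapExactFunctor_extClass K (syzSeq_shortExact X))))).symm
    exact (relExt_extClass_comp hF ((syzSeq_shortExact X).map_of_exact K) (hK X hX)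
      (hK _ (hKF.syz X hX)) _ _).symm

end RelativeExt

/-! ### Signs for connecting classes -/

section Anticommutativity

variable {R : Type v} [Ring R]

theorem ext_comp_zsmul {D : Type v} [Category.{u} D] [Abelian D] [HasExt.{u} D] {X Y Z : D}
    {a b c : ℕ} (α : Ext X Y a) (n : ℤ) (β : Ext Y Z b) (h : a + b = c) :
    α.comp (n • β) h = n • α.comp β h :=
  map_zsmul ((Ext.bilinearComp X Y Z a b c h) α) n β

theorem ext_zsmul_comp {D : Type v} [Category.{u} D] [Abelian D] [HasExt.{u} D] {X Y Z : D}
    {a b c : ℕ} (n : ℤ) (α : Ext X Y a) (β : Ext Y Z b) (h : a + b = c) :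
    (n • α).comp β h = n • α.comp β h :=
  map_zsmul ((Ext.bilinearComp X Y Z a b c h).flip β) n α

/-- The connecting classes of a `3 × 3` diagram with exact rows and columns anticommute. -/
theorem extClass_anticommute [HasExt.{u} (ModuleCat.{u} R)] {R₁ R₂ R₃ : ShortComplex (ModuleCat.{u} R)} (φ : R₁ ⟶ R₂) (χ : R₂ ⟶ R₃)
    (w₁ : φ.τ₁ ≫ χ.τ₁ = 0) (w₃ : φ.τ₃ ≫ χ.τ₃ = 0)
    (h₁ : R₁.ShortExact) (h₂ : R₂.ShortExact) (h₃ : R₃.ShortExact)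
    (c₁ : (ShortComplex.mk φ.τ₁ χ.τ₁ w₁).ShortExact) (w₂ : φ.τ₂ ≫ χ.τ₂ = 0)
    (c₃ : (ShortComplex.mk φ.τ₃ χ.τ₃ w₃).ShortExact) :
    c₃.extClass.comp h₁.extClass (show 1 + 1 = 2 from rfl) =
      -h₃.extClass.comp c₁.extClass (show 1 + 1 = 2 from rfl) := by
  have := h₁.mono_f; have := h₁.epi_g; have := h₂.epi_g; have := h₂.mono_f
  have := h₃.mono_f; have := c₃.mono_f; have := c₃.epi_g
  have : Mono φ.τ₃ := c₃.mono_f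
  have : Epi χ.τ₃ := c₃.epi_g
  have inj₁ := (ModuleCat.mono_iff_injective R₁.f).1 inferInstance
  have surj₁ := (ModuleCat.epi_iff_surjective R₁.g).1 inferInstance
  have inj₂ := (ModuleCat.mono_iff_injective R₂.f).1 inferInstance
  have injφ := (ModuleCat.mono_iff_injective φ.τ₃).1 inferInstance
  have ex₁ := (ShortComplex.moduleCat_exact_iff R₁).1 h₁.exact
  have ex₂ := (ShortComplex.moduleCat_exact_iff R₂).1 h₂.exact
  have ex₃ := (ShortComplex.moduleCat_exact_iff _).1 c₃.exact
  -- The diagonal from the centre of the diagram to its last corner. Its kernel maps by `l` to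
  -- `R₁.X₃` and by `l'` to `R₃.X₁`, so its class pushes forward to the last column along `l` and to
  -- the last row along `l'`.
  let q : R₂.X₂ ⟶ R₃.X₃ := R₂.g ≫ χ.τ₃
  let κ : ShortComplex (ModuleCat.{u} R) := ShortComplex.mk (Limits.kernel.ι q) q (Limits.kernel.condition q)
  have hκ : κ.ShortExact :=
    { exact := ShortComplex.exact_of_f_is_kernel _ (Limits.kernelIsKernel q)
      mono_f := by dsimp [κ]; infer_instance
      epi_g := by dsimp [κ, q]; infer_instance }
  obtain ⟨l, hl⟩ := Limits.KernelFork.IsLimit.lift' c₃.fIsKernel (κ.f ≫ R₂.g)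
    (by rw [Category.assoc]; exact κ.zero)
  obtain ⟨l', hl'⟩ := Limits.KernelFork.IsLimit.lift' h₃.fIsKernel (κ.f ≫ χ.τ₂)
    (by rw [Category.assoc, χ.comm₂₃]; exact κ.zero)
  replace hl : l ≫ φ.τ₃ = κ.f ≫ R₂.g := hl
  replace hl' : l' ≫ R₃.f = κ.f ≫ χ.τ₂ := hl'
  let P : ModuleCat.{u} R := ModuleCat.of R (R₁.X₂ × R₂.X₁)
  -- The kernel of the diagonal is the sum of the images of `R₁.X₂` and `R₂.X₁`, which meet in the
  -- image of `R₁.X₁`. The minus sign makes the composite to the kernel vanish and is the source of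
  -- the sign in the conclusion.
  let a : R₁.X₁ ⟶ P := ModuleCat.ofHom (R₁.f.hom.prod (-φ.τ₁.hom))
  let pr₁ : P ⟶ R₁.X₂ := ModuleCat.ofHom (LinearMap.fst R R₁.X₂ R₂.X₁)
  let pr₂ : P ⟶ R₂.X₁ := ModuleCat.ofHom (LinearMap.snd R R₁.X₂ R₂.X₁)
  let b' : P ⟶ R₂.X₂ := pr₁ ≫ φ.τ₂ + pr₂ ≫ R₂.f
  have hb' : b' ≫ q = 0 := by
    simp only [b', q, Preadditive.add_comp, Category.assoc, R₂.zero_assoc, Limits.zero_comp,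
      Limits.comp_zero, add_zero]
    rw [← Category.assoc φ.τ₂, φ.comm₂₃, Category.assoc, w₃, Limits.comp_zero, Limits.comp_zero]
  obtain ⟨b, hb⟩ := Limits.KernelFork.IsLimit.lift' hκ.fIsKernel b' hb'
  replace hb : b ≫ κ.f = b' := hb
  have : Mono κ.f := hκ.mono_f
  have hap₁ : a ≫ pr₁ = R₁.f := rfl
  have hap₂ : a ≫ pr₂ = -φ.τ₁ := rfl
  have hab : a ≫ b = 0 := by
    rw [← cancel_mono κ.f, Category.assoc, hb, Limits.zero_comp]
    simp only [b', Preadditive.comp_add, reassoc_of% hap₁, reassoc_of% hap₂, Preadditive.neg_comp,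
      φ.comm₁₂, add_neg_cancel]
  have hel : ∀ p : P, κ.f (b p) = φ.τ₂ p.1 + R₂.f p.2 := fun p =>
    DFunLike.congr_fun (congrArg ModuleCat.Hom.hom hb) p
  have injκ := (ModuleCat.mono_iff_injective κ.f).1 inferInstance
  have zR₂ : ∀ y, R₂.g (R₂.f y) = 0 := fun y =>
    DFunLike.congr_fun (congrArg ModuleCat.Hom.hom R₂.zero) y
  let ε : ShortComplex (ModuleCat.{u} R) := ShortComplex.mk a b hab
  have hε : ε.ShortExact := by
    refine { exact := ?_, mono_f := ?_, epi_g := ?_ }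
    · rw [ShortComplex.moduleCat_exact_iff]
      intro p hp
      change b p = 0 at hp
      have hp' : φ.τ₂ p.1 + R₂.f p.2 = 0 := by rw [← hel, hp, map_zero]
      have hs : R₁.g p.1 = 0 := by
        apply injφ
        rw [map_zero, ← ConcreteCategory.comp_apply, ← φ.comm₂₃, ConcreteCategory.comp_apply]
        have := congrArg R₂.g hp'
        rwa [map_add, map_zero, zR₂, add_zero] at this
      obtain ⟨x, hx⟩ := ex₁ p.1 hs
      refine ⟨x, Prod.ext hx (inj₂ ?_)⟩
      change R₂.f (-φ.τ₁ x) = R₂.f p.2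
      rw [map_neg, ← ConcreteCategory.comp_apply, φ.comm₁₂, ConcreteCategory.comp_apply, hx]
      exact neg_eq_of_add_eq_zero_right hp'
    · rw [ModuleCat.mono_iff_injective]
      intro x y hxy
      exact inj₁ (congrArg Prod.fst hxy)
    · rw [ModuleCat.epi_iff_surjective]
      intro z
      have hz : χ.τ₃ (R₂.g (κ.f z)) = 0 :=
        DFunLike.congr_fun (congrArg ModuleCat.Hom.hom κ.zero) z
      obtain ⟨w, hw⟩ := ex₃ _ hz
      obtain ⟨x, rfl⟩ := surj₁ w
      obtain ⟨y, hy⟩ := ex₂ (κ.f z - φ.τ₂ x) (by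
        change φ.τ₃ (R₁.g x) = R₂.g (κ.f z) at hw
        rw [map_sub, ← hw, ← ConcreteCategory.comp_apply φ.τ₂, φ.comm₂₃,
          ConcreteCategory.comp_apply, sub_self])
      refine ⟨(x, y), injκ ?_⟩
      refine (hel (x, y)).trans ?_
      change φ.τ₂ x + R₂.f y = _
      rw [hy, add_sub_cancel]
  have e₁ : hκ.extClass.comp (Ext.mk₀ l) (add_zero 1) = c₃.extClass := by
    refine (ShortComplex.ShortExact.extClass_naturality hκ c₃
      ⟨l, R₂.g, 𝟙 _, hl, Category.comp_id _ |>.symm⟩).trans ?_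
    exact Ext.mk₀_id_comp _
  have e₂ : hκ.extClass.comp (Ext.mk₀ l') (add_zero 1) = h₃.extClass := by
    refine (ShortComplex.ShortExact.extClass_naturality hκ h₃
      ⟨l', χ.τ₂, 𝟙 _, hl', χ.comm₂₃.trans (Category.comp_id _).symm⟩).trans ?_
    exact Ext.mk₀_id_comp _
  -- The same sequence `ε` is the pullback of the first row along `l` and, up to sign, of the first
  -- column along `l'`; both products in the statement are therefore the class of `κ` followed by
  -- plus or minus that of `ε`.
  have e₃ : (Ext.mk₀ l).comp h₁.extClass (zero_add 1) = hε.extClass := by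
    refine (ShortComplex.ShortExact.extClass_naturality hε h₁
      ⟨𝟙 _, pr₁, l, (Category.id_comp _).trans hap₁.symm, ?_⟩).symm.trans ?_
    · rw [← cancel_mono φ.τ₃, Category.assoc, Category.assoc, hl]
      refine Eq.trans ?_ (congrArg (· ≫ R₂.g) hb).symm |>.trans (Category.assoc _ _ _)
      simp [b', φ.comm₂₃]
    · exact Ext.comp_mk₀_id _
  have e₄ : (Ext.mk₀ l').comp c₁.extClass (zero_add 1) = -hε.extClass := by
    refine (ShortComplex.ShortExact.extClass_naturality hε c₁
      ⟨-𝟙 _, pr₂, l', ?_, ?_⟩).symm.trans ?_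
    · change (-𝟙 _) ≫ φ.τ₁ = a ≫ pr₂
      rw [hap₂, Preadditive.neg_comp, Category.id_comp]
    · change pr₂ ≫ χ.τ₁ = b ≫ l'
      rw [← cancel_mono R₃.f, Category.assoc, Category.assoc, hl', ← Category.assoc b, hb]
      simp [b', w₂, χ.comm₁₂]
    · rw [Ext.mk₀_neg, Ext.comp_neg]
      exact congrArg _ (Ext.comp_mk₀_id _)
  rw [← e₁, ← e₂, Ext.comp_assoc (a₂₃ := 1) _ _ _ (by lia) (by lia) (by lia),
    Ext.comp_assoc (a₂₃ := 1) _ _ _ (by lia) (by lia) (by lia)]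
  refine (congrArg (fun z => Ext.comp _ z _) e₃).trans ?_
  refine Eq.trans ?_ (congrArg (fun z => -Ext.comp _ z _) e₄).symm
  rw [Ext.comp_neg, neg_neg]

universe v₁

variable {C : Type v₁} [Category.{u} C] [Abelian C] [EnoughProjectives C] [HasExt.{u} C]
  [HasExt.{u} (ModuleCat.{u} R)]

/-- A short exact sequence of exact functors gives connecting classes which commute, up to sign,
with the maps induced on `Ext`. -/
theorem mapExactFunctor_comp_extClass {F₁ F₂ F₃ : C ⥤ ModuleCat.{u} R}
    [F₁.Additive] [Limits.PreservesFiniteLimits F₁] [Limits.PreservesFiniteColimits F₁]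
    [F₂.Additive] [Limits.PreservesFiniteLimits F₂] [Limits.PreservesFiniteColimits F₂]
    [F₃.Additive] [Limits.PreservesFiniteLimits F₃] [Limits.PreservesFiniteColimits F₃]
    (σ : F₁ ⟶ F₂) (τ : F₂ ⟶ F₃) (w : ∀ B, σ.app B ≫ τ.app B = 0)
    (h : ∀ B, (ShortComplex.mk (σ.app B) (τ.app B) (w B)).ShortExact)
    {B B' : C} {b c : ℕ} (θ : Ext B B' b) (hc : b + 1 = c) (hc' : 1 + b = c) :
    (θ.mapExactFunctor F₃).comp (h B').extClass hc =
      (-1 : ℤ) ^ b • (h B).extClass.comp (θ.mapExactFunctor F₁) hc' := by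
  induction θ using ext_induction generalizing c with
  | h₀ X Y f =>
    obtain rfl : c = 1 := by lia
    rw [pow_zero, one_smul, Ext.mapExactFunctor_mk₀, Ext.mapExactFunctor_mk₀]
    exact (ShortComplex.ShortExact.extClass_naturality (h X) (h Y)
      ⟨F₁.map f, F₂.map f, F₃.map f, σ.naturality f, τ.naturality f⟩).symm
  | h₁ S hS =>
    obtain rfl : c = 2 := by lia
    rw [pow_one, neg_smul, one_smul, Ext.mapExactFunctor_extClass, Ext.mapExactFunctor_extClass]
    refine neg_eq_iff_eq_neg.1 (Eq.symm ?_)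
    -- The rows are the images of `S` under the three functors; the columns are the functor sequence
    -- evaluated at the three objects of `S`.
    exact extClass_anticommute (S.mapNatTrans σ) (S.mapNatTrans τ) (w _) (w _)
      (hS.map_of_exact F₁) (hS.map_of_exact F₂) (hS.map_of_exact F₃) (h _) (w _) (h _)
  | h X Y Z a b c' α β e hα hβ =>
    subst e
    rw [Ext.mapExactFunctor_comp, Ext.mapExactFunctor_comp,
      Ext.comp_assoc (a₂₃ := b + 1) _ _ _ (by lia) (by lia) (by lia),
      hβ rfl (by lia), ext_comp_zsmul,
      ← Ext.comp_assoc (a₁₂ := a + 1) _ _ _ (by lia) (by lia) (by lia), hα rfl (by lia),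
      ext_zsmul_comp, smul_smul, Ext.comp_assoc (a₂₃ := a + b) _ _ _ (by lia) (by lia) (by lia),
      ← pow_add, add_comm b a]

end Anticommutativity

/-! ### The interchange law for a bifunctor -/

section Interchange

universe v₁ v₂

variable {R : Type v} [Ring R] {C : Type v₁} [Category.{u} C] [Abelian C] [EnoughProjectives C]
  [HasExt.{u} C] {C' : Type v₂} [Category.{u} C'] [Abelian C'] [EnoughProjectives C']
  [HasExt.{u} C'] [HasExt.{u} (ModuleCat.{u} R)]

theorem mapExactFunctor_comp_extClass_bifunctor (T : C ⥤ C' ⥤ ModuleCat.{u} R) {P : C → Prop}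
    [∀ X, (T.obj X).Additive] [∀ B, (T.flip.obj B).Additive]
    (hT : ∀ B, RelExact (T.flip.obj B) P) {S : ShortComplex C} (hS : S.ShortExact) (h₃ : P S.X₃)
    [Limits.PreservesFiniteLimits (T.obj S.X₁)] [Limits.PreservesFiniteColimits (T.obj S.X₁)]
    [Limits.PreservesFiniteLimits (T.obj S.X₂)] [Limits.PreservesFiniteColimits (T.obj S.X₂)]
    [Limits.PreservesFiniteLimits (T.obj S.X₃)] [Limits.PreservesFiniteColimits (T.obj S.X₃)]
    {B B' : C'} {b : ℕ} (θ : Ext B B' b) :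
    (θ.mapExactFunctor (T.obj S.X₃)).comp ((hT B').extClass hS h₃) (rfl : b + 1 = b + 1) =
      (-1 : ℤ) ^ b • ((hT B).extClass hS h₃).comp (θ.mapExactFunctor (T.obj S.X₁))
        (add_comm 1 b) :=
  by
  have h : ∀ B, (ShortComplex.mk ((T.map S.f).app B) ((T.map S.g).app B)
      (S.map (T.flip.obj B)).zero).ShortExact := fun B => (hT B).shortExact hS h₃
  have e : ∀ B, (hT B).extClass hS h₃ = (h B).extClass := fun B => rfl
  have := mapExactFunctor_comp_extClass (T.map S.f) (T.map S.g) _ h θ rfl (add_comm 1 b)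
  rw [e, e]
  exact this

/-- The interchange law for the maps induced on `Ext` by the two variables of a bifunctor. -/
theorem relExt_comp_mapExactFunctor (T : C ⥤ C' ⥤ ModuleCat.{u} R) {P : C → Prop}
    [∀ X, (T.obj X).Additive] [∀ B, (T.flip.obj B).Additive]
    (hT : ∀ B, RelExact (T.flip.obj B) P)
    (hproj : ∀ X, Projective X → P X)
    (hlim : ∀ X, P X → Limits.PreservesFiniteLimits (T.obj X))
    (hcolim : ∀ X, P X → Limits.PreservesFiniteColimits (T.obj X))
    {X X' : C} (hX : P X) [Limits.PreservesFiniteLimits (T.obj X)]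
    [Limits.PreservesFiniteColimits (T.obj X)] [Limits.PreservesFiniteLimits (T.obj X')]
    [Limits.PreservesFiniteColimits (T.obj X')] {B B' : C'} {a b c : ℕ} (x : Ext X X' a)
    (θ : Ext B B' b) (h : a + b = c) (h' : b + a = c) :
    (relExt (hT B) a hX x).comp (θ.mapExactFunctor (T.obj X')) h =
      (-1 : ℤ) ^ (a * b) • (θ.mapExactFunctor (T.obj X)).comp (relExt (hT B') a hX x) h' := by
  induction a generalizing X c with
  | zero =>
    obtain ⟨f, rfl⟩ := (Ext.mk₀_bijective _ _).2 x
    obtain rfl : b = c := by lia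
    rw [relExt_mk₀, relExt_mk₀, zero_mul, pow_zero, one_smul]
    exact (mapExactFunctor_naturality (T.obj X) (T.obj X') (T.map f) θ).symm
  | succ a ih =>
    obtain ⟨x, rfl⟩ := exists_syzClass_comp x
    have hX₁ := (hT B).syz X hX
    have hX₂ : P (syzSeq X).X₂ := hproj _ inferInstance
    have := hlim _ hX₁
    have := hcolim _ hX₁
    have := hlim _ hX₂
    have := hcolim _ hX₂
    have : Limits.PreservesFiniteLimits (T.obj (syzSeq X).X₃) := ‹Limits.PreservesFiniteLimits (T.obj X)›
    have : Limits.PreservesFiniteColimits (T.obj (syzSeq X).X₃) := ‹Limits.PreservesFiniteColimits (T.obj X)›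
    have key : (θ.mapExactFunctor (T.obj X)).comp ((hT B').syzClass hX) (rfl : b + 1 = b + 1) =
        (-1 : ℤ) ^ b • ((hT B).syzClass hX).comp (θ.mapExactFunctor (T.obj (syzSeq X).X₁))
          (add_comm 1 b) :=
      mapExactFunctor_comp_extClass_bifunctor T hT (syzSeq_shortExact X) hX θ
    -- One syzygy class is split off `x`; it passes `θ` at the cost of `(-1)^b`. The rewriting
    -- collects this sign on the other side, where `(a + 1) * b + b` and `a * b` have the same
    -- parity.
    rw [relExt_syz, relExt_syz, Ext.comp_assoc (a₂₃ := a + b) _ _ _ (by lia) (by lia) (by lia),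
      ih hX₁ x rfl (by lia), ext_comp_zsmul,
      ← Ext.comp_assoc (a₁₂ := b + 1) _ _ _ (by lia) (by lia) (by lia),
      ← Ext.comp_assoc (a₁₂ := b + 1) _ _ _ (by lia) (by lia) (by lia), key, ext_zsmul_comp,
      smul_smul, ← pow_add, show (a + 1) * b + b = a * b + 2 * b by ring, pow_add, pow_mul]
    simp

end Interchange

/-! ### Exactness of tensoring with a right projective bimodule -/

section TensorExactness

variable {k : Type v} {Λ : Type u} [CommRing k] [Ring Λ] [Algebra k Λ]

/-- The additive map on `B ⊗_Λ M` given by a balanced biadditive map. -/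
noncomputable def balLift {B : ModuleCat.{u} (Env k Λ)} {M : ModuleCat.{u} Λ} {A : Type u}
    [AddCommGroup A] (φ : leftMod B →+ M →+ A)
    (h : ∀ (b : leftMod B) (l : Λ) (m : M), φ (rightMul B b l) m = φ b (l • m)) :
    BalTensor B M →+ A :=
  QuotientAddGroup.lift (balancedRel B M).toAddSubgroup
    (TensorProduct.liftAddHom φ fun r b m => by simp) (by
    intro x hx
    have hle : AddSubgroup.closure {x | ∃ (b : leftMod B) (l : Λ) (m : M),
        x = rightMul B b l ⊗ₜ[ℤ] m - b ⊗ₜ[ℤ] (l • m)} ≤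
        (TensorProduct.liftAddHom φ fun (r : ℤ) b m => by simp).ker := by
      rw [AddSubgroup.closure_le]
      rintro _ ⟨b, l, m, rfl⟩
      simp [h]
    exact hle (mem_balancedRel B M hx))

theorem balTmul_zero_right {B : ModuleCat.{u} (Env k Λ)} {M : ModuleCat.{u} Λ} (b : leftMod B) :
    balTmul b (0 : M) = 0 := by
  rw [balTmul, TensorProduct.tmul_zero, map_zero]

theorem balTensor_induction {B : ModuleCat.{u} (Env k Λ)} {M : ModuleCat.{u} Λ}
    {motive : BalTensor B M → Prop} (x : BalTensor B M) (zero : motive 0)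
    (tmul : ∀ (b : leftMod B) (m : M), motive (balTmul b m))
    (add : ∀ x y, motive x → motive y → motive (x + y)) : motive x := by
  obtain ⟨x, rfl⟩ := Submodule.mkQ_surjective _ x
  induction x using TensorProduct.induction_on with
  | zero => rw [map_zero]; exact zero
  | tmul b m => exact tmul b m
  | add x y hx hy => rw [map_add]; exact add _ _ hx hy

/-- The map `B ⊗_Λ M → B ⊗_Λ M'` induced by a map of left modules. -/
noncomputable def balRight (B : ModuleCat.{u} (Env k Λ)) {M M' : ModuleCat.{u} Λ}
    (g : M →ₗ[Λ] M') : BalTensor B M →ₗ[Λ] BalTensor B M' :=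
  Submodule.mapQ _ _ (TensorProduct.AlgebraTensorModule.map
    (LinearMap.id (R := Λ) (M := leftMod B)) (g.restrictScalars ℤ)) (by
      rw [balancedRel, Submodule.span_le]
      rintro _ ⟨b, l, m, rfl⟩
      refine Submodule.subset_span ⟨b, l, g m, ?_⟩
      rw [map_sub, ← g.map_smul]
      rfl)

theorem balRight_comp (B : ModuleCat.{u} (Env k Λ)) {M M' M'' : ModuleCat.{u} Λ}
    (g : M →ₗ[Λ] M') (g' : M' →ₗ[Λ] M'') :
    balRight B (g' ∘ₗ g) = balRight B g' ∘ₗ balRight B g :=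
  balLin_ext fun _ _ => rfl

/-- If `B` is projective as a right module, then `B ⊗_Λ -` is a natural retract of a power of the
identity functor. -/
theorem exists_balTensor_retract (B : ModuleCat.{u} (Env k Λ))
    (hB : Module.Projective Λᵐᵒᵖ (rightMod B)) :
    ∃ (i : ∀ M : ModuleCat.{u} Λ, BalTensor B M →+ (leftMod B →₀ M))
      (r : ∀ M : ModuleCat.{u} Λ, (leftMod B →₀ M) →+ BalTensor B M),
      (∀ M x, r M (i M x) = x) ∧
      (∀ (M M' : ModuleCat.{u} Λ) (g : M →ₗ[Λ] M') (x : BalTensor B M),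
        i M' (balRight B g x) = Finsupp.mapRange.addMonoidHom g.toAddMonoidHom (i M x)) ∧
      (∀ (M M' : ModuleCat.{u} Λ) (g : M →ₗ[Λ] M') (y : leftMod B →₀ M),
        r M' (Finsupp.mapRange.addMonoidHom g.toAddMonoidHom y) = balRight B g (r M y)) := by
  obtain ⟨s, hs⟩ := hB
  have hs₁ : ∀ (b : leftMod B) (l : Λ), s (rightMul B b l) = MulOpposite.op l • s b :=
    fun b l => s.map_smul (MulOpposite.op l) b
  -- The retract comes from the section `s` of the free right module on the elements of `B`: the
  -- inclusion sends `b ⊗ m` to the family `s(b)_e m`, and the retraction sends a family `(m_e)` to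
  -- the sum of the `e ⊗ m_e`.
  let ev (M : ModuleCat.{u} Λ) (m : M) : Λᵐᵒᵖ →+ M :=
    ((smulAddHom Λ M).flip m).comp (MulOpposite.opAddEquiv (α := Λ)).symm.toAddMonoidHom
  let φ (M : ModuleCat.{u} Λ) : leftMod B →+ M →+ (leftMod B →₀ M) :=
    AddMonoidHom.mk' (fun b => AddMonoidHom.mk'
      (fun m => Finsupp.mapRange.addMonoidHom (ev M m) (s b)) fun m m' => by
        ext e
        change (s b e).unop • (m + m') = (s b e).unop • m + (s b e).unop • m'
        rw [smul_add]) fun b b' => by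
      ext m e
      change ev M m (s (b + b') e) = ev M m (s b e) + ev M m (s b' e)
      rw [← map_add]
      exact congrArg (ev M m) (DFunLike.congr_fun (s.map_add b b') e)
  refine ⟨fun M => balLift (φ M) fun b l m => ?_, fun M => Finsupp.liftAddHom fun b =>
    AddMonoidHom.mk' (fun m => balTmul b m) fun m m' => balTmul_add_right b m m', ?_, ?_, ?_⟩
  · ext e
    change ev M m (s (rightMul B b l) e) = ev M (l • m) (s b e)
    rw [hs₁]
    exact mul_smul (s b e).unop l m
  · intro M x
    induction x using balTensor_induction with
    | zero => simp
    | add x y hx hy => rw [map_add, map_add, hx, hy]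
    | tmul b m => ?_
    have h₁ : b = (s b).sum fun e l => rightMul B e l.unop := (hs b).symm
    let T : leftMod B →+ BalTensor B M :=
      AddMonoidHom.mk' (fun b => balTmul b m) fun b b' => balTmul_add_left b b' m
    have h₂ : balTmul b m = (s b).sum fun e l => balTmul (B := B) e (l.unop • m) := by
      change T b = _
      conv_lhs => rw [h₁]
      rw [map_finsuppSum]
      exact Finsupp.sum_congr fun e _ => balTmul_rightMul e _ m
    refine Eq.trans ?_ h₂.symm
    change Finsupp.liftAddHom _ (Finsupp.mapRange.addMonoidHom (ev M m) (s b)) = _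
    exact Finsupp.sum_mapRange_index (α := leftMod B) (hf := map_zero (ev M m))
      (h := fun e (z : M) => (balTmul e z : BalTensor B M)) fun e => balTmul_zero_right e
  · intro M M' g x
    induction x using balTensor_induction with
    | zero => simp
    | add x y hx hy => simp only [map_add, hx, hy]
    | tmul b m =>
      ext e
      exact (g.map_smul _ _).symm
  · intro M M' g y
    induction y using Finsupp.induction_linear with
    | zero => simp
    | add y y' hy hy' => simp only [map_add, hy, hy']
    | single b m =>
      simp only [Finsupp.mapRange.addMonoidHom_apply, Finsupp.mapRange_single,
        Finsupp.liftAddHom_apply_single]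
      rfl

/-- If `B` is projective as a right module, then `B ⊗_Λ -` is exact. -/
theorem balRight_exact (B : ModuleCat.{u} (Env k Λ)) (hB : Module.Projective Λᵐᵒᵖ (rightMod B))
    {M₁ M₂ M₃ : ModuleCat.{u} Λ} (f : M₁ →ₗ[Λ] M₂) (g : M₂ →ₗ[Λ] M₃) (h : Function.Exact f g) :
    Function.Exact (balRight B f) (balRight B g) := by
  obtain ⟨i, r, hri, hi, hr⟩ := exists_balTensor_retract B hB
  intro x
  constructor
  · intro hx
    have h₁ : ∀ e, g (i M₂ x e) = 0 := by
      intro e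
      have := DFunLike.congr_fun (hi _ _ g x) e
      rw [hx, map_zero] at this
      exact this.symm
    -- Exactness holds coordinatewise, so preimages are chosen in each coordinate. They are reset to
    -- zero off the support of `i M₂ x`, since an arbitrary preimage of zero would spoil finite
    -- support.
    choose p hp using fun e => (h _).1 (h₁ e)
    classical
    let y : leftMod B →₀ M₁ := Finsupp.onFinset (i M₂ x).support
      (fun e => if i M₂ x e = 0 then 0 else p e) fun e he => by
        rw [Finsupp.mem_support_iff]
        intro h0
        exact he (if_pos h0)
    refine ⟨r M₁ y, ?_⟩
    rw [← hr, ← hri M₂ x]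
    congr 1
    ext e
    change f (if i M₂ x e = 0 then 0 else p e) = i M₂ x e
    split_ifs with h0
    · rw [h0, map_zero]
    · exact hp e
  · rintro ⟨y, rfl⟩
    have : g ∘ₗ f = 0 := LinearMap.ext fun z => (h _).2 ⟨z, rfl⟩
    rw [← LinearMap.comp_apply, ← balRight_comp, this]
    exact DFunLike.congr_fun (f := (balRight B (0 : M₁ →ₗ[Λ] M₃)).toAddMonoidHom) (g := 0)
      (balTensor_ext fun b m => balTmul_zero_right b) y

end TensorExactness

/-! ### The tensor product of bimodules as a bifunctor -/

section BimoduleTensor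

variable {k : Type v} {Λ : Type u} [CommRing k] [Ring Λ] [Algebra k Λ]

/-- Right multiplication on a bimodule, as a ring homomorphism to the endomorphisms of the
underlying left module. -/
noncomputable def rightEnd (B : ModuleCat.{u} (Env k Λ)) :
    Λᵐᵒᵖ →+* Module.End Λ (leftMod B) where
  toFun l :=
    { toFun := fun b => rightMul B b l.unop
      map_add' := fun b b' => smul_add (rightInc k Λ l) (show B from b) (show B from b')
      map_smul' := fun a b => rightMul_smul B a b l.unop }
  map_one' := by
    ext b
    change rightInc k Λ 1 • (show B from b) = (b : B)
    rw [map_one, one_smul]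
  map_mul' l l' := by
    ext b
    change rightInc k Λ (l * l') • (show B from b) =
      rightInc k Λ l • (rightInc k Λ l' • (show B from b))
    rw [map_mul, mul_smul]
  map_zero' := by
    ext b
    exact (congrArg (· • (show B from b)) (map_zero (rightInc k Λ))).trans
      (zero_smul (Env k Λ) (show B from b))
  map_add' l l' := by
    ext b
    change rightInc k Λ (l + l') • (show B from b) =
      rightInc k Λ l • (show B from b) + rightInc k Λ l' • (show B from b)
    rw [map_add, add_smul]

/-- The action of the endomorphisms of `M` on `B ⊗_Λ M`. -/
noncomputable def balRightHom (B : ModuleCat.{u} (Env k Λ)) (M : ModuleCat.{u} Λ) :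
    Module.End Λ M →+* Module.End Λ (BalTensor B M) where
  toFun f := balRight B f
  map_one' := balLin_ext fun _ _ => rfl
  map_mul' _ _ := balLin_ext fun _ _ => rfl
  map_zero' := balLin_ext fun _ _ => balTmul_zero_right _
  map_add' _ _ := balLin_ext fun _ _ => balTmul_add_right _ _ _

/-- The bimodule `X ⊗_Λ B`. -/
def BiTensor (X B : ModuleCat.{u} (Env k Λ)) : Type u := BalTensor X (leftMod B)

variable (X B : ModuleCat.{u} (Env k Λ))

noncomputable instance : AddCommGroup (BiTensor X B) :=
  inferInstanceAs (AddCommGroup (BalTensor X (leftMod B)))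

noncomputable instance : Module Λ (BiTensor X B) :=
  inferInstanceAs (Module Λ (BalTensor X (leftMod B)))

noncomputable instance : Module Λᵐᵒᵖ (BiTensor X B) :=
  Module.compHom (BalTensor X (leftMod B)) ((balRightHom X (leftMod B)).comp (rightEnd B))

noncomputable instance : Module k (BiTensor X B) :=
  Module.compHom (BalTensor X (leftMod B)) (algebraMap k Λ)

variable {X B}

/-- The element `x ⊗ b` of `X ⊗_Λ B`. -/
noncomputable def biTmul (x : leftMod X) (b : leftMod B) : BiTensor X B :=
  balTmul x b

theorem smul_biTmul (a : Λ) (x : leftMod X) (b : leftMod B) :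
    a • biTmul x b = biTmul (a • x) b := rfl

theorem op_smul_biTmul (l : Λ) (x : leftMod X) (b : leftMod B) :
    MulOpposite.op l • biTmul x b = biTmul x (rightMul B b l) := rfl

theorem biTmul_rightMul (x : leftMod X) (l : Λ) (b : leftMod B) :
    biTmul (rightMul X x l) b = biTmul x (l • b) :=
  balTmul_rightMul _ _ _

theorem biTensor_induction {motive : BiTensor X B → Prop} (x : BiTensor X B) (zero : motive 0)
    (tmul : ∀ (x : leftMod X) (b : leftMod B), motive (biTmul x b))
    (add : ∀ x y, motive x → motive y → motive (x + y)) : motive x :=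
  balTensor_induction (B := X) (M := leftMod B) x zero tmul add

theorem rightMul_algebraMap (c : k) (x : leftMod X) :
    rightMul X x (algebraMap k Λ c) = algebraMap k Λ c • x := by
  change rightInc k Λ (MulOpposite.op (algebraMap k Λ c)) • (show X from x) =
    leftInc k Λ (algebraMap k Λ c) • (show X from x)
  congr 1
  exact (Algebra.TensorProduct.includeRight.commutes c).trans
    (Algebra.TensorProduct.includeLeft.commutes c).symm

/-- A scalar slides from the right of `B` to its left, across the tensor sign, and from the right of
`X` to its left. This centrality of `k` is what makes `X ⊗_Λ B` a module over the enveloping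
algebra. -/
theorem op_algebraMap_smul (c : k) (x : BiTensor X B) :
    MulOpposite.op (algebraMap k Λ c) • x = algebraMap k Λ c • x := by
  induction x using biTensor_induction with
  | zero => rw [smul_zero, smul_zero]
  | tmul x b =>
    rw [op_smul_biTmul, rightMul_algebraMap, ← biTmul_rightMul, rightMul_algebraMap, smul_biTmul]
  | add x y hx hy => rw [smul_add, smul_add, hx, hy]

instance : IsScalarTower k Λ (BiTensor X B) where
  smul_assoc c a x := by
    rw [Algebra.smul_def, mul_smul]
    rfl

instance : IsScalarTower k Λᵐᵒᵖ (BiTensor X B) where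
  smul_assoc c a x := by
    rw [Algebra.smul_def, mul_smul]
    exact op_algebraMap_smul c _

instance : SMulCommClass Λ Λᵐᵒᵖ (BiTensor X B) where
  smul_comm a l x := by
    induction x using biTensor_induction with
    | zero => simp only [smul_zero]
    | tmul x b => rfl
    | add x y hx hy => simp only [smul_add, hx, hy]

noncomputable instance : Module (Env k Λ) (BiTensor X B) :=
  TensorProduct.Algebra.module

theorem tmul_smul_biTmul (a l : Λ) (x : leftMod X) (b : leftMod B) :
    (a ⊗ₜ[k] MulOpposite.op l : Env k Λ) • biTmul x b = biTmul (a • x) (rightMul B b l) :=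
  TensorProduct.Algebra.smul_def _ _ _

/-- A homomorphism of bimodules on `X ⊗_Λ B` given by an additive map. -/
noncomputable def biHom {Z : ModuleCat.{u} (Env k Λ)} (F : BalTensor X (leftMod B) →+ Z)
    (hF : ∀ (a l : Λ) (x : leftMod X) (b : leftMod B), F (balTmul (a • x) (rightMul B b l)) =
      (a ⊗ₜ[k] MulOpposite.op l : Env k Λ) • F (balTmul x b)) :
    ModuleCat.of (Env k Λ) (BiTensor X B) ⟶ Z :=
  let G : BiTensor X B →+ Z := F
  ModuleCat.ofHom (X := BiTensor X B)
    { toFun := G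
      map_add' := G.map_add
      map_smul' := fun e x => by
        change G (e • x) = e • G x
        induction x using biTensor_induction with
        | zero => rw [smul_zero, map_zero, smul_zero]
        | add x y hx hy => rw [smul_add, map_add, hx, hy, map_add, smul_add]
        | tmul x b =>
          induction e using TensorProduct.induction_on with
          | zero =>
            exact (congrArg G (zero_smul (Env k Λ) _)).trans
              ((map_zero G).trans (zero_smul (Env k Λ) (G (biTmul x b))).symm)
          | add e e' h h' => rw [add_smul, add_smul, ← h, ← h', map_add]
          | tmul a l =>
            induction l using MulOpposite.rec' with
            | h l =>
              rw [tmul_smul_biTmul]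
              exact hF a l x b }

theorem biHom_ext {Z : ModuleCat.{u} (Env k Λ)}
    {f g : ModuleCat.of (Env k Λ) (BiTensor X B) ⟶ Z}
    (h : ∀ (x : leftMod X) (b : leftMod B), f.hom (biTmul x b) = g.hom (biTmul x b)) : f = g := by
  ext x
  induction x using biTensor_induction with
  | zero => rw [map_zero, map_zero]
  | tmul x b => exact h x b
  | add x y hx hy => rw [map_add, map_add, hx, hy]

/-- The left module map underlying a map of bimodules. -/
noncomputable def leftHom {B B' : ModuleCat.{u} (Env k Λ)} (g : B ⟶ B') :
    leftMod B →ₗ[Λ] leftMod B' :=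
  ((ModuleCat.restrictScalars (leftInc k Λ)).map g).hom

theorem leftHom_rightMul {B B' : ModuleCat.{u} (Env k Λ)} (g : B ⟶ B') (b : leftMod B) (l : Λ) :
    leftHom g (rightMul B b l) = rightMul B' (leftHom g b) l :=
  g.hom.map_smul _ _

variable (k Λ)

/-- The tensor product of bimodules as a bifunctor. -/
noncomputable def biTensorFunctor :
    ModuleCat.{u} (Env k Λ) ⥤ ModuleCat.{u} (Env k Λ) ⥤ ModuleCat.{u} (Env k Λ) where
  obj X :=
    { obj := fun B => ModuleCat.of (Env k Λ) (BiTensor X B)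
      map := fun g => biHom (balRight X (leftHom g)).toAddMonoidHom fun a l x b =>
        (congrArg (fun z => balTmul (a • x) z) (leftHom_rightMul g b l)).trans
          (tmul_smul_biTmul a l x (leftHom g b)).symm
      map_id := fun _ => biHom_ext fun _ _ => rfl
      map_comp := fun _ _ => biHom_ext fun _ _ => rfl }
  map f :=
    { app := fun B => biHom (balLin f (leftMod B)).toAddMonoidHom fun a l x b =>
        (congrArg (fun z => balTmul z (rightMul B b l)) ((leftHom f).map_smul a x)).trans
          (tmul_smul_biTmul a l (leftHom f x) b).symm
      naturality := fun _ _ _ => biHom_ext fun _ _ => rfl }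
  map_id _ := NatTrans.ext (funext fun _ => biHom_ext fun _ _ => rfl)
  map_comp _ _ := NatTrans.ext (funext fun _ => biHom_ext fun _ _ => rfl)

variable {k Λ}

instance (X : ModuleCat.{u} (Env k Λ)) : ((biTensorFunctor k Λ).obj X).Additive where
  map_add := biHom_ext fun _ _ => balTmul_add_right _ _ _

instance (B : ModuleCat.{u} (Env k Λ)) : ((biTensorFunctor k Λ).flip.obj B).Additive where
  map_add := biHom_ext fun _ _ => balTmul_add_left _ _ _

/-- The bimodule is projective as a right module. -/
def RightProjective (B : ModuleCat.{u} (Env k Λ)) : Prop :=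
  Module.Projective Λᵐᵒᵖ (rightMod B)

theorem tensorFunctor_relExact [Module.Projective k Λ] (M : ModuleCat.{u} Λ) :
    RelExact (tensorFunctor k M) (RightProjective (k := k) (Λ := Λ)) where
  shortExact hS h := tensorFunctor_shortExact M hS h
  syz X h := syz_rightProjective X h

/-- Exactness concerns only the underlying maps of sets, so the case of left modules applies to
`leftMod B`. -/
theorem biTensorFunctor_relExact [Module.Projective k Λ] (B : ModuleCat.{u} (Env k Λ)) :
    RelExact ((biTensorFunctor k Λ).flip.obj B) (RightProjective (k := k) (Λ := Λ)) where
  shortExact {S} hS h := by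
    have hT := tensorFunctor_shortExact (leftMod B) hS h
    have hi := hT.moduleCat_injective_f
    have hs := hT.moduleCat_surjective_g
    have he := (ShortComplex.ShortExact.moduleCat_exact_iff_function_exact _).1 hT.exact
    exact
      { exact := (ShortComplex.ShortExact.moduleCat_exact_iff_function_exact _).2 he
        mono_f := (ModuleCat.mono_iff_injective _).2 hi
        epi_g := (ModuleCat.epi_iff_surjective _).2 hs }
  syz X h := syz_rightProjective X h

theorem biTensorFunctor_exact (hX : RightProjective X)
    (S : ShortComplex (ModuleCat.{u} (Env k Λ))) (hS : S.Exact) :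
    (S.map ((biTensorFunctor k Λ).obj X)).Exact := by
  rw [ShortComplex.ShortExact.moduleCat_exact_iff_function_exact] at hS ⊢
  exact balRight_exact X hX (leftHom S.f) (leftHom S.g) hS

theorem biTensorFunctor_preservesFiniteLimits (hX : RightProjective X) :
    Limits.PreservesFiniteLimits ((biTensorFunctor k Λ).obj X) := by
  have h := ((Functor.exact_tfae ((biTensorFunctor k Λ).obj X)).out 1 3).mp
    (biTensorFunctor_exact hX)
  exact h.1

theorem biTensorFunctor_preservesFiniteColimits (hX : RightProjective X) :
    Limits.PreservesFiniteColimits ((biTensorFunctor k Λ).obj X) := by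
  have h := ((Functor.exact_tfae ((biTensorFunctor k Λ).obj X)).out 1 3).mp
    (biTensorFunctor_exact hX)
  exact h.2

end BimoduleTensor

/-! ### Graded commutation with the right twist -/

section SkewCommutativity

theorem RelExact.of_exact {C : Type*} [Category* C] [Abelian C] [EnoughProjectives C] {D : Type*}
    [Category* D] [Abelian D] {P : C → Prop} (hP : ∀ X, P X → P (syzSeq X).X₁) (F : C ⥤ D)
    [F.Additive] [Limits.PreservesFiniteLimits F] [Limits.PreservesFiniteColimits F] :
    RelExact F P where
  shortExact hS _ := hS.map_of_exact F
  syz := hP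

/-- Formal bookkeeping for `rightTwist_comp`: `hint` is the interchange law on tensor products, and
the remaining hypotheses are the naturality squares and compatibilities that carry its two sides to
untensored bimodules. -/
theorem ext_skew_aux {D : Type v} [Category.{u} D] [Abelian D] [HasExt.{u} D]
    {B₀ B L XB LB LL XL LR XR X₀ X₁ : D} {a b c : ℕ} (h : a + b = c) (h' : b + a = c) (s : ℤ)
    {r : Ext XB LB a} {yT : Ext LB LL b} {β : LL ⟶ L} {α : B₀ ⟶ XB} {yT' : Ext XB XL b}
    {r' : Ext XL LL a} {γ : LB ⟶ LR} {g : LR ⟶ B} {y : Ext B L b} {γX : XB ⟶ XR}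
    {x' : Ext XR LR a} {c₀ : B₀ ⟶ XR} {γ' : XL ⟶ X₀} {x : Ext X₀ L a} {y'' : Ext B₀ X₁ b}
    {αL : X₁ ⟶ XL} {i : X₁ ⟶ X₀}
    (hint : r.comp yT h = s • yT'.comp r' h')
    (h₁ : yT.comp (Ext.mk₀ β) (add_zero b) = (Ext.mk₀ (γ ≫ g)).comp y (zero_add b))
    (h₂ : r.comp (Ext.mk₀ γ) (add_zero a) = (Ext.mk₀ γX).comp x' (zero_add a))
    (h₃ : α ≫ γX = c₀)
    (h₄ : r'.comp (Ext.mk₀ β) (add_zero a) = (Ext.mk₀ γ').comp x (zero_add a))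
    (h₅ : (Ext.mk₀ α).comp yT' (zero_add b) = y''.comp (Ext.mk₀ αL) (add_zero b))
    (h₆ : αL ≫ γ' = i) :
    ((Ext.mk₀ c₀).comp (x'.comp (Ext.mk₀ g) (add_zero a)) (zero_add a)).comp y h =
      s • y''.comp ((Ext.mk₀ i).comp x (zero_add a)) h' := by
  have e₁ : (Ext.mk₀ α).comp ((r.comp yT h).comp (Ext.mk₀ β) (add_zero c)) (zero_add c) =
      ((Ext.mk₀ c₀).comp (x'.comp (Ext.mk₀ g) (add_zero a)) (zero_add a)).comp y h := by
    rw [Ext.comp_assoc (a₂₃ := b) r yT _ (by lia) (by lia) (by lia), h₁, ← Ext.mk₀_comp_mk₀,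
      Ext.comp_assoc (a₂₃ := b) (Ext.mk₀ γ) _ _ (by lia) (by lia) (by lia),
      ← Ext.comp_assoc (a₁₂ := a) r (Ext.mk₀ γ) _ (by lia) (by lia) (by lia), h₂, ← h₃,
      ← Ext.mk₀_comp_mk₀,
      Ext.comp_assoc (a₂₃ := c) (Ext.mk₀ γX) x' _ (by lia) (by lia) (by lia),
      Ext.comp_assoc (a₁₂ := 0) (a₂₃ := a) (Ext.mk₀ α) (Ext.mk₀ γX) _ (by lia) (by lia) (by lia),
      Ext.comp_assoc (a₁₂ := a) (a₂₃ := c) (Ext.mk₀ α) _ y (by lia) (by lia) (by lia),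
      Ext.comp_assoc (a₁₂ := a) (a₂₃ := c) (Ext.mk₀ γX) _ y (by lia) (by lia) (by lia),
      Ext.comp_assoc (a₁₂ := a) (a₂₃ := b) x' _ y (by lia) (by lia) (by lia)]
  have e₂ : (Ext.mk₀ α).comp ((yT'.comp r' h').comp (Ext.mk₀ β) (add_zero c)) (zero_add c) =
      y''.comp ((Ext.mk₀ i).comp x (zero_add a)) h' := by
    rw [Ext.comp_assoc (a₂₃ := a) yT' r' _ (by lia) (by lia) (by lia), h₄,
      ← Ext.comp_assoc (a₁₂ := b) (Ext.mk₀ α) yT' _ (by lia) (by lia) (by lia), h₅,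
      Ext.comp_assoc (a₂₃ := a) y'' _ _ (by lia) (by lia) (by lia),
      ← Ext.comp_assoc (a₁₂ := 0) (Ext.mk₀ αL) _ _ (by lia) (by lia) (by lia),
      Ext.mk₀_comp_mk₀, h₆]
  rw [← e₁, ← e₂, hint, ext_zsmul_comp, ext_comp_zsmul]

variable {k : Type v} {Λ : Type u} [CommRing k] [Ring Λ] [Algebra k Λ]

theorem env_map_smul {X Z : Type u} [AddCommGroup X] [AddCommGroup Z] [Module (Env k Λ) X]
    [Module (Env k Λ) Z] (f : X →+ Z)
    (h : ∀ (a l : Λ) (x : X), f ((a ⊗ₜ[k] MulOpposite.op l : Env k Λ) • x) =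
      (a ⊗ₜ[k] MulOpposite.op l : Env k Λ) • f x) (e : Env k Λ) (x : X) :
    f (e • x) = e • f x := by
  induction e using TensorProduct.induction_on with
  | zero =>
    exact (congrArg f (zero_smul (Env k Λ) x)).trans
      ((map_zero f).trans (zero_smul (Env k Λ) (f x)).symm)
  | add e e' h h' => rw [add_smul, add_smul, ← h, ← h', map_add]
  | tmul a l =>
    induction l using MulOpposite.rec' with
    | h l => exact h a l x

theorem tmul_smul_eq (B : ModuleCat.{u} (Env k Λ)) (a l : Λ) (b : leftMod B) :
    (a ⊗ₜ[k] MulOpposite.op l : Env k Λ) • (show B from b) = a • rightMul B b l := by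
  change _ = leftInc k Λ a • (rightInc k Λ (MulOpposite.op l) • (show B from b))
  rw [smul_smul]
  congr 1
  simp

theorem rightMul_rightMul (B : ModuleCat.{u} (Env k Λ)) (b : leftMod B) (l l' : Λ) :
    rightMul B (rightMul B b l) l' = rightMul B b (l * l') := by
  change rightInc k Λ (MulOpposite.op l') • (rightInc k Λ (MulOpposite.op l) • (show B from b)) =
    rightInc k Λ (MulOpposite.op (l * l')) • (show B from b)
  rw [smul_smul, ← map_mul, MulOpposite.op_mul]

theorem rightMul_add (B : ModuleCat.{u} (Env k Λ)) (b : leftMod B) (l l' : Λ) :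
    rightMul B b (l + l') = rightMul B b l + rightMul B b l' :=
  DFunLike.congr_fun ((rightEnd B).map_add (MulOpposite.op l) (MulOpposite.op l')) b

theorem add_rightMul (B : ModuleCat.{u} (Env k Λ)) (b b' : leftMod B) (l : Λ) :
    rightMul B (b + b') l = rightMul B b l + rightMul B b' l :=
  (rightEnd B (MulOpposite.op l)).map_add b b'

theorem toReg_symm_tmul_smul (a l : Λ) (x : regBimod k Λ) :
    (toReg k Λ).symm ((a ⊗ₜ[k] MulOpposite.op l : Env k Λ) • x) =
      a * (toReg k Λ).symm x * l :=
  congrArg (toReg k Λ).symm (smul_toReg a (MulOpposite.op l) ((toReg k Λ).symm x))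

theorem toReg_symm_smul (a : Λ) (x : leftMod (regBimod k Λ)) :
    (toReg k Λ).symm (a • x : leftMod (regBimod k Λ)) = a * (toReg k Λ).symm x :=
  (toReg_symm_tmul_smul a 1 x).trans (mul_one _)

theorem toReg_symm_rightMul (l : Λ) (x : leftMod (regBimod k Λ)) :
    (toReg k Λ).symm (rightMul (regBimod k Λ) x l) = (toReg k Λ).symm x * l :=
  (toReg_symm_tmul_smul 1 l x).trans (by rw [one_mul])

theorem toReg_symm_tw_smul (ψ : Λ ≃ₐ[k] Λ) (a : Λ)
    (x : leftMod ((tw (leftTw ψ)).obj (regBimod k Λ))) :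
    (toReg k Λ).symm (a • x : leftMod ((tw (leftTw ψ)).obj (regBimod k Λ))) =
      ψ a * (toReg k Λ).symm x :=
  toReg_symm_smul (ψ a) x

theorem toReg_symm_tw_rightMul (ψ : Λ ≃ₐ[k] Λ) (l : Λ)
    (x : leftMod ((tw (leftTw ψ)).obj (regBimod k Λ))) :
    (toReg k Λ).symm (rightMul ((tw (leftTw ψ)).obj (regBimod k Λ)) x l) =
      (toReg k Λ).symm x * l :=
  (congrArg (fun e : Env k Λ => (toReg k Λ).symm (e • (show regBimod k Λ from x)))
    ((leftTw_tmul ψ 1 (MulOpposite.op l)).trans (by rw [map_one]; rfl))).trans (toReg_symm_rightMul l x)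

theorem rightMul_twReg (ψ : Λ ≃ₐ[k] Λ) (m : ℕ) (x l : Λ) :
    rightMul (twReg ψ m) (toReg k Λ x) l = toReg k Λ (x * l) := by
  change (leftTw ψ ^ m) ((1 : Λ) ⊗ₜ[k] MulOpposite.op l) • toReg k Λ x = _
  rw [leftTw_pow_tmul, smul_toReg, map_one, one_mul, MulOpposite.unop_op]

theorem rightMul_twReg_one (ψ : Λ ≃ₐ[k] Λ) (m : ℕ) (a : Λ) :
    rightMul (twReg ψ m) (toReg k Λ 1) (((ψ : Λ →+* Λ) ^ m) a) =
      (a • (show leftMod (twReg ψ m) from toReg k Λ 1) : leftMod (twReg ψ m)) := by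
  change (leftTw ψ ^ m) ((1 : Λ) ⊗ₜ[k] MulOpposite.op (((ψ : Λ →+* Λ) ^ m) a)) • toReg k Λ 1 =
    (leftTw ψ ^ m) (a ⊗ₜ[k] 1) • toReg k Λ 1
  rw [leftTw_pow_tmul, leftTw_pow_tmul, smul_toReg, smul_toReg]
  simp

/-- The map `_{ψᵐ}B → _{ψᵐ}Λ_1 ⊗_Λ B`, `b ↦ 1 ⊗ b`. -/
noncomputable def toBiTensor (ψ : Λ ≃ₐ[k] Λ) (m : ℕ) :
    tw (leftTw ψ ^ m) ⟶ (biTensorFunctor k Λ).obj (twReg ψ m) where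
  app B :=
    let f : (tw (leftTw ψ ^ m)).obj B →+ BiTensor (twReg ψ m) B :=
      { toFun := fun b => biTmul (X := twReg ψ m) (toReg k Λ 1) (show B from b)
        map_zero' := balTmul_zero_right (B := twReg ψ m) (M := leftMod B) (toReg k Λ 1)
        map_add' := fun b b' =>
          balTmul_add_right (B := twReg ψ m) (M := leftMod B) (toReg k Λ 1) b b' }
    let g : (tw (leftTw ψ ^ m)).obj B →ₗ[Env k Λ] BiTensor (twReg ψ m) B :=
      { f with
        map_smul' := env_map_smul f fun a l b => by
          have h₁ : ((leftTw ψ ^ m) (a ⊗ₜ[k] MulOpposite.op l) • (show B from b) : B) =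
              ((ψ : Λ →+* Λ) ^ m) a • rightMul B b l := by
            rw [leftTw_pow_tmul]
            exact tmul_smul_eq B _ l b
          refine (congrArg (biTmul (X := twReg ψ m) (toReg k Λ 1)) h₁).trans ?_
          refine (biTmul_rightMul (X := twReg ψ m) (toReg k Λ 1) _ (rightMul B b l)).symm.trans ?_
          rw [rightMul_twReg_one]
          exact (tmul_smul_biTmul (X := twReg ψ m) a l (toReg k Λ 1) b).symm }
    ModuleCat.ofHom (X := (tw (leftTw ψ ^ m)).obj B) g
  naturality _ _ _ := rfl

/-- The map `Λ ⊗_Λ B → B`, `l ⊗ b ↦ lb`. -/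
noncomputable def ofBiTensorLeft (k : Type v) (Λ : Type u) [CommRing k] [Ring Λ] [Algebra k Λ] :
    (biTensorFunctor k Λ).obj (regBimod k Λ) ⟶ 𝟭 _ where
  app B := biHom (Z := B) (ofTensor k (leftMod B)).hom.toAddMonoidHom fun a l x b => by
    refine Eq.trans ?_ (tmul_smul_eq B a l ((toReg k Λ).symm x • b)).symm
    change ((toReg k Λ).symm (a • x : leftMod (regBimod k Λ)) • rightMul B b l : leftMod B) = _
    rw [toReg_symm_smul, rightMul_smul, smul_smul]
  naturality _ _ g := biHom_ext fun x b => ((leftHom g).map_smul ((toReg k Λ).symm x) b).symm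

/-- The map `X ⊗_Λ Λ → X`, `x ⊗ l ↦ xl`. -/
noncomputable def ofBiTensorRight (k : Type v) (Λ : Type u) [CommRing k] [Ring Λ] [Algebra k Λ] :
    (biTensorFunctor k Λ).flip.obj (regBimod k Λ) ⟶ 𝟭 _ where
  app X :=
    let φ : leftMod X →+ leftMod (regBimod k Λ) →+ X :=
      AddMonoidHom.mk' (fun x => AddMonoidHom.mk'
        (fun l => (rightMul X x ((toReg k Λ).symm l) : X))
        fun l l' => (congrArg _ ((toReg k Λ).symm.map_add l l')).trans (rightMul_add X x _ _))
        fun x x' => AddMonoidHom.ext fun l => add_rightMul X x x' _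
    biHom (Z := X) (balLift φ fun x l l' => (rightMul_rightMul X x l _).trans
        (congrArg (rightMul X x) (toReg_symm_smul l l').symm)) fun a l x b => by
      refine Eq.trans ?_ (tmul_smul_eq X a l (rightMul X x ((toReg k Λ).symm b))).symm
      change rightMul X (a • x) ((toReg k Λ).symm (rightMul (regBimod k Λ) b l)) = _
      rw [toReg_symm_rightMul, ← rightMul_rightMul, rightMul_smul, rightMul_smul]
  naturality _ _ g := biHom_ext fun x b => (leftHom_rightMul g x _).symm

/-- The map `X ⊗_Λ _ψΛ → X_{ψ⁻¹}`, `x ⊗ l ↦ xψ⁻¹(l)`. -/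
noncomputable def ofBiTensorTwist (ψ : Λ ≃ₐ[k] Λ) :
    (biTensorFunctor k Λ).flip.obj ((tw (leftTw ψ)).obj (regBimod k Λ)) ⟶
      tw (rightTw ψ.symm) where
  app X :=
    let φ : leftMod X →+ leftMod ((tw (leftTw ψ)).obj (regBimod k Λ)) →+
        (tw (rightTw ψ.symm)).obj X :=
      AddMonoidHom.mk' (fun x => AddMonoidHom.mk'
        (fun l => (rightMul X x (ψ.symm ((toReg k Λ).symm l)) : X))
        fun l l' => (congrArg (fun z => rightMul X x (ψ.symm z))
          ((toReg k Λ).symm.map_add l l')).trans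
          ((congrArg (rightMul X x) (map_add ψ.symm _ _)).trans (rightMul_add X x _ _)))
        fun x x' => AddMonoidHom.ext fun l => add_rightMul X x x' _
    biHom (Z := (tw (rightTw ψ.symm)).obj X) (balLift φ fun x l l' => by
        change rightMul X (rightMul X x l) (ψ.symm ((toReg k Λ).symm l')) =
          rightMul X x (ψ.symm ((toReg k Λ).symm
            (l • l' : leftMod ((tw (leftTw ψ)).obj (regBimod k Λ)))))
        rw [toReg_symm_tw_smul, map_mul, AlgEquiv.symm_apply_apply, rightMul_rightMul])
      fun a l x b => by
        refine Eq.trans ?_ (tmul_smul_eq X a (ψ.symm l)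
          (rightMul X x (ψ.symm ((toReg k Λ).symm b)))).symm
        change rightMul X (a • x) (ψ.symm ((toReg k Λ).symm
          (rightMul ((tw (leftTw ψ)).obj (regBimod k Λ)) b l))) = _
        rw [toReg_symm_tw_rightMul, map_mul, ← rightMul_rightMul, rightMul_smul, rightMul_smul]
  naturality _ _ g := biHom_ext fun x b => (leftHom_rightMul g x _).symm

theorem twReg_hasRightProjective (ψ : Λ ≃ₐ[k] Λ) (m : ℕ) : RightProjective (twReg ψ m) :=
  twReg_rightProjective ψ m

theorem regBimod_rightProjective : RightProjective (regBimod k Λ) := by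
  have e : Λᵐᵒᵖ ≃ₗ[Λᵐᵒᵖ] rightMod (regBimod k Λ) :=
    { MulOpposite.opAddEquiv.symm.trans (toReg k Λ) with
      map_smul' := fun a x => by
        change toReg k Λ (a * x).unop = ((1 : Λ) ⊗ₜ[k] a : Env k Λ) • toReg k Λ x.unop
        rw [smul_toReg]
        simp }
  exact Module.Projective.of_equiv' e

/-- The element `η_{ψ⁻¹}`, viewed in `Ext_{Λᵉ}^{tn}(_{ψⁿ⁺¹}Λ_1, _ψΛ_1)`. -/
noncomputable def rightTwist {ψ : Λ ≃ₐ[k] Λ} {t n : ℕ} (η : HHdeg ψ t n) :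
    Ext (twReg ψ (n + 1)) ((tw (leftTw ψ)).obj (regBimod k Λ)) (t * n) :=
  (Ext.mk₀ (srcTwist ψ n)).comp
    ((twExt (rightTw ψ.symm) η).comp (Ext.mk₀ (tgtTwist ψ)) (add_zero _)) (zero_add _)

/-- This is the interchange law for `x` in the left variable and `y` in the right variable.
Tensoring `x` with `_ψΛ` on the right gives `x_{ψ⁻¹}`, tensoring `y` with `_{ψᵐ}Λ` on the left gives
`_{ψᵐ}y`, and tensoring either with `Λ` on the side of the other variable changes nothing. It plays
the role of graded commutativity of ordinary Hochschild cohomology, with a twist on each side. -/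
theorem rightTwist_comp [Module.Projective k Λ] {ψ : Λ ≃ₐ[k] Λ} {t m b c : ℕ} (x : HHdeg ψ t m)
    (y : Ext ((tw (leftTw ψ)).obj (regBimod k Λ)) (regBimod k Λ) b) (h : t * m + b = c)
    (h' : b + t * m = c) :
    (rightTwist x).comp y h = (-1 : ℤ) ^ (t * m * b) •
      (Ext.mk₀ (twComp (show leftTw ψ ^ (m + 1) = (leftTw ψ).comp (leftTw ψ ^ m) from
        pow_succ' _ _) (regBimod k Λ))).comp ((twExt (leftTw ψ ^ m) y).comp x h') (zero_add c) := by
  have hX := twReg_hasRightProjective ψ m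
  have hL : RightProjective (regBimod k Λ) := regBimod_rightProjective
  have := biTensorFunctor_preservesFiniteLimits hX
  have := biTensorFunctor_preservesFiniteColimits hX
  have := biTensorFunctor_preservesFiniteLimits hL
  have := biTensorFunctor_preservesFiniteColimits hL
  have hsyz := (biTensorFunctor_relExact (regBimod k Λ)).syz
  let u : twReg ψ (m + 1) ⟶ (tw (leftTw ψ ^ m)).obj ((tw (leftTw ψ)).obj (regBimod k Λ)) :=
    twComp (show leftTw ψ ^ (m + 1) = (leftTw ψ).comp (leftTw ψ ^ m) from
        pow_succ' _ _) (regBimod k Λ)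
  have hint := relExt_comp_mapExactFunctor (biTensorFunctor k Λ) biTensorFunctor_relExact
    (fun X hX => rightMod_projective X hX)
    (fun _ => biTensorFunctor_preservesFiniteLimits)
    (fun _ => biTensorFunctor_preservesFiniteColimits) hX x y h h'
  -- The four natural maps turn tensored classes into untensored ones: `Λ ⊗ y` into `y`, `x ⊗ _ψΛ`
  -- into `x_{ψ⁻¹}`, `x ⊗ Λ` into `x`, and `_{ψᵐ}Λ ⊗ y` into `_{ψᵐ}y`.
  have n₁ := mapExactFunctor_naturality _ _ (ofBiTensorLeft k Λ) y
  have n₂ := relExt_naturality (biTensorFunctor_relExact ((tw (leftTw ψ)).obj (regBimod k Λ)))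
    (RelExact.of_exact hsyz (tw (rightTw ψ.symm))) (ofBiTensorTwist ψ) hX x
  have n₄ := relExt_naturality (biTensorFunctor_relExact (regBimod k Λ))
    (RelExact.of_exact hsyz (𝟭 _)) (ofBiTensorRight k Λ) hX x
  have n₅ := mapExactFunctor_naturality _ _ (toBiTensor ψ m) y
  rw [mapExactFunctor_id] at n₁
  rw [relExt_eq_mapExactFunctor (RelExact.of_exact hsyz (tw (rightTw ψ.symm)))] at n₂
  rw [relExt_eq_mapExactFunctor (RelExact.of_exact hsyz (𝟭 _))] at n₄
  rw [mapExactFunctor_id] at n₄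
  -- On `Λ ⊗ _ψΛ` the left action gives `ψ(x) b`, the twisted right action gives `x ψ⁻¹(b)`, and `ψ`
  -- carries the second to the first. This is where `tgtTwist` enters.
  have hβ : (ofBiTensorLeft k Λ).app ((tw (leftTw ψ)).obj (regBimod k Λ)) =
      (ofBiTensorTwist ψ).app (regBimod k Λ) ≫ tgtTwist ψ :=
    biHom_ext fun x b => (toReg k Λ).symm.injective (by
      change (toReg k Λ).symm ((toReg k Λ).symm x • b : leftMod ((tw (leftTw ψ)).obj
        (regBimod k Λ))) = ψ ((toReg k Λ).symm (rightMul (regBimod k Λ) x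
          (ψ.symm ((toReg k Λ).symm b))))
      rw [toReg_symm_tw_smul, toReg_symm_rightMul, map_mul, AlgEquiv.apply_symm_apply])
  have hβ' : (ofBiTensorLeft k Λ).app (regBimod k Λ) =
      (ofBiTensorRight k Λ).app (regBimod k Λ) :=
    biHom_ext fun x b => (toReg k Λ).symm.injective
      ((toReg_symm_smul ((toReg k Λ).symm x) b).trans (toReg_symm_rightMul _ x).symm)
  have hα : (u ≫ (toBiTensor ψ m).app _) ≫ (ofBiTensorTwist ψ).app (twReg ψ m) =
      srcTwist ψ m := by
    ext b
    exact (rightMul_twReg ψ m 1 _).trans (congrArg (toReg k Λ) (one_mul _))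
  have hα' : (toBiTensor ψ m).app _ ≫ (ofBiTensorRight k Λ).app (twReg ψ m) = 𝟙 _ := by
    ext b
    exact (rightMul_twReg ψ m 1 _).trans (congrArg (toReg k Λ) (one_mul _))
  rw [hβ] at n₁
  rw [← hβ'] at n₄
  have n₅' : (Ext.mk₀ (u ≫ (toBiTensor ψ m).app _)).comp
      (y.mapExactFunctor ((biTensorFunctor k Λ).obj (twReg ψ m))) (zero_add b) =
      ((Ext.mk₀ u).comp (twExt (leftTw ψ ^ m) y) (zero_add b)).comp
        (Ext.mk₀ ((toBiTensor ψ m).app (regBimod k Λ))) (add_zero b) := by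
    rw [← Ext.mk₀_comp_mk₀, Ext.comp_assoc (a₂₃ := b) _ _ _ (by lia) (by lia) (by lia),
      Ext.comp_assoc (a₂₃ := b) _ _ _ (by lia) (by lia) (by lia), ← n₅]
    rfl
  refine (ext_skew_aux h h' _ hint n₁ n₂ hα n₄ n₅' hα').trans ?_
  congr 1
  rw [Ext.comp_assoc (a₂₃ := c) _ _ _ (by lia) (by lia) (by lia)]
  congr 2
  exact Ext.mk₀_id_comp _

end SkewCommutativity

/-! ### Products of two elements of degree t are invariant -/

section Invariance

theorem ext_comp_comp_congr {D : Type v} [Category.{u} D] [Abelian D] [HasExt.{u} D]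
    {X Y Z W : D} {n a b c c' d : ℕ} (f : Ext X Y n) (α : Ext Y Z a) (β : Ext Z W b)
    (h : a + b = c) (h' : a + b = c') (e : n + c = d) (e' : n + c' = d) :
    f.comp (α.comp β h) e = f.comp (α.comp β h') e' := by
  subst h
  subst h'
  rfl

/-- Here `F` is the twist by `ψ` on the left and `G` the twist by `ψ⁻¹` on the right. With `σ(x)`
the transported right twist, `skew` reads `y ∘ σ(x) = ε x ∘ F(y)`. Since `F` is surjective on Ext,
`σ(x) = F(x')`, and `σ(x) ∘ F(σ(y)) = F(x' ∘ σ(y)) = ε F(y ∘ σ(x)) = ε² F(x ∘ F(y))`. That `x` and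
`y` have the same type is essential: the relation is applied to the pairs `(y, x')` and `(x, y)`. -/
theorem twist_invariant_aux {D : Type v} [Category.{u} D] [Abelian D] [EnoughProjectives D]
    [HasExt.{u} D] (F G : D ⥤ D) [F.Additive] [Limits.PreservesFiniteLimits F]
    [Limits.PreservesFiniteColimits F] [G.Additive] [Limits.PreservesFiniteLimits G]
    [Limits.PreservesFiniteColimits G] (κ : G ⋙ F ⟶ F ⋙ G) {A : D} {a c : ℕ} (h : a + a = c)
    (hsurj : ∀ α : Ext (F.obj (F.obj A)) (F.obj A) a,
      ∃ β : Ext (F.obj A) A a, β.mapExactFunctor F = α)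
    (s : F.obj (F.obj A) ⟶ G.obj (F.obj A)) (t : G.obj A ⟶ F.obj A)
    (hst : F.map t ≫ s = κ.app A) (ε : ℤ) (hε : ε * ε = 1)
    (skew : ∀ x y : Ext (F.obj A) A a,
      ((Ext.mk₀ s).comp ((x.mapExactFunctor G).comp (Ext.mk₀ t) (add_zero a)) (zero_add a)).comp y h
        = ε • (y.mapExactFunctor F).comp x h) (x y : Ext (F.obj A) A a) :
    (Ext.mk₀ (F.map s ≫ κ.app (F.obj A))).comp
      ((Ext.mapExactFunctor G ((y.mapExactFunctor F).comp x h)).comp (Ext.mk₀ t) (add_zero c))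
      (zero_add c) = Ext.mapExactFunctor F ((y.mapExactFunctor F).comp x h) := by
  let σ (x : Ext (F.obj A) A a) : Ext (F.obj (F.obj A)) (F.obj A) a :=
    (Ext.mk₀ s).comp ((x.mapExactFunctor G).comp (Ext.mk₀ t) (add_zero a)) (zero_add a)
  have hσ : ∀ x y : Ext (F.obj A) A a, (σ x).comp y h = ε • (y.mapExactFunctor F).comp x h := skew
  obtain ⟨x', hx'⟩ := hsurj (σ x)
  have nat : (Ext.mapExactFunctor F (y.mapExactFunctor G)).comp (Ext.mk₀ (κ.app A)) (add_zero a) =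
      (Ext.mk₀ (κ.app (F.obj A))).comp (Ext.mapExactFunctor G (y.mapExactFunctor F))
        (zero_add a) := by
    have := mapExactFunctor_naturality (G ⋙ F) (F ⋙ G) κ y
    rwa [← mapExactFunctor_mapExactFunctor, ← mapExactFunctor_mapExactFunctor] at this
  -- The right twist is multiplicative: applied to `x ∘ F(y)` it gives `σ(x) ∘ F(σ(y))`. The inner
  -- maps `F(t)` and `s` combine to the swap `κ`, which is then moved past `y` by naturality.
  have e₁ : (Ext.mapExactFunctor F (σ y)).comp (σ x) h =
      (Ext.mk₀ (F.map s ≫ κ.app (F.obj A))).comp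
      ((Ext.mapExactFunctor G ((y.mapExactFunctor F).comp x h)).comp (Ext.mk₀ t) (add_zero c))
      (zero_add c) := by
    simp only [σ]
    rw [Ext.mapExactFunctor_comp, Ext.mapExactFunctor_comp, Ext.mapExactFunctor_comp,
      Ext.mapExactFunctor_mk₀, Ext.mapExactFunctor_mk₀,
      Ext.comp_assoc (a₂₃ := c) _ _ _ (by omega) (by omega) (by omega),
      Ext.comp_assoc (a₂₃ := a) _ _ _ (by omega) (by omega) (by omega),
      ← Ext.comp_assoc (a₁₂ := 0) (Ext.mk₀ (F.map t)) _ _ (by omega) (by omega) (by omega),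
      Ext.mk₀_comp_mk₀, hst,
      ← Ext.comp_assoc (a₁₂ := a) (Ext.mapExactFunctor F _) (Ext.mk₀ (κ.app A)) _
        (by omega) (by omega) (by omega), nat,
      Ext.comp_assoc (a₂₃ := c) (Ext.mk₀ (κ.app (F.obj A))) _ _ (by omega) (by omega) (by omega),
      ← Ext.mk₀_comp_mk₀,
      Ext.comp_assoc (a₂₃ := c) (Ext.mk₀ (F.map s)) _ _ (by omega) (by omega) (by omega),
      Ext.comp_assoc (a₂₃ := a) _ _ (Ext.mk₀ t) (by omega) (by omega) (by omega)]
  rw [← e₁, ← hx', ← Ext.mapExactFunctor_comp, hσ, hx', ← ext_zsmul_comp,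
    show ε • σ x = σ (ε • x) from ?_, hσ, ext_comp_zsmul, smul_smul, hε, one_smul]
  change _ = (Ext.mk₀ s).comp ((G.mapExtAddHom _ _ a (ε • x)).comp (Ext.mk₀ t)
    (add_zero a)) (zero_add a)
  rw [map_zsmul, ext_zsmul_comp, ext_comp_zsmul]
  rfl

/-- The preimage is the twist of `α` by the inverse automorphism, conjugated by the identity maps
between a module and its double twist. -/
theorem twExt_surjective {R : Type u} [Ring R] (f g : R →+* R) (hfg : f.comp g = RingHom.id R)
    (hgf : g.comp f = RingHom.id R) {X Y : ModuleCat.{u} R} {n : ℕ}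
    (α : Ext ((tw f).obj X) ((tw f).obj Y) n) : ∃ β : Ext X Y n, twExt f β = α := by
  let i (Z : ModuleCat.{u} R) : Z ⟶ (tw g).obj ((tw f).obj Z) :=
    (ModuleCat.restrictScalarsId'App _ rfl Z).inv ≫ twComp hfg.symm Z
  let j (Z : ModuleCat.{u} R) : (tw g).obj ((tw f).obj Z) ⟶ Z :=
    (ModuleCat.restrictScalarsComp'App _ _ _ hfg.symm Z).inv ≫ twOne rfl Z
  refine ⟨(Ext.mk₀ (i X)).comp ((twExt g α).comp (Ext.mk₀ (j Y)) (add_zero n)) (zero_add n), ?_⟩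
  have h₁ := twExt_twExt hgf.symm α
  have h₂ := twExt_one (f := RingHom.id R) rfl α
  let i' (Z : ModuleCat.{u} R) : Z ⟶ (tw (RingHom.id R)).obj Z :=
    (ModuleCat.restrictScalarsId'App _ rfl Z).inv
  have e₁ : (tw f).map (i X) = i' _ ≫ twComp hgf.symm ((tw f).obj X) := rfl
  have e₂ : twComp hgf.symm ((tw f).obj Y) ≫ (tw f).map (j Y) = twOne rfl _ := rfl
  have e₃ : i' ((tw f).obj X) ≫ twOne rfl ((tw f).obj X) = 𝟙 _ := rfl
  rw [twExt_comp, twExt_comp, twExt_mk₀, twExt_mk₀, e₁, ← Ext.mk₀_comp_mk₀,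
    Ext.comp_assoc (a₂₃ := n) (Ext.mk₀ (i' _)) _ _ (by omega) (by omega) (by omega),
    ← Ext.comp_assoc (a₁₂ := n) _ _ (Ext.mk₀ ((tw f).map (j Y))) (by omega) (by omega) (by omega),
    ← h₁, Ext.comp_assoc (a₂₃ := 0) (twExt _ α) _ _ (by omega) (by omega) (by omega),
    Ext.mk₀_comp_mk₀, e₂, h₂, ← Ext.comp_assoc (a₁₂ := 0) _ _ α (by omega) (by omega) (by omega),
    Ext.mk₀_comp_mk₀, e₃, Ext.mk₀_id_comp]

variable {k : Type v} {Λ : Type u} [CommRing k] [Ring Λ] [Algebra k Λ]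

theorem leftTw_comp_symm (ψ : Λ ≃ₐ[k] Λ) : (leftTw ψ).comp (leftTw ψ.symm) = RingHom.id _ := by
  refine RingHom.ext fun x => ?_
  induction x using TensorProduct.induction_on with
  | zero => simp
  | tmul a b =>
    change leftTw ψ (leftTw ψ.symm (a ⊗ₜ b)) = _
    rw [leftTw_tmul, leftTw_tmul, AlgEquiv.apply_symm_apply]
    rfl
  | add x y hx hy => rw [map_add, map_add, hx, hy]

theorem leftTw_symm_comp (ψ : Λ ≃ₐ[k] Λ) : (leftTw ψ.symm).comp (leftTw ψ) = RingHom.id _ :=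
  leftTw_comp_symm ψ.symm

theorem leftTw_comp_rightTw (ψ ρ : Λ ≃ₐ[k] Λ) :
    (leftTw ψ).comp (rightTw ρ) = (rightTw ρ).comp (leftTw ψ) := by
  refine RingHom.ext fun x => ?_
  induction x using TensorProduct.induction_on with
  | zero => simp
  | tmul a b => rfl
  | add x y hx hy => rw [map_add, map_add, hx, hy]

theorem twComp_apply {R : Type u} [Ring R] {f g gf : R →+* R} (h : gf = g.comp f)
    (X : ModuleCat.{u} R) (x : X) : (twComp h X).hom x = x := rfl

theorem tw_map_apply {R : Type u} [Ring R] {f : R →+* R} {X Y : ModuleCat.{u} R} (g : X ⟶ Y)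
    (x : X) : ((tw f).map g).hom x = g.hom x := rfl

theorem hom_comp_apply {R : Type u} [Ring R] {X Y Z : ModuleCat.{u} R} (f : X ⟶ Y) (g : Y ⟶ Z)
    (x : X) : (f ≫ g).hom x = g.hom (f.hom x) := rfl

/-- The identification `_ψ(B_ρ) = (_ψB)_ρ`. -/
noncomputable def twSwap (ψ ρ : Λ ≃ₐ[k] Λ) :
    tw (rightTw ρ) ⋙ tw (leftTw ψ) ⟶ tw (leftTw ψ) ⋙ tw (rightTw ρ) :=
  (ModuleCat.restrictScalarsComp' (leftTw ψ) (rightTw ρ) _ rfl).inv ≫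
    (ModuleCat.restrictScalarsComp' (rightTw ρ) (leftTw ψ) _ (leftTw_comp_rightTw ψ ρ).symm).hom

theorem twSwap_apply (ψ ρ : Λ ≃ₐ[k] Λ) (X : ModuleCat.{u} (Env k Λ)) (z : X) :
    ((twSwap ψ ρ).app X).hom z = z := rfl

/-- The isomorphism of bimodules `ψ⁻¹ : _ψ(_ψΛ_1) → (_ψΛ)_{ψ⁻¹}`. -/
noncomputable def twRegSymm (ψ : Λ ≃ₐ[k] Λ) :
    (tw (leftTw ψ)).obj ((tw (leftTw ψ)).obj (regBimod k Λ)) ⟶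
      (tw (rightTw ψ.symm)).obj ((tw (leftTw ψ)).obj (regBimod k Λ)) :=
  (ModuleCat.restrictScalarsComp'App _ _ _ (show leftTw ψ ^ (1 + 1) =
    (leftTw ψ).comp (leftTw ψ) from pow_two _) _).inv ≫ srcTwist ψ 1 ≫
      (tw (rightTw ψ.symm)).map (twCongr (pow_one _) _)

theorem twRegSymm_apply (ψ : Λ ≃ₐ[k] Λ) (z : Λ) :
    (twRegSymm ψ).hom (toReg k Λ z) = toReg k Λ (ψ.symm z) := rfl

theorem srcTwist_apply (ψ : Λ ≃ₐ[k] Λ) (n : ℕ) (z : Λ) :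
    (srcTwist ψ n).hom (toReg k Λ z) = toReg k Λ (ψ.symm z) := rfl

theorem tgtTwist_apply (ψ : Λ ≃ₐ[k] Λ) (z : Λ) :
    (tgtTwist ψ).hom (toReg k Λ z) = toReg k Λ (ψ z) := rfl

theorem tw_map_tgtTwist_toReg (ψ : Λ ≃ₐ[k] Λ) (z : Λ) :
    ((tw (leftTw ψ)).map (tgtTwist ψ)).hom (toReg k Λ z) = toReg k Λ (ψ z) := rfl

theorem twRegSymm_tgtTwist_toReg (ψ : Λ ≃ₐ[k] Λ) (z : Λ) :
    (twRegSymm ψ).hom (((tw (leftTw ψ)).map (tgtTwist ψ)).hom (toReg k Λ z)) = toReg k Λ z := by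
  rw [tw_map_tgtTwist_toReg, twRegSymm_apply, AlgEquiv.symm_apply_apply]

theorem tgtTwist_twRegSymm_toReg (ψ : Λ ≃ₐ[k] Λ) (z : Λ) :
    ((tw (leftTw ψ)).map (tgtTwist ψ) ≫ twRegSymm ψ).hom (toReg k Λ z) = toReg k Λ z :=
  (hom_comp_apply ((tw (leftTw ψ)).map (tgtTwist ψ)) (twRegSymm ψ) (toReg k Λ z)).trans
    (twRegSymm_tgtTwist_toReg ψ z)

theorem twSwap_toReg (ψ : Λ ≃ₐ[k] Λ) (z : Λ) :
    ((twSwap ψ ψ.symm).app (regBimod k Λ)).hom (toReg k Λ z) = toReg k Λ z :=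
  twSwap_apply ψ ψ.symm (regBimod k Λ) (toReg k Λ z)

theorem tgtTwist_twRegSymm_twSwap_toReg (ψ : Λ ≃ₐ[k] Λ) (z : Λ) :
    ((tw (leftTw ψ)).map (tgtTwist ψ) ≫ twRegSymm ψ).hom (toReg k Λ z) =
      ((twSwap ψ ψ.symm).app (regBimod k Λ)).hom (toReg k Λ z) :=
  (tgtTwist_twRegSymm_toReg ψ z).trans (twSwap_toReg ψ z).symm

theorem tgtTwist_twRegSymm (ψ : Λ ≃ₐ[k] Λ) :
    (tw (leftTw ψ)).map (tgtTwist ψ) ≫ twRegSymm ψ = (twSwap ψ ψ.symm).app (regBimod k Λ) :=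
  ModuleCat.hom_ext (LinearMap.ext fun z =>
    tgtTwist_twRegSymm_twSwap_toReg ψ ((toReg k Λ).symm z))

theorem tw_map_comp_twSwap_toReg (ψ : Λ ≃ₐ[k] Λ) (z : Λ) :
    ((tw (leftTw ψ)).map (twRegSymm ψ) ≫
      (twSwap ψ ψ.symm).app ((tw (leftTw ψ)).obj (regBimod k Λ))).hom (toReg k Λ z) =
      toReg k Λ (ψ.symm z) :=
  (twSwap_apply ψ ψ.symm ((tw (leftTw ψ)).obj (regBimod k Λ)) _).trans
    ((tw_map_apply (f := leftTw ψ) (twRegSymm ψ) (toReg k Λ z)).trans (twRegSymm_apply ψ z))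

theorem srcTwist_comp_map_toReg (ψ : Λ ≃ₐ[k] Λ) (n : ℕ) {Y : ModuleCat.{u} (Env k Λ)}
    (f : twReg ψ n ⟶ Y) (z : Λ) :
    (srcTwist ψ n ≫ (tw (rightTw ψ.symm)).map f).hom (toReg k Λ z) =
      f.hom (toReg k Λ (ψ.symm z)) :=
  (tw_map_apply (f := rightTw ψ.symm) f _).trans
    (congrArg (fun x => f.hom x) (srcTwist_apply ψ n z))

theorem twComp_map_comp_toReg {R : Type u} [Ring R] {f g gf : R →+* R} (h : gf = g.comp f)
    (X : ModuleCat.{u} R) {Y Z : ModuleCat.{u} R} (u : (tw g).obj X ⟶ Y) (v : (tw f).obj Y ⟶ Z)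
    (x : X) : ((twComp h X ≫ (tw f).map u) ≫ v).hom x = v.hom (u.hom x) := rfl

theorem srcTwist_two_toReg (ψ : Λ ≃ₐ[k] Λ) (z : Λ) :
    (srcTwist ψ (1 + 1) ≫ (tw (rightTw ψ.symm)).map (twComp (pow_two (leftTw ψ))
      (regBimod k Λ))).hom (toReg k Λ z) = toReg k Λ (ψ.symm z) :=
  (srcTwist_comp_map_toReg ψ (1 + 1) _ z).trans
    (twComp_apply (pow_two (leftTw ψ)) (regBimod k Λ) (toReg k Λ (ψ.symm z)))

theorem twComp_twRegSymm_toReg (ψ : Λ ≃ₐ[k] Λ) (z : Λ) :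
    ((twComp (show leftTw ψ ^ (1 + 1 + 1) = (leftTw ψ ^ (1 + 1)).comp (leftTw ψ) from
      pow_succ _ _) (regBimod k Λ) ≫ (tw (leftTw ψ)).map (twComp (pow_two _) (regBimod k Λ))) ≫
      (tw (leftTw ψ)).map (twRegSymm ψ) ≫
        (twSwap ψ ψ.symm).app ((tw (leftTw ψ)).obj (regBimod k Λ))).hom (toReg k Λ z) =
      toReg k Λ (ψ.symm z) :=
  (twComp_map_comp_toReg _ (regBimod k Λ) _ _ (toReg k Λ z)).trans
    ((congrArg (fun x => ((tw (leftTw ψ)).map (twRegSymm ψ) ≫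
      (twSwap ψ ψ.symm).app ((tw (leftTw ψ)).obj (regBimod k Λ))).hom x)
      (twComp_apply (pow_two (leftTw ψ)) (regBimod k Λ) (toReg k Λ z))).trans
      (tw_map_comp_twSwap_toReg ψ z))

theorem srcTwist_two (ψ : Λ ≃ₐ[k] Λ) :
    srcTwist ψ (1 + 1) ≫ (tw (rightTw ψ.symm)).map (twComp (pow_two (leftTw ψ)) (regBimod k Λ)) =
      (twComp (show leftTw ψ ^ (1 + 1 + 1) = (leftTw ψ ^ (1 + 1)).comp (leftTw ψ) from
        pow_succ _ _) (regBimod k Λ) ≫ (tw (leftTw ψ)).map (twComp (pow_two _) (regBimod k Λ))) ≫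
      (tw (leftTw ψ)).map (twRegSymm ψ) ≫
        (twSwap ψ ψ.symm).app ((tw (leftTw ψ)).obj (regBimod k Λ)) :=
  ModuleCat.hom_ext (LinearMap.ext fun z => (srcTwist_two_toReg ψ ((toReg k Λ).symm z)).trans
    (twComp_twRegSymm_toReg ψ ((toReg k Λ).symm z)).symm)

/-- The products of two elements of degree `t` of the twisted Hochschild cohomology ring are
invariant. -/
theorem twistInvariant_mul [Module.Projective k Λ] {ψ : Λ ≃ₐ[k] Λ} {t : ℕ} (x y : HHdeg ψ t 1) :
    TwistInvariant (TwExt.mul x y) := by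
  let A := regBimod k Λ
  let F := tw (leftTw ψ)
  let G := tw (rightTw ψ.symm)
  let κ : G ⋙ F ⟶ F ⋙ G := twSwap ψ ψ.symm
  have p₂ : leftTw ψ ^ (1 + 1) = (leftTw ψ).comp (leftTw ψ) := pow_two _
  let u₂ : twReg ψ (1 + 1) ⟶ F.obj (F.obj A) := twComp p₂ A
  let u₂' : F.obj (F.obj A) ⟶ twReg ψ (1 + 1) := (ModuleCat.restrictScalarsComp'App _ _ _ p₂ A).inv
  -- The first power of the twist is equal but not syntactically identical to the twist itself, so
  -- classes of index `1` are carried to classes on `F.obj A` along identity maps.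
  let j (Z : ModuleCat.{u} (Env k Λ)) : (tw (leftTw ψ ^ 1)).obj Z ⟶ F.obj Z := twCongr (pow_one _) Z
  let j' (Z : ModuleCat.{u} (Env k Λ)) : F.obj Z ⟶ (tw (leftTw ψ ^ 1)).obj Z :=
    twCongr (pow_one _).symm Z
  have hj : ∀ {X Y : ModuleCat.{u} (Env k Λ)} {n : ℕ} (α : Ext X Y n),
      (twExt (leftTw ψ ^ 1) α).comp (Ext.mk₀ (j Y)) (add_zero n) =
        (Ext.mk₀ (j X)).comp (twExt (leftTw ψ) α) (zero_add n) := fun α =>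
    mapExactFunctor_naturality _ _ (ModuleCat.restrictScalarsCongr (pow_one (leftTw ψ))).hom α
  let s : F.obj (F.obj A) ⟶ G.obj (F.obj A) := twRegSymm ψ
  have hs : s = u₂' ≫ srcTwist ψ 1 ≫ G.map (j A) := rfl
  have hst : F.map (tgtTwist ψ) ≫ s = κ.app A := tgtTwist_twRegSymm ψ
  have skew : ∀ x y : Ext (F.obj A) A (t * 1),
      ((Ext.mk₀ s).comp ((x.mapExactFunctor G).comp (Ext.mk₀ (tgtTwist ψ)) (add_zero _))
        (zero_add _)).comp y (show t * 1 + t * 1 = t * (1 + 1) by ring)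
        = (-1 : ℤ) ^ (t * 1 * (t * 1)) •
          (y.mapExactFunctor F).comp x (show t * 1 + t * 1 = t * (1 + 1) by ring) := by
    intro x y
    have h := rightTwist_comp (ψ := ψ) (t := t) (m := 1) ((Ext.mk₀ (j A)).comp x (zero_add _)) y
      (show t * 1 + t * 1 = t * (1 + 1) by ring) (show t * 1 + t * 1 = t * (1 + 1) by ring)
    have e₁ : (Ext.mk₀ s).comp ((x.mapExactFunctor G).comp (Ext.mk₀ (tgtTwist ψ)) (add_zero _))
        (zero_add _) = (Ext.mk₀ u₂').comp
          (rightTwist (ψ := ψ) (t := t) ((Ext.mk₀ (j A)).comp x (zero_add _))) (zero_add _) := by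
      simp only [hs, rightTwist]
      rw [twExt_comp, twExt_mk₀, ← Ext.mk₀_comp_mk₀, ← Ext.mk₀_comp_mk₀,
        Ext.comp_assoc (a₁₂ := 0) (a₂₃ := t * 1) (Ext.mk₀ u₂') _ _ (by omega) (by omega) (by omega),
        Ext.comp_assoc (a₁₂ := 0) (a₂₃ := t * 1) (Ext.mk₀ (srcTwist ψ 1)) _ _
          (by omega) (by omega) (by omega),
        Ext.comp_assoc (a₁₂ := t * 1) (a₂₃ := t * 1) (Ext.mk₀ (G.map (j A))) _ _
          (by omega) (by omega) (by omega)]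
      rfl
    let u₁ : twReg ψ (1 + 1) ⟶ (tw (leftTw ψ ^ 1)).obj (F.obj A) := twComp (pow_succ' _ _) A
    have hid : (u₂' ≫ u₁) ≫ j _ = 𝟙 _ := rfl
    rw [e₁, Ext.comp_assoc (a₂₃ := t * (1 + 1)) _ _ _ (by omega) (by omega) (by omega), h,
      ext_comp_zsmul,
      ← Ext.comp_assoc (a₁₂ := 0) (Ext.mk₀ u₂') _ _ (by omega) (by omega) (by omega),
      Ext.mk₀_comp_mk₀,
      ← Ext.comp_assoc (a₁₂ := t * 1) (twExt (leftTw ψ ^ 1) y) (Ext.mk₀ (j A)) x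
        (by omega) (by omega) (by omega), hj,
      Ext.comp_assoc (a₂₃ := t * (1 + 1)) (Ext.mk₀ (j _)) _ x (by omega) (by omega) (by omega),
      ← Ext.comp_assoc (a₁₂ := 0) _ (Ext.mk₀ (j _)) _ (by omega) (by omega) (by omega),
      Ext.mk₀_comp_mk₀]
    exact congrArg _ (Ext.mk₀_id_comp _)
  -- The sign `ε` is `(-1)^(t²)`, whose square is `1`; no parity condition on `t` is needed.
  have key := twist_invariant_aux F G κ (show t * 1 + t * 1 = t * (1 + 1) by ring)
    (twExt_surjective _ _ (leftTw_comp_symm ψ) (leftTw_symm_comp ψ)) s (tgtTwist ψ) hst _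
    (by rw [← pow_add, ← two_mul, pow_mul]; simp) skew
    ((Ext.mk₀ (j' A)).comp x (zero_add _)) ((Ext.mk₀ (j' A)).comp y (zero_add _))
  have hz : TwExt.mul x y = (Ext.mk₀ u₂).comp (Ext.comp
      (Ext.mapExactFunctor F ((Ext.mk₀ (j' A)).comp y (zero_add _)))
      ((Ext.mk₀ (j' A)).comp x (zero_add _)) (show t * 1 + t * 1 = t * (1 + 1) by ring))
      (zero_add _) := by
    have hj' : (Ext.mapExactFunctor F y).comp (Ext.mk₀ (j' A)) (add_zero _) =
        (Ext.mk₀ (j' (twReg ψ 1))).comp (twExt (leftTw ψ ^ 1) y) (zero_add _) :=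
      mapExactFunctor_naturality _ _
        (ModuleCat.restrictScalarsCongr (pow_one (leftTw ψ)).symm).hom y
    have e : twComp (pow_add_eq_comp (leftTw ψ) 1 1) A =
        u₂ ≫ F.map (j' A) ≫ j' (twReg ψ 1) := rfl
    rw [Ext.mapExactFunctor_comp, Ext.mapExactFunctor_mk₀,
      Ext.comp_assoc (a₂₃ := t * (1 + 1)) (Ext.mk₀ (F.map (j' A))) _ _
        (by omega) (by omega) (by omega),
      ← Ext.comp_assoc (a₁₂ := t * 1) _ (Ext.mk₀ (j' A)) x (by omega) (by omega) (by omega), hj',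
      Ext.comp_assoc (a₂₃ := t * (1 + 1)) (Ext.mk₀ (j' _)) _ x (by omega) (by omega) (by omega),
      ← Ext.comp_assoc (a₁₂ := 0) _ (Ext.mk₀ (j' _)) _ (by omega) (by omega) (by omega),
      ← Ext.comp_assoc (a₁₂ := 0) (Ext.mk₀ u₂) _ _ (by omega) (by omega) (by omega),
      Ext.mk₀_comp_mk₀, Ext.mk₀_comp_mk₀, ← e]
    exact ext_comp_comp_congr _ _ _ _ _ _ _
  have e : srcTwist ψ (1 + 1) ≫ G.map u₂ = (twComp (show leftTw ψ ^ (1 + 1 + 1) =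
    (leftTw ψ ^ (1 + 1)).comp (leftTw ψ) from pow_succ _ _) A ≫ F.map u₂) ≫
      F.map s ≫ κ.app (F.obj A) := srcTwist_two ψ
  generalize Ext.comp (Ext.mapExactFunctor F ((Ext.mk₀ (j' A)).comp y (zero_add _)))
      ((Ext.mk₀ (j' A)).comp x (zero_add _)) (show t * 1 + t * 1 = t * (1 + 1) by ring) = z
      at hz key
  have eG : twExt (rightTw ψ.symm) (TwExt.mul x y) =
      (Ext.mk₀ (G.map u₂)).comp (z.mapExactFunctor G) (zero_add _) := by
    rw [hz, twExt_comp, twExt_mk₀]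
    rfl
  have eF : twExt (leftTw ψ) (TwExt.mul x y) =
      (Ext.mk₀ (F.map u₂)).comp (z.mapExactFunctor F) (zero_add _) := by
    rw [hz, twExt_comp, twExt_mk₀]
    rfl
  unfold TwistInvariant
  rw [eG, eF, ← key,
    Ext.comp_assoc (a₂₃ := t * (1 + 1)) (Ext.mk₀ (G.map u₂)) _ _ (by omega) (by omega) (by omega),
    ← Ext.comp_assoc (a₁₂ := 0) _ (Ext.mk₀ (G.map u₂)) _ (by omega) (by omega) (by omega),
    Ext.mk₀_comp_mk₀, e, ← Ext.mk₀_comp_mk₀,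
    Ext.comp_assoc (a₂₃ := t * (1 + 1)) _ (Ext.mk₀ (F.map s ≫ κ.app (F.obj A))) _
      (by omega) (by omega) (by omega), ← Ext.mk₀_comp_mk₀,
    Ext.comp_assoc (a₂₃ := t * (1 + 1)) _ (Ext.mk₀ (F.map u₂)) _ (by omega) (by omega) (by omega)]

end Invariance

/-! ### Tensoring with M is multiplicative and defines an action -/

section TensorMultiplicative

variable {k : Type v} {Λ : Type u} [CommRing k] [Ring Λ] [Algebra k Λ]

/-- The two recursions coincide term by term, so additivity, multiplicativity and naturality of `η ↦
η ⊗_Λ M` all come from the relative theory. -/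
theorem tensorExt_eq_relExt [Module.Projective k Λ] (M : ModuleCat.{u} Λ) (n : ℕ)
    {B B' : ModuleCat.{u} (Env k Λ)} (hB : Module.Projective Λᵐᵒᵖ (rightMod B)) (η : Ext B B' n) :
    tensorExt M n hB η = relExt (tensorFunctor_relExact M) n hB η := by
  induction n generalizing B with
  | zero => rfl
  | succ n ih =>
    exact congrArg (fun z => (tensorFunctor_shortExact M (syzSeq_shortExact B) hB).extClass.comp z
      (add_comm 1 n)) (ih (syz_rightProjective B hB) _)

theorem rightMul_tw_leftTw_pow (ψ : Λ ≃ₐ[k] Λ) (m : ℕ) (B : ModuleCat.{u} (Env k Λ))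
    (b : leftMod B) (l : Λ) :
    rightMul ((tw (leftTw ψ ^ m)).obj B) b l = rightMul B b l := by
  change ((leftTw ψ ^ m) ((1 : Λ) ⊗ₜ[k] MulOpposite.op l) • (show B from b) : B) =
    ((1 : Λ) ⊗ₜ[k] MulOpposite.op l : Env k Λ) • (show B from b)
  rw [leftTw_pow_tmul, map_one]

theorem smul_tw_leftTw_pow (ψ : Λ ≃ₐ[k] Λ) (m : ℕ) (B : ModuleCat.{u} (Env k Λ))
    (a : Λ) (b : leftMod B) :
    (a • (show leftMod ((tw (leftTw ψ ^ m)).obj B) from b) : leftMod ((tw (leftTw ψ ^ m)).obj B)) =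
      (((ψ : Λ →+* Λ) ^ m) a • b : leftMod B) := by
  change ((leftTw ψ ^ m) (a ⊗ₜ[k] (1 : Λᵐᵒᵖ)) • (show B from b) : B) =
    (((ψ : Λ →+* Λ) ^ m) a ⊗ₜ[k] (1 : Λᵐᵒᵖ) : Env k Λ) • (show B from b)
  rw [leftTw_pow_tmul]

theorem tw_leftTw_pow_rightProjective (ψ : Λ ≃ₐ[k] Λ) (m : ℕ) (B : ModuleCat.{u} (Env k Λ))
    (hB : RightProjective B) : RightProjective ((tw (leftTw ψ ^ m)).obj B) := by
  have : Module.Projective Λᵐᵒᵖ (rightMod B) := hB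
  have e : rightMod B ≃ₗ[Λᵐᵒᵖ] rightMod ((tw (leftTw ψ ^ m)).obj B) :=
    { AddEquiv.refl B with
      map_smul' := fun a x => (rightMul_tw_leftTw_pow ψ m B x a.unop).symm }
  exact Module.Projective.of_equiv' e

theorem twTensor_ext {ψ : Λ ≃ₐ[k] Λ} {m : ℕ} {B : ModuleCat.{u} (Env k Λ)} {M Z : ModuleCat.{u} Λ}
    {f g : (tw ((ψ : Λ →+* Λ) ^ m)).obj ((tensorFunctor k M).obj B) ⟶ Z}
    (h : ∀ (b : leftMod B) (x : M), f.hom (balTmul b x) = g.hom (balTmul b x)) : f = g :=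
  ModuleCat.hom_ext (LinearMap.toAddMonoidHom_injective
    (balTensor_ext (F := (f.hom.toAddMonoidHom : BalTensor B M →+ Z))
      (G := (g.hom.toAddMonoidHom : BalTensor B M →+ Z)) h))

theorem toTensor_apply (ψ : Λ ≃ₐ[k] Λ) (n : ℕ) (M : ModuleCat.{u} Λ) (x : M) :
    (toTensor ψ n M).hom x = balTmul (B := twReg ψ n) (toReg k Λ 1) x := rfl

theorem ofTensor_balTmul (M : ModuleCat.{u} Λ) (b : leftMod (regBimod k Λ)) (x : M) :
    (ofTensor k M).hom (balTmul b x) = (toReg k Λ).symm b • x := rfl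

theorem tensorFunctor_map_balTmul {B B' : ModuleCat.{u} (Env k Λ)} (f : B ⟶ B')
    (M : ModuleCat.{u} Λ) (b : leftMod B) (x : M) :
    ((tensorFunctor k M).map f).hom (balTmul b x) = balTmul (B := B') (f.hom b) x := rfl

theorem balTmul_tw_smul (ψ : Λ ≃ₐ[k] Λ) (m : ℕ) (B : ModuleCat.{u} (Env k Λ))
    (M : ModuleCat.{u} Λ) (a : Λ) (b : leftMod B) (x : M) :
    balTmul (B := (tw (leftTw ψ ^ m)).obj B) (((ψ : Λ →+* Λ) ^ m) a • b : leftMod B) x =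
      a • balTmul (B := (tw (leftTw ψ ^ m)).obj B) (show B from b) x :=
  (congrArg (fun z => balTmul (B := (tw (leftTw ψ ^ m)).obj B) z x)
    (smul_tw_leftTw_pow ψ m B a b)).symm

/-- The additive map underlying the identification of `_{ψᵐ}(B ⊗_Λ M)` with `_{ψᵐ}B ⊗_Λ M`. -/
noncomputable def twTensorAdd (ψ : Λ ≃ₐ[k] Λ) (m : ℕ) (M : ModuleCat.{u} Λ)
    (B : ModuleCat.{u} (Env k Λ)) :
    BalTensor B M →+ BalTensor ((tw (leftTw ψ ^ m)).obj B) M :=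
  balLift (AddMonoidHom.mk' (fun b => AddMonoidHom.mk'
    (fun x => balTmul (B := (tw (leftTw ψ ^ m)).obj B) (show B from b) x)
    fun x x' => balTmul_add_right (B := (tw (leftTw ψ ^ m)).obj B) _ x x')
    fun b b' => AddMonoidHom.ext fun x =>
      balTmul_add_left (B := (tw (leftTw ψ ^ m)).obj B) (show B from b) (show B from b') x)
  fun b l x => (congrArg (fun z => balTmul (B := (tw (leftTw ψ ^ m)).obj B) z x)
      (rightMul_tw_leftTw_pow ψ m B b l).symm).trans
      (balTmul_rightMul (B := (tw (leftTw ψ ^ m)).obj B) (show B from b) l x)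

theorem twTensorAdd_balTmul (ψ : Λ ≃ₐ[k] Λ) (m : ℕ) (M : ModuleCat.{u} Λ)
    (B : ModuleCat.{u} (Env k Λ)) (b : leftMod B) (x : M) :
    twTensorAdd ψ m M B (balTmul b x) =
      balTmul (B := (tw (leftTw ψ ^ m)).obj B) (show B from b) x := rfl

theorem twTensorAdd_smul (ψ : Λ ≃ₐ[k] Λ) (m : ℕ) (M : ModuleCat.{u} Λ)
    (B : ModuleCat.{u} (Env k Λ)) (a : Λ) (x : BalTensor B M) :
    twTensorAdd ψ m M B (((ψ : Λ →+* Λ) ^ m) a • x) = a • twTensorAdd ψ m M B x := by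
  induction x using balTensor_induction with
  | zero => rw [smul_zero, map_zero, smul_zero]
  | tmul b x => exact balTmul_tw_smul ψ m B M a b x
  | add x y hx hy => rw [smul_add, map_add, hx, hy, map_add, smul_add]

theorem twTensorAdd_tw_smul (ψ : Λ ≃ₐ[k] Λ) (m : ℕ) (M : ModuleCat.{u} Λ)
    (B : ModuleCat.{u} (Env k Λ)) (a : Λ)
    (x : (tw ((ψ : Λ →+* Λ) ^ m)).obj ((tensorFunctor k M).obj B)) :
    twTensorAdd ψ m M B
      (a • x : (tw ((ψ : Λ →+* Λ) ^ m)).obj ((tensorFunctor k M).obj B)) =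
      a • twTensorAdd ψ m M B x :=
  (congrArg (fun z : BalTensor B M => twTensorAdd ψ m M B z)
    (ModuleCat.restrictScalars.smul_def ((ψ : Λ →+* Λ) ^ m) a x)).trans
    (twTensorAdd_smul ψ m M B a x)

theorem twTensorAdd_tw_add (ψ : Λ ≃ₐ[k] Λ) (m : ℕ) (M : ModuleCat.{u} Λ)
    (B : ModuleCat.{u} (Env k Λ))
    (x y : (tw ((ψ : Λ →+* Λ) ^ m)).obj ((tensorFunctor k M).obj B)) :
    twTensorAdd ψ m M B
      (x + y : (tw ((ψ : Λ →+* Λ) ^ m)).obj ((tensorFunctor k M).obj B)) =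
      twTensorAdd ψ m M B x + twTensorAdd ψ m M B y :=
  (twTensorAdd ψ m M B).map_add x y

/-- The map underlying the identification of `_{ψᵐ}(B ⊗_Λ M)` with `_{ψᵐ}B ⊗_Λ M`. -/
noncomputable def twTensorFun (ψ : Λ ≃ₐ[k] Λ) (m : ℕ) (M : ModuleCat.{u} Λ)
    (B : ModuleCat.{u} (Env k Λ)) :
    (tw ((ψ : Λ →+* Λ) ^ m)).obj ((tensorFunctor k M).obj B) →
      (tensorFunctor k M).obj ((tw (leftTw ψ ^ m)).obj B) :=
  twTensorAdd ψ m M B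

theorem twTensorFun_add (ψ : Λ ≃ₐ[k] Λ) (m : ℕ) (M : ModuleCat.{u} Λ)
    (B : ModuleCat.{u} (Env k Λ))
    (x y : (tw ((ψ : Λ →+* Λ) ^ m)).obj ((tensorFunctor k M).obj B)) :
    twTensorFun ψ m M B
      (x + y : (tw ((ψ : Λ →+* Λ) ^ m)).obj ((tensorFunctor k M).obj B)) =
      twTensorFun ψ m M B x + twTensorFun ψ m M B y :=
  twTensorAdd_tw_add ψ m M B x y

theorem twTensorFun_smul (ψ : Λ ≃ₐ[k] Λ) (m : ℕ) (M : ModuleCat.{u} Λ)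
    (B : ModuleCat.{u} (Env k Λ)) (a : Λ)
    (x : (tw ((ψ : Λ →+* Λ) ^ m)).obj ((tensorFunctor k M).obj B)) :
    twTensorFun ψ m M B
      (a • x : (tw ((ψ : Λ →+* Λ) ^ m)).obj ((tensorFunctor k M).obj B)) =
      a • twTensorFun ψ m M B x :=
  twTensorAdd_tw_smul ψ m M B a x

/-- The linear map underlying the identification of `_{ψᵐ}(B ⊗_Λ M)` with `_{ψᵐ}B ⊗_Λ M`. -/
noncomputable def twTensorLin (ψ : Λ ≃ₐ[k] Λ) (m : ℕ) (M : ModuleCat.{u} Λ)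
    (B : ModuleCat.{u} (Env k Λ)) :
    (tw ((ψ : Λ →+* Λ) ^ m)).obj ((tensorFunctor k M).obj B) →ₗ[Λ]
      (tensorFunctor k M).obj ((tw (leftTw ψ ^ m)).obj B) where
  toFun := twTensorFun ψ m M B
  map_add' := twTensorFun_add ψ m M B
  map_smul' := twTensorFun_smul ψ m M B

/-- The identification of `_{ψᵐ}(B ⊗_Λ M)` with `_{ψᵐ}B ⊗_Λ M`. -/
noncomputable def twTensorApp (ψ : Λ ≃ₐ[k] Λ) (m : ℕ) (M : ModuleCat.{u} Λ)
    (B : ModuleCat.{u} (Env k Λ)) :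
    (tw ((ψ : Λ →+* Λ) ^ m)).obj ((tensorFunctor k M).obj B) ⟶
      (tensorFunctor k M).obj ((tw (leftTw ψ ^ m)).obj B) :=
  ConcreteCategory.ofHom (C := ModuleCat Λ) (twTensorLin ψ m M B)

theorem twTensor_balTmul (ψ : Λ ≃ₐ[k] Λ) (m : ℕ) (M : ModuleCat.{u} Λ)
    (B : ModuleCat.{u} (Env k Λ)) (b : leftMod B) (x : M) :
    (twTensorApp ψ m M B).hom (balTmul b x) =
      balTmul (B := (tw (leftTw ψ ^ m)).obj B) (show B from b) x :=
  twTensorAdd_balTmul ψ m M B b x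
theorem twTensorApp_map_balTmul (ψ : Λ ≃ₐ[k] Λ) (m : ℕ) (M : ModuleCat.{u} Λ)
    {B B' : ModuleCat.{u} (Env k Λ)} (f : B ⟶ B') (b : leftMod B) (x : M) :
    (twTensorApp ψ m M B ≫ (tensorFunctor k M).map ((tw (leftTw ψ ^ m)).map f)).hom
      (balTmul b x) = balTmul (B := (tw (leftTw ψ ^ m)).obj B') (show B' from f.hom b) x :=
  (congrArg (fun z => ((tensorFunctor k M).map ((tw (leftTw ψ ^ m)).map f)).hom z)
    (twTensor_balTmul ψ m M B b x)).trans (tensorFunctor_map_balTmul _ M _ x)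

theorem map_twTensorApp_balTmul (ψ : Λ ≃ₐ[k] Λ) (m : ℕ) (M : ModuleCat.{u} Λ)
    {B B' : ModuleCat.{u} (Env k Λ)} (f : B ⟶ B') (b : leftMod B) (x : M) :
    ((tw ((ψ : Λ →+* Λ) ^ m)).map ((tensorFunctor k M).map f) ≫ twTensorApp ψ m M B').hom
      (balTmul b x) = balTmul (B := (tw (leftTw ψ ^ m)).obj B') (show B' from f.hom b) x :=
  (congrArg (fun z => (twTensorApp ψ m M B').hom z)
    ((tw_map_apply (f := (ψ : Λ →+* Λ) ^ m) ((tensorFunctor k M).map f) (balTmul b x)).trans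
      (tensorFunctor_map_balTmul f M b x))).trans (twTensor_balTmul ψ m M B' (f.hom b) x)

theorem twTensorApp_naturality (ψ : Λ ≃ₐ[k] Λ) (m : ℕ) (M : ModuleCat.{u} Λ)
    {B B' : ModuleCat.{u} (Env k Λ)} (f : B ⟶ B') :
    (tw ((ψ : Λ →+* Λ) ^ m)).map ((tensorFunctor k M).map f) ≫ twTensorApp ψ m M B' =
      twTensorApp ψ m M B ≫ (tensorFunctor k M).map ((tw (leftTw ψ ^ m)).map f) :=
  twTensor_ext fun b x => (map_twTensorApp_balTmul ψ m M f b x).trans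
    (twTensorApp_map_balTmul ψ m M f b x).symm

/-- The identification of `_{ψᵐ}(B ⊗_Λ M)` with `_{ψᵐ}B ⊗_Λ M`, as a natural transformation. -/
noncomputable def twTensor (ψ : Λ ≃ₐ[k] Λ) (m : ℕ) (M : ModuleCat.{u} Λ) :
    tensorFunctor k M ⋙ tw ((ψ : Λ →+* Λ) ^ m) ⟶ tw (leftTw ψ ^ m) ⋙ tensorFunctor k M where
  app B := twTensorApp ψ m M B
  naturality _ _ f := twTensorApp_naturality ψ m M f

/-- Formal part of `tens_mul`: `r` is the tensored twist and `r'` the twisted tensor of the same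
class, related by `τ₂` and `τ₃`; the other two hypotheses absorb these comparison maps into the
identifications of `Λ ⊗_Λ M` with `M`. -/
theorem ext_tensor_mul_aux {D : Type v} [Category.{u} D] [Abelian D] [HasExt.{u} D]
    {X₀ X₁ X₂ X₃ X₄ X W V V' U : D} {a b c : ℕ} (h : a + b = c) (i : X₀ ⟶ X₁) (j : X₁ ⟶ X₂)
    (r : Ext X₂ X₃ a) (e : Ext X₃ X₄ b) (o : X₄ ⟶ X) (w : X₀ ⟶ W) (v : W ⟶ V) (r' : Ext V V' a)
    (o' : V' ⟶ U) (t : U ⟶ X₃) (τ₂ : V ⟶ X₂) (τ₃ : V' ⟶ X₃)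
    (hτ : r'.comp (Ext.mk₀ τ₃) (add_zero a) = (Ext.mk₀ τ₂).comp r (zero_add a))
    (h₁ : o' ≫ t = τ₃) (h₂ : (w ≫ v) ≫ τ₂ = i ≫ j) :
    (Ext.mk₀ i).comp (((Ext.mk₀ j).comp (r.comp e h) (zero_add c)).comp (Ext.mk₀ o)
      (add_zero c)) (zero_add c) =
    (Ext.mk₀ w).comp (((Ext.mk₀ v).comp (r'.comp (Ext.mk₀ o') (add_zero a)) (zero_add a)).comp
      ((Ext.mk₀ t).comp (e.comp (Ext.mk₀ o) (add_zero b)) (zero_add b)) h) (zero_add c) := by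
  rw [Ext.comp_assoc (a₁₂ := a) (a₂₃ := c) (Ext.mk₀ v) _ _ (by omega) (by omega) (by omega),
    ← Ext.comp_assoc (a₁₂ := 0) (Ext.mk₀ w) (Ext.mk₀ v) _ (by omega) (by omega) (by omega),
    Ext.mk₀_comp_mk₀,
    ← Ext.comp_assoc (a₁₂ := a) (a₂₃ := b) _ (Ext.mk₀ t) _ (by omega) (by omega) (by omega),
    Ext.comp_assoc (a₂₃ := 0) r' (Ext.mk₀ o') _ (by omega) (by omega) (by omega),
    Ext.mk₀_comp_mk₀, h₁, hτ,
    Ext.comp_assoc (a₂₃ := c) (Ext.mk₀ τ₂) r _ (by omega) (by omega) (by omega),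
    ← Ext.comp_assoc (a₁₂ := 0) (Ext.mk₀ _) (Ext.mk₀ τ₂) _ (by omega) (by omega) (by omega),
    Ext.mk₀_comp_mk₀, h₂,
    Ext.comp_assoc (a₂₃ := c) (Ext.mk₀ j) _ _ (by omega) (by omega) (by omega),
    ← Ext.comp_assoc (a₁₂ := 0) (Ext.mk₀ i) (Ext.mk₀ j) _ (by omega) (by omega) (by omega),
    Ext.mk₀_comp_mk₀,
    Ext.comp_assoc (a₂₃ := b) r e _ (by omega) (by omega) (by omega)]

theorem twMap_ofTensor_balTmul (ψ : Λ ≃ₐ[k] Λ) (m : ℕ) (M : ModuleCat.{u} Λ)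
    (b : leftMod (regBimod k Λ)) (x : M) :
    ((tw ((ψ : Λ →+* Λ) ^ m)).map (ofTensor k M) ≫ toTensor ψ m M).hom (balTmul b x) =
      (toTensor ψ m M).hom ((toReg k Λ).symm b • x : M) :=
  (hom_comp_apply ((tw ((ψ : Λ →+* Λ) ^ m)).map (ofTensor k M)) (toTensor ψ m M)
    (balTmul b x)).trans (congrArg (toTensor ψ m M).hom
      ((tw_map_apply (ofTensor k M) (balTmul b x)).trans (ofTensor_balTmul M b x)))

theorem toTensor_smul (ψ : Λ ≃ₐ[k] Λ) (m : ℕ) (M : ModuleCat.{u} Λ)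
    (b : leftMod (regBimod k Λ)) (x : M) :
    (toTensor ψ m M).hom ((toReg k Λ).symm b • x : M) = balTmul (B := twReg ψ m)
      (rightMul (twReg ψ m) (toReg k Λ 1) ((toReg k Λ).symm b)) x :=
  (toTensor_apply ψ m M ((toReg k Λ).symm b • x)).trans
    (balTmul_rightMul (B := twReg ψ m) (toReg k Λ 1) ((toReg k Λ).symm b) x).symm

theorem rightMul_twReg_toReg_one (ψ : Λ ≃ₐ[k] Λ) (m : ℕ) (b : leftMod (regBimod k Λ)) :
    rightMul (twReg ψ m) (toReg k Λ 1) ((toReg k Λ).symm b) = toReg k Λ ((toReg k Λ).symm b) :=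
  (rightMul_twReg ψ m 1 _).trans (congrArg (toReg k Λ) (one_mul _))

theorem balTmul_rightMul_toReg_one (ψ : Λ ≃ₐ[k] Λ) (m : ℕ) (M : ModuleCat.{u} Λ)
    (b : leftMod (regBimod k Λ)) (x : M) :
    balTmul (B := twReg ψ m) (rightMul (twReg ψ m) (toReg k Λ 1) ((toReg k Λ).symm b)) x =
      balTmul (B := twReg ψ m) b x :=
  congrArg (fun z => balTmul (B := twReg ψ m) z x) (rightMul_twReg_toReg_one ψ m b)

theorem twMap_ofTensor_toTensor_balTmul (ψ : Λ ≃ₐ[k] Λ) (m : ℕ) (M : ModuleCat.{u} Λ)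
    (b : leftMod (regBimod k Λ)) (x : M) :
    ((tw ((ψ : Λ →+* Λ) ^ m)).map (ofTensor k M) ≫ toTensor ψ m M).hom (balTmul b x) =
      (twTensorApp ψ m M (regBimod k Λ)).hom (balTmul b x) :=
  (((twMap_ofTensor_balTmul ψ m M b x).trans (toTensor_smul ψ m M b x)).trans
    (balTmul_rightMul_toReg_one ψ m M b x)).trans (twTensor_balTmul ψ m M (regBimod k Λ) b x).symm

theorem twMap_ofTensor_toTensor (ψ : Λ ≃ₐ[k] Λ) (m : ℕ) (M : ModuleCat.{u} Λ) :
    (tw ((ψ : Λ →+* Λ) ^ m)).map (ofTensor k M) ≫ toTensor ψ m M =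
      twTensorApp ψ m M (regBimod k Λ) :=
  twTensor_ext (twMap_ofTensor_toTensor_balTmul ψ m M)

theorem twMap_toTensor_twTensor_apply (ψ : Λ ≃ₐ[k] Λ) (m n : ℕ) (M : ModuleCat.{u} Λ) (x : M) :
    ((tw ((ψ : Λ →+* Λ) ^ m)).map (toTensor ψ n M) ≫ twTensorApp ψ m M (twReg ψ n)).hom x =
      balTmul (B := (tw (leftTw ψ ^ m)).obj (twReg ψ n)) (toReg k Λ 1) x :=
  (congrArg (fun z => (twTensorApp ψ m M (twReg ψ n)).hom z)
      ((tw_map_apply (f := (ψ : Λ →+* Λ) ^ m) (toTensor ψ n M) x).trans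
        (toTensor_apply ψ n M x))).trans (twTensor_balTmul ψ m M (twReg ψ n) (toReg k Λ 1) x)

theorem toTensor_tensorFunctor_map_apply (ψ : Λ ≃ₐ[k] Λ) (n : ℕ) (M : ModuleCat.{u} Λ)
    {B : ModuleCat.{u} (Env k Λ)} (f : twReg ψ n ⟶ B) (x : M) :
    (toTensor ψ n M ≫ (tensorFunctor k M).map f).hom x = balTmul (B := B)
      (f.hom (toReg k Λ 1)) x :=
  (congrArg (fun z => ((tensorFunctor k M).map f).hom z) (toTensor_apply ψ n M x)).trans
    (tensorFunctor_map_balTmul f M (toReg k Λ 1) x)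

theorem twComp_toReg (ψ : Λ ≃ₐ[k] Λ) (m n : ℕ) (x : Λ) :
    (twComp (pow_add_eq_comp (leftTw ψ) m n) (regBimod k Λ)).hom (toReg k Λ x) = toReg k Λ x :=
  twComp_apply _ _ _

theorem twComp_toTensor_twTensor_apply (ψ : Λ ≃ₐ[k] Λ) (m n : ℕ) (M : ModuleCat.{u} Λ) (x : M) :
    (toTensor ψ (m + n) M ≫ (tensorFunctor k M).map
        (twComp (pow_add_eq_comp (leftTw ψ) m n) (regBimod k Λ))).hom x =
    ((tw ((ψ : Λ →+* Λ) ^ m)).map (toTensor ψ n M) ≫ twTensorApp ψ m M (twReg ψ n)).hom x :=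
  (toTensor_tensorFunctor_map_apply ψ (m + n) M _ x).trans
    ((congrArg (fun z => balTmul (B := (tw (leftTw ψ ^ m)).obj (twReg ψ n)) z x)
      (twComp_toReg ψ m n 1)).trans (twMap_toTensor_twTensor_apply ψ m n M x).symm)

theorem twComp_comp_apply {R : Type u} [Ring R] {f g gf : R →+* R} (h : gf = g.comp f)
    (X : ModuleCat.{u} R) {Z : ModuleCat.{u} R} (i : (tw f).obj ((tw g).obj X) ⟶ Z) (x : X) :
    (twComp h X ≫ i).hom x = i.hom x := rfl

theorem twComp_toTensor_twTensor (ψ : Λ ≃ₐ[k] Λ) (m n : ℕ) (M : ModuleCat.{u} Λ) :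
    (twComp (pow_add_eq_comp (ψ : Λ →+* Λ) m n) M ≫
      (tw ((ψ : Λ →+* Λ) ^ m)).map (toTensor ψ n M)) ≫ twTensorApp ψ m M (twReg ψ n) =
      toTensor ψ (m + n) M ≫ (tensorFunctor k M).map
        (twComp (pow_add_eq_comp (leftTw ψ) m n) (regBimod k Λ)) := by
  rw [Category.assoc]
  exact ModuleCat.hom_ext (LinearMap.ext fun x => (twComp_comp_apply _ M _ x).trans
    (twComp_toTensor_twTensor_apply ψ m n M x).symm)

variable [Module.Projective k Λ] {ψ : Λ ≃ₐ[k] Λ} {t : ℕ} (M : ModuleCat.{u} Λ)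

theorem tens_eq {n : ℕ} (η : HHdeg ψ t n) :
    tens M η = (Ext.mk₀ (toTensor ψ n M)).comp
      ((relExt (tensorFunctor_relExact M) (t * n) (twReg_hasRightProjective ψ n) η).comp
        (Ext.mk₀ (ofTensor k M)) (add_zero _)) (zero_add _) :=
  congrArg (fun z => (Ext.mk₀ (toTensor ψ n M)).comp (Ext.comp z (Ext.mk₀ (ofTensor k M))
    (add_zero _)) (zero_add _)) (tensorExt_eq_relExt M (t * n) (twReg_rightProjective ψ n) η)

theorem tens_add {n : ℕ} (η θ : HHdeg ψ t n) : tens M (η + θ) = tens M η + tens M θ := by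
  rw [tens_eq, tens_eq, tens_eq, relExt_add, Ext.add_comp,
    Ext.comp_add]

theorem toTensor_twOne_apply (x : M) :
    (toTensor ψ 0 M ≫ (tensorFunctor k M).map (twOne (pow_zero (leftTw ψ)) (regBimod k Λ))).hom x =
      balTmul (B := regBimod k Λ) (toReg k Λ 1) x :=
  toTensor_tensorFunctor_map_apply ψ 0 M _ x

theorem ofTensor_toReg_one (x : M) :
    (ofTensor k M).hom (balTmul (B := regBimod k Λ) (toReg k Λ 1) x) = x :=
  (ofTensor_balTmul M (toReg k Λ 1) x).trans
    ((congrArg (· • x) ((toReg k Λ).symm_apply_apply 1)).trans (one_smul Λ x))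

theorem toTensor_twOne_ofTensor :
    toTensor ψ 0 M ≫ (tensorFunctor k M).map (twOne (pow_zero (leftTw ψ)) (regBimod k Λ)) ≫
      ofTensor k M = twOne (pow_zero (ψ : Λ →+* Λ)) M := by
  rw [← Category.assoc]
  exact ModuleCat.hom_ext (LinearMap.ext fun x =>
    (congrArg (ofTensor k M).hom (toTensor_twOne_apply M x)).trans (ofTensor_toReg_one M x))

theorem tens_one : tens M (TwExt.one (leftTw ψ) t (regBimod k Λ)) =
    TwExt.one (ψ : Λ →+* Λ) t M := by
  have h := relExt_mk₀ (tensorFunctor_relExact M) (twReg_hasRightProjective ψ 0)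
    (twOne (pow_zero (leftTw ψ)) (regBimod k Λ))
  rw [tens_eq]
  refine (congrArg (fun z => (Ext.mk₀ (toTensor ψ 0 M)).comp (Ext.comp z
    (Ext.mk₀ (ofTensor k M)) (add_zero 0)) (zero_add 0)) h).trans ?_
  rw [Ext.mk₀_comp_mk₀, Ext.mk₀_comp_mk₀]
  exact congrArg Ext.mk₀ (toTensor_twOne_ofTensor M)

theorem relExt_mul {m n : ℕ} (η : HHdeg ψ t m) (θ : HHdeg ψ t n)
    (h : t * n + t * m = t * (m + n)) :
    relExt (tensorFunctor_relExact M) (t * (m + n)) (twReg_hasRightProjective ψ (m + n))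
      (TwExt.mul η θ) = (Ext.mk₀ ((tensorFunctor k M).map
        (twComp (pow_add_eq_comp (leftTw ψ) m n) (regBimod k Λ)))).comp
        ((relExt (tensorFunctor_relExact M) (t * n) (tw_leftTw_pow_rightProjective ψ m _
          (twReg_hasRightProjective ψ n)) (twExt (leftTw ψ ^ m) θ)).comp
        (relExt (tensorFunctor_relExact M) (t * m) (twReg_hasRightProjective ψ m) η) h)
        (zero_add _) := by
  have e₁ : TwExt.mul η θ = (Ext.mk₀ (twComp (pow_add_eq_comp (leftTw ψ) m n)
      (regBimod k Λ))).comp ((twExt (leftTw ψ ^ m) θ).comp η h) (zero_add _) :=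
    ext_comp_comp_congr _ _ _ _ _ _ _
  rw [e₁]
  refine (relExt_mk₀_comp _ _ (tw_leftTw_pow_rightProjective ψ m _
    (twReg_hasRightProjective ψ n)) _ _).trans ?_
  exact congrArg (fun z => Ext.comp _ z _) (relExt_comp _ _ (twReg_hasRightProjective ψ m) _ _ _)

/-- Twisting on the left commutes with tensoring by `M` on the right. On Ext this is naturality of
`twTensor` between two composite functors, each relatively exact with respect to right projective
bimodules. -/
theorem relExt_twTensor {m n : ℕ} (θ : HHdeg ψ t n) :
    ((relExt (tensorFunctor_relExact M) (t * n) (twReg_hasRightProjective ψ n) θ).mapExactFunctor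
      (tw ((ψ : Λ →+* Λ) ^ m))).comp (Ext.mk₀ (twTensorApp ψ m M (regBimod k Λ)))
        (add_zero _) =
    (Ext.mk₀ (twTensorApp ψ m M (twReg ψ n))).comp
      (relExt (tensorFunctor_relExact M) (t * n) (tw_leftTw_pow_rightProjective ψ m _
          (twReg_hasRightProjective ψ n)) (θ.mapExactFunctor (tw (leftTw ψ ^ m)))) (zero_add _) := by
  have hsyz := (tensorFunctor_relExact (k := k) M).syz
  have hK := tw_leftTw_pow_rightProjective ψ m
  have hKT := (tensorFunctor_relExact (k := k) M).exact_comp (tw (leftTw ψ ^ m)) hK hsyz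
  have hTt := (tensorFunctor_relExact (k := k) M).comp_exact (tw ((ψ : Λ →+* Λ) ^ m))
  have hτ := relExt_naturality hTt hKT (twTensor ψ m M) (twReg_hasRightProjective ψ n) θ
  rw [relExt_comp_exact (tensorFunctor_relExact M), relExt_exact_comp
    (tensorFunctor_relExact M) (tw (leftTw ψ ^ m)) hK] at hτ
  exact hτ

/-- The functor `- ⊗_Λ M` respects Yoneda products of classes with right projective sources, and it
respects the twist occurring in the product by `relExt_twTensor`. -/
theorem tens_mul {m n : ℕ} (η : HHdeg ψ t m) (θ : HHdeg ψ t n) :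
    tens M (TwExt.mul η θ) = TwExt.mul (tens M η) (tens M θ) := by
  have h : t * n + t * m = t * (m + n) := by ring
  rw [tens_eq, tens_eq, tens_eq, relExt_mul M η θ h]
  have key := ext_tensor_mul_aux h (toTensor ψ (m + n) M) _
    (relExt (tensorFunctor_relExact M) (t * n) (tw_leftTw_pow_rightProjective ψ m _
      (twReg_hasRightProjective ψ n)) (θ.mapExactFunctor (tw (leftTw ψ ^ m))))
    (relExt (tensorFunctor_relExact M) (t * m) (twReg_hasRightProjective ψ m) η)
    (ofTensor k M) _ _ _ _ _ _ _ (relExt_twTensor M θ)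
    (twMap_ofTensor_toTensor ψ m M) (twComp_toTensor_twTensor ψ m n M)
  refine key.trans ?_
  unfold TwExt.mul
  rw [twExt_comp, twExt_comp, twExt_mk₀, twExt_mk₀]
  exact ext_comp_comp_congr _ _ _ _ _ _ _

variable (N : ModuleCat.{u} Λ)

theorem actRight_of {m n : ℕ} (η : HHdeg ψ t n) (ζ : TwExt (ψ : Λ →+* Λ) t M N m) :
    actRight M N η (DirectSum.of (TwExt (ψ : Λ →+* Λ) t M N) m ζ) =
      DirectSum.of (TwExt (ψ : Λ →+* Λ) t M N) (m + n) (TwExt.mul ζ (tens M η)) :=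
  DirectSum.toAddMonoid_of _ _ _

/-- The right action of the twisted Hochschild cohomology ring on `Ext_Λ^{t*}(_{ψ^*}M, N)`. -/
noncomputable def actHom : HHtw ψ t →+
    (⨁ m, TwExt (ψ : Λ →+* Λ) t M N m) →+ ⨁ m, TwExt (ψ : Λ →+* Λ) t M N m :=
  DirectSum.toAddMonoid fun _ => AddMonoidHom.mk' (fun η => actRight M N η) fun η θ => by
    refine DirectSum.addHom_ext fun m ζ => ?_
    rw [AddMonoidHom.add_apply, actRight_of, actRight_of, actRight_of, tens_add, TwExt.mul_add',
      map_add]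

theorem actHom_of {n : ℕ} (η : HHdeg ψ t n) :
    actHom M N (DirectSum.of (HHdeg ψ t) n η) = actRight M N η :=
  DirectSum.toAddMonoid_of _ _ _

theorem actHom_one : actHom M N (1 : HHtw ψ t) = AddMonoidHom.id _ := by
  refine (actHom_of M N (TwExt.one (leftTw ψ) t (regBimod k Λ))).trans ?_
  refine DirectSum.addHom_ext fun m ζ => ?_
  rw [actRight_of, tens_one]
  exact DirectSum.of_eq_of_gradedMonoid_eq (TwExt.mul_one' ζ)

/-- The action is on the right, hence the reversed order: `x` acts first. On homogeneous elements
this is associativity of the twisted product together with `tens_mul`. -/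
theorem actHom_mul (x y : HHtw ψ t) : actHom M N (x * y) = (actHom M N y).comp (actHom M N x) := by
  induction x using DirectSum.induction_on with
  | zero => rw [zero_mul, map_zero, AddMonoidHom.comp_zero]
  | add x x' hx hx' => rw [add_mul, map_add, map_add, hx, hx', AddMonoidHom.comp_add]
  | of m η =>
    induction y using DirectSum.induction_on with
    | zero => rw [mul_zero, map_zero, AddMonoidHom.zero_comp]
    | add y y' hy hy' => rw [mul_add, map_add, map_add, hy, hy', AddMonoidHom.add_comp]
    | of n θ =>
      rw [DirectSum.of_mul_of]
      refine (actHom_of M N (TwExt.mul η θ)).trans ?_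
      rw [actHom_of, actHom_of]
      refine DirectSum.addHom_ext fun l ζ => ?_
      rw [AddMonoidHom.comp_apply, actRight_of, actRight_of, actRight_of, tens_mul]
      exact DirectSum.of_eq_of_gradedMonoid_eq (TwExt.mul_assoc' ζ (tens M η) (tens M θ)).symm

end TensorMultiplicative

/-! ### Restriction to degrees divisible by ts -/

section Veronese

theorem ext_incl_mul_aux {D : Type v} [Category.{u} D] [Abelian D] [HasExt.{u} D]
    {X₀ X₁ X₂ X₃ X₄ Y₁ Y₂ Y₃ Y₄ : D} {a a' b b' c c' d : ℕ} (i : X₀ ⟶ X₁) (p : X₁ ⟶ X₂)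
    (θ : Ext X₂ X₃ a) (η : Ext X₃ X₄ b) (j : X₀ ⟶ Y₁) (q : Y₁ ⟶ Y₂) (w : Y₂ ⟶ Y₃)
    (θ' : Ext Y₃ Y₄ a) (x : Y₄ ⟶ X₃) (y : Y₃ ⟶ X₂)
    (h : θ'.comp (Ext.mk₀ x) (add_zero a) = (Ext.mk₀ y).comp θ (zero_add a))
    (h' : i ≫ p = j ≫ q ≫ w ≫ y)
    (e₁ : a + b = c) (e₂ : 0 + c = c') (e₃ : 0 + c' = d) (e₄ : 0 + a = a') (e₅ : 0 + b = b')
    (e₆ : a' + b' = c) (e₇ : 0 + c = c') (e₈ : 0 + c' = d) :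
    (Ext.mk₀ i).comp ((Ext.mk₀ p).comp (θ.comp η e₁) e₂) e₃ =
      (Ext.mk₀ j).comp ((Ext.mk₀ q).comp (((Ext.mk₀ w).comp θ' e₄).comp
        ((Ext.mk₀ x).comp η e₅) e₆) e₇) e₈ := by
  obtain rfl : c' = c := by omega
  obtain rfl : d = c' := by omega
  obtain rfl : a' = a := by omega
  obtain rfl : b' = b := by omega
  rw [← Ext.comp_assoc (a₁₂ := 0) _ _ _ (by omega) (by omega) (by omega), Ext.mk₀_comp_mk₀, h',
    Ext.comp_assoc (a₂₃ := d) (Ext.mk₀ w) _ _ (by omega) (by omega) (by omega),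
    ← Ext.comp_assoc (a₁₂ := a') θ' _ _ (by omega) (by omega) (by omega), h,
    Ext.comp_assoc (a₂₃ := d) (Ext.mk₀ y) _ _ (by omega) (by omega) (by omega),
    ← Ext.comp_assoc (a₁₂ := 0) (Ext.mk₀ w) _ _ (by omega) (by omega) (by omega),
    Ext.mk₀_comp_mk₀,
    ← Ext.comp_assoc (a₁₂ := 0) (Ext.mk₀ q) _ _ (by omega) (by omega) (by omega),
    Ext.mk₀_comp_mk₀,
    ← Ext.comp_assoc (a₁₂ := 0) (Ext.mk₀ j) _ _ (by omega) (by omega) (by omega),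
    Ext.mk₀_comp_mk₀]

theorem ext_comp_comp_comp_congr {D : Type v} [Category.{u} D] [Abelian D] [HasExt.{u} D]
    {V X Y Z W : D} {n a b c c' d d' l m : ℕ} (g : Ext V X m) (f : Ext X Y n) (α : Ext Y Z a)
    (β : Ext Z W b) (h : a + b = c) (h' : a + b = c') (e : n + c = d) (e' : n + c' = d')
    (i : m + d = l) (i' : m + d' = l) :
    g.comp (f.comp (α.comp β h) e) i = g.comp (f.comp (α.comp β h') e') i' := by
  subst h
  subst h'
  subst e
  subst e'
  rfl

variable {R : Type u} [Ring R] {f g : R →+* R} {s : ℕ}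

/-- The identification of `Ext^{(ts)n}(_{gⁿ}X, Y)` with `Ext^{t(sn)}(_{f^{sn}}X, Y)` for
`g = fˢ`. -/
noncomputable def TwExt.incl (hg : ∀ n, g ^ n = f ^ (s * n)) (t : ℕ) {X Y : ModuleCat.{u} R}
    (n : ℕ) : TwExt g (t * s) X Y n →+ TwExt f t X Y (s * n) :=
  AddMonoidHom.mk' (fun η => (Ext.mk₀ (twCongr (hg n).symm X)).comp η
    (show 0 + t * s * n = t * (s * n) by ring)) fun _ _ => Ext.comp_add _ _ _ _

theorem TwExt.incl_apply (hg : ∀ n, g ^ n = f ^ (s * n)) {t : ℕ} {X Y : ModuleCat.{u} R}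
    {n : ℕ} (η : TwExt g (t * s) X Y n) :
    TwExt.incl hg t n η = (Ext.mk₀ (twCongr (hg n).symm X)).comp η
      (show 0 + t * s * n = t * (s * n) by ring) := rfl

theorem TwExt.incl_bijective (hg : ∀ n, g ^ n = f ^ (s * n)) (t : ℕ) {X Y : ModuleCat.{u} R}
    (n : ℕ) : Function.Bijective (TwExt.incl hg t (X := X) (Y := Y) n) := by
  have e₁ : twCongr (hg n) X ≫ twCongr (hg n).symm X = 𝟙 _ := rfl
  have e₂ : twCongr (hg n).symm X ≫ twCongr (hg n) X = 𝟙 _ := rfl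
  refine Function.bijective_iff_has_inverse.2 ⟨fun θ => (Ext.mk₀ (twCongr (hg n) X)).comp θ
    (show 0 + t * (s * n) = t * s * n by ring), fun η => ?_, fun θ => ?_⟩
  · have e : 0 + t * s * n = t * (s * n) := by ring
    have e' : 0 + t * (s * n) = t * s * n := by ring
    change (Ext.mk₀ _).comp ((Ext.mk₀ _).comp η e) e' = η
    rw [← Ext.comp_assoc (a₁₂ := 0) _ _ _ (by omega) (by omega) (by omega), Ext.mk₀_comp_mk₀, e₁,
      Ext.mk₀_id_comp]
  · have e : 0 + t * s * n = t * (s * n) := by ring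
    have e' : 0 + t * (s * n) = t * s * n := by ring
    change (Ext.mk₀ _).comp ((Ext.mk₀ _).comp θ e') e = θ
    rw [← Ext.comp_assoc (a₁₂ := 0) _ _ _ (by omega) (by omega) (by omega), Ext.mk₀_comp_mk₀, e₂,
      Ext.mk₀_id_comp]

theorem TwExt.incl_one (hg : ∀ n, g ^ n = f ^ (s * n)) (t : ℕ) (X : ModuleCat.{u} R) :
    GradedMonoid.mk (A := TwExt f t X X) (s * 0) (TwExt.incl hg t 0 (TwExt.one g (t * s) X)) =
      GradedMonoid.mk 0 (TwExt.one f t X) := by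
  apply TwExt.mk_eq (mul_zero s)
  rw [TwExt.incl_apply]
  unfold TwExt.one
  refine (Ext.mk₀_comp_mk₀ _ _).trans ?_
  refine Eq.trans ?_ (Ext.mk₀_comp_mk₀ _ _).symm
  rfl

theorem twCongr_twComp (hg : ∀ n, g ^ n = f ^ (s * n)) (m n : ℕ) (X : ModuleCat.{u} R) :
    twCongr (hg (m + n)).symm X ≫ twComp (pow_add_eq_comp g m n) X =
      twCongr (congrArg (f ^ ·) (mul_add s m n)) X ≫ twComp (pow_add_eq_comp f (s * m) (s * n)) X ≫
        (tw (f ^ (s * m))).map (twCongr (hg n).symm X) ≫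
          twCongr (hg m).symm ((tw (g ^ n)).obj X) := rfl

/-- All comparison maps are identities on elements; the content is that the twist by `gᵐ` equals
that by `f^(sm)`. Equality is stated in the graded monoid because the indices `s * (m + n)` and `s *
m + s * n` agree only propositionally. -/
theorem TwExt.incl_mul (hg : ∀ n, g ^ n = f ^ (s * n)) {t : ℕ} {X Y Z : ModuleCat.{u} R} {m n : ℕ}
    (η : TwExt g (t * s) X Y m) (θ : TwExt g (t * s) Z X n) :
    GradedMonoid.mk (A := TwExt f t Z Y) (s * (m + n)) (TwExt.incl hg t (m + n) (TwExt.mul η θ)) =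
      GradedMonoid.mk (s * m + s * n) (TwExt.mul (TwExt.incl hg t m η) (TwExt.incl hg t n θ)) := by
  apply TwExt.mk_eq (mul_add s m n)
  rw [TwExt.incl_apply, TwExt.incl_apply, TwExt.incl_apply]
  unfold TwExt.mul
  rw [twExt_comp, twExt_mk₀]
  have h : (twExt (f ^ (s * m)) θ).comp (Ext.mk₀ (twCongr (hg m).symm X)) (add_zero _) =
      (Ext.mk₀ (twCongr (hg m).symm ((tw (g ^ n)).obj Z))).comp (twExt (g ^ m) θ) (zero_add _) :=
    mapExactFunctor_naturality _ _ (ModuleCat.restrictScalarsCongr (hg m).symm).hom θ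
  have e₁ : t * s * n + t * s * m = t * s * (m + n) := by ring
  have e₃ : 0 + t * s * (m + n) = t * (s * (m + n)) := by ring
  have e₄ : 0 + t * s * n = t * (s * n) := by ring
  have e₅ : 0 + t * s * m = t * (s * m) := by ring
  have e₆ : t * (s * n) + t * (s * m) = t * s * (m + n) := by ring
  have key := ext_incl_mul_aux (twCongr (hg (m + n)).symm Z) (twComp (pow_add_eq_comp g m n) Z)
    (twExt (g ^ m) θ) η (twCongr (congrArg (f ^ ·) (mul_add s m n)) Z)
    (twComp (pow_add_eq_comp f (s * m) (s * n)) Z)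
    ((tw (f ^ (s * m))).map (twCongr (hg n).symm Z)) (twExt (f ^ (s * m)) θ)
    (twCongr (hg m).symm X) (twCongr (hg m).symm ((tw (g ^ n)).obj Z)) h (twCongr_twComp hg m n Z)
    e₁ (zero_add _) e₃ e₄ e₅ e₆ (zero_add _) e₃
  refine Eq.trans ?_ (key.trans ?_)
  · exact congrArg (fun z => Ext.comp _ z _) (ext_comp_comp_congr _ _ _ _ _ _ _)
  · exact ext_comp_comp_comp_congr _ _ _ _ _ _ _ _ _ _

variable {k : Type v} {Λ : Type u} [CommRing k] [Ring Λ] [Algebra k Λ]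

theorem algEquiv_pow_toRingHom_pow (ψ : Λ ≃ₐ[k] Λ) (s n : ℕ) :
    ((ψ ^ s : Λ ≃ₐ[k] Λ) : Λ →+* Λ) ^ n = (ψ : Λ →+* Λ) ^ (s * n) := by
  have h : ((ψ ^ s : Λ ≃ₐ[k] Λ) : Λ →+* Λ) = (ψ : Λ →+* Λ) ^ s := by
    induction s with
    | zero => rfl
    | succ s ih => rw [pow_succ, pow_succ, ← ih]; rfl
  rw [h, pow_mul]

variable [Module.Projective k Λ] (M N : ModuleCat.{u} Λ)

theorem toTensor_twCongr_apply (ψ : Λ ≃ₐ[k] Λ) (s n : ℕ) (x : M) :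
    (toTensor ψ (s * n) M ≫ (tensorFunctor k M).map
      (twCongr (leftTw_pow ψ s n).symm (regBimod k Λ))).hom x =
      (toTensor (ψ ^ s) n M).hom x :=
  toTensor_tensorFunctor_map_apply ψ (s * n) M _ x

theorem twCongr_comp_apply {f g : R →+* R} (h : f = g) (X : ModuleCat.{u} R)
    {Z : ModuleCat.{u} R} (i : (tw g).obj X ⟶ Z) (x : X) :
    (twCongr h X ≫ i).hom x = i.hom x := rfl

theorem toTensor_twCongr (ψ : Λ ≃ₐ[k] Λ) (s n : ℕ) :
    toTensor ψ (s * n) M ≫ (tensorFunctor k M).map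
      (twCongr (leftTw_pow ψ s n).symm (regBimod k Λ)) =
    twCongr (algEquiv_pow_toRingHom_pow ψ s n).symm M ≫ toTensor (ψ ^ s) n M :=
  ModuleCat.hom_ext (LinearMap.ext fun x => (toTensor_twCongr_apply M ψ s n x).trans
    (twCongr_comp_apply _ M _ x).symm)

/-- The identification of degrees is precomposition with a morphism, which `relExt_mk₀_comp` carries
through the tensor product. Consequently an element of the smaller ring acts in the same way as its
image in the larger one. -/
theorem tens_HHincl (ψ : Λ ≃ₐ[k] Λ) (t s n : ℕ) (η : HHdeg (ψ ^ s) (t * s) n) :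
    tens M (HHincl ψ t s n η) =
      TwExt.incl (algEquiv_pow_toRingHom_pow ψ s) t n (tens M η) := by
  have e : 0 + t * s * n = t * (s * n) := by ring
  have h : ∀ {a : ℕ} (ha : 0 + t * s * n = a),
      relExt (tensorFunctor_relExact M) a (twReg_hasRightProjective ψ (s * n))
        ((Ext.mk₀ (twCongr (leftTw_pow ψ s n).symm (regBimod k Λ))).comp η ha) =
      (Ext.mk₀ ((tensorFunctor k M).map (twCongr (leftTw_pow ψ s n).symm (regBimod k Λ)))).comp
        (relExt (tensorFunctor_relExact M) (t * s * n) (twReg_hasRightProjective (ψ ^ s) n) η)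
          ha := by
    intro a ha
    obtain rfl : t * s * n = a := by omega
    exact relExt_mk₀_comp _ _ (twReg_hasRightProjective (ψ ^ s) n) _ _
  rw [TwExt.incl_apply, tens_eq, tens_eq]
  refine (congrArg (fun z => (Ext.mk₀ _).comp (Ext.comp z (Ext.mk₀ _) _) _) (h e)).trans ?_
  rw [Ext.comp_assoc (a₂₃ := t * s * n) _ _ (Ext.mk₀ (ofTensor k M)) (by omega) (by omega)
      (by omega),
    ← Ext.comp_assoc (a₁₂ := 0) _ _ _ (by omega) (by omega) (by omega), Ext.mk₀_comp_mk₀,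
    toTensor_twCongr, ← Ext.mk₀_comp_mk₀,
    Ext.comp_assoc (a₁₂ := 0) (a₂₃ := t * s * n) _ _ _ (by omega) (by omega) (by omega)]

/-- The inclusion of `HH^{ts*}(_{(ψˢ)^*}Λ_1, Λ)` in `HH^{t*}(_{ψ^*}Λ_1, Λ)`. -/
noncomputable def veronese (ψ : Λ ≃ₐ[k] Λ) (t s : ℕ) : HHtw (ψ ^ s) (t * s) →+* HHtw ψ t :=
  DirectSum.toSemiring (fun n => (DirectSum.of (HHdeg ψ t) (s * n)).comp
    (TwExt.incl (leftTw_pow ψ s) t n))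
    (DirectSum.of_eq_of_gradedMonoid_eq (TwExt.incl_one (leftTw_pow ψ s) t (regBimod k Λ)))
    fun η θ => (DirectSum.of_eq_of_gradedMonoid_eq (TwExt.incl_mul (leftTw_pow ψ s) η θ)).trans
      (DirectSum.of_mul_of _ _).symm

theorem veronese_of (ψ : Λ ≃ₐ[k] Λ) (t s n : ℕ) (η : HHdeg (ψ ^ s) (t * s) n) :
    veronese ψ t s (DirectSum.of _ n η) = DirectSum.of (HHdeg ψ t) (s * n) (HHincl ψ t s n η) :=
  DirectSum.toSemiring_of _ _ _ _ _

/-- Positivity of `s` guarantees that distinct indices `n` go to distinct degrees `s * n`, so no two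
components are added together. -/
theorem veronese_apply (ψ : Λ ≃ₐ[k] Λ) (t : ℕ) {s : ℕ} (hs : 0 < s) (n : ℕ)
    (x : HHtw (ψ ^ s) (t * s)) : veronese ψ t s x (s * n) = HHincl ψ t s n (x n) := by
  induction x using DirectSum.induction_on with
  | zero =>
    rw [map_zero]
    exact (map_zero (TwExt.incl (leftTw_pow ψ s) t n)).symm
  | add x y hx hy =>
    rw [map_add]
    refine (congrArg₂ (· + ·) hx hy).trans ?_
    exact (map_add (TwExt.incl (leftTw_pow ψ s) t n) _ _).symm
  | of m η =>
    rw [veronese_of]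
    obtain rfl | h := eq_or_ne m n
    · rw [DirectSum.of_eq_same, DirectSum.of_eq_same]
    · rw [DirectSum.of_eq_of_ne _ _ _ (Ne.symm h), DirectSum.of_eq_of_ne _ _ _
        (fun e => h (Nat.eq_of_mul_eq_mul_left hs e.symm))]
      exact (map_zero (TwExt.incl (leftTw_pow ψ s) t n)).symm

theorem veronese_injective (ψ : Λ ≃ₐ[k] Λ) (t : ℕ) {s : ℕ} (hs : 0 < s) :
    Function.Injective (veronese ψ t s) := by
  intro x y h
  refine DFinsupp.ext fun n => (TwExt.incl_bijective (leftTw_pow ψ s) t n).1 ?_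
  exact (veronese_apply ψ t hs n x).symm.trans ((DFunLike.congr_fun h (s * n)).trans
    (veronese_apply ψ t hs n y))

/-- The projection of `Ext_Λ^{t*}(_{ψ^*}M, N)` onto the part of the degrees which are multiples of
`ts` is compatible with the actions. -/
theorem exists_veronese_projection (ψ : Λ ≃ₐ[k] Λ) (t : ℕ) {s : ℕ} (hs : 0 < s) :
    ∃ π : (⨁ m, TwExt (ψ : Λ →+* Λ) t M N m) →+
        ⨁ m, TwExt ((ψ ^ s : Λ ≃ₐ[k] Λ) : Λ →+* Λ) (t * s) M N m,
      Function.Surjective π ∧ ∀ h ζ, π (actHom M N (veronese ψ t s h) ζ) =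
        actHom M N h (π ζ) := by
  classical
  let hg := algEquiv_pow_toRingHom_pow ψ s
  let E := TwExt (ψ : Λ →+* Λ) t M N
  let E' := TwExt ((ψ ^ s : Λ ≃ₐ[k] Λ) : Λ →+* Λ) (t * s) M N
  -- On a degree divisible by `s` the projection inverts the identification; on any other degree it
  -- is zero. The transport along `s * n = m` lets both cases be stated for an arbitrary `m`.
  have hp : ∀ m, ∃ p : E m →+ ⨁ m, E' m,
      (∀ (n : ℕ) (ζ : E' n) (e : s * n = m), p (e ▸ TwExt.incl hg t n ζ) = of E' n ζ) ∧
        (¬ s ∣ m → p = 0) := by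
    intro m
    by_cases h : s ∣ m
    · obtain ⟨n, rfl⟩ := h
      let e : E' n ≃+ E (s * n) := AddEquiv.ofBijective (TwExt.incl hg t n)
        (TwExt.incl_bijective hg t n)
      refine ⟨(of E' n).comp e.symm.toAddMonoidHom, fun n' ζ h' => ?_,
        fun h' => absurd (dvd_mul_right s n) h'⟩
      obtain rfl := Nat.eq_of_mul_eq_mul_left hs h'
      exact congrArg (of E' n') (e.symm_apply_apply ζ)
    · exact ⟨0, fun n ζ e => absurd ⟨n, e.symm⟩ h, fun _ => rfl⟩
  choose p hp hp' using hp
  have hπ : ∀ (n : ℕ) (ζ : E' n),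
      DirectSum.toAddMonoid p (of E (s * n) (TwExt.incl hg t n ζ)) = of E' n ζ :=
    fun n ζ => (DirectSum.toAddMonoid_of _ _ _).trans (hp _ n ζ rfl)
  have hπ' : ∀ m (ζ : E m), ¬ s ∣ m → DirectSum.toAddMonoid p (of E m ζ) = 0 := fun m ζ h =>
    (DirectSum.toAddMonoid_of _ _ _).trans (by rw [hp' m h]; rfl)
  refine ⟨DirectSum.toAddMonoid p, fun x => ?_, fun h ζ => ?_⟩
  · induction x using DirectSum.induction_on with
    | zero => exact ⟨0, map_zero _⟩
    | of n ζ => exact ⟨_, hπ n ζ⟩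
    | add x y hx hy =>
      obtain ⟨a, rfl⟩ := hx
      obtain ⟨b, rfl⟩ := hy
      exact ⟨a + b, map_add _ _ _⟩
  · induction h using DirectSum.induction_on with
    | zero => simp only [map_zero, AddMonoidHom.zero_apply]
    | add x y hx hy => simp only [map_add, AddMonoidHom.add_apply, hx, hy]
    | of n η =>
      induction ζ using DirectSum.induction_on with
      | zero => simp only [map_zero]
      | add x y hx hy => simp only [map_add, hx, hy]
      | of m ζ =>
        rw [veronese_of, actHom_of, actHom_of, actRight_of]
        by_cases hm : s ∣ m
        · obtain ⟨m, rfl⟩ := hm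
          obtain ⟨ζ, rfl⟩ := (TwExt.incl_bijective hg t m).2 ζ
          rw [hπ, actRight_of, tens_HHincl, ← hπ]
          exact congrArg _ (DirectSum.of_eq_of_gradedMonoid_eq
            (TwExt.incl_mul hg ζ (tens M η))).symm
        · rw [hπ' m ζ hm, map_zero]
          -- Acting by an element of index `s * n` does not change the residue of the degree modulo
          -- `s`, so killed degrees stay killed.
          exact hπ' _ _ fun h => hm ((Nat.dvd_add_left (dvd_mul_right s n)).1 h)

end Veronese

/-! ### Closure properties of invariance, and degree zero -/

section InvariantProducts

/-- Invariance of `η` and `θ` is written as two commuting squares between the right twist `R` and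
the left twist `L`. Applying the power twist `K` to the square of `θ` and swapping `K` past `R` and
`L` produces a square whose right side is the left side of that of `η`; pasting gives the square of
the product. -/
theorem twist_invariant_mul_aux {D : Type v} [Category.{u} D] [Abelian D] [EnoughProjectives D]
    [HasExt.{u} D] (L R K : D ⥤ D) [L.Additive] [Limits.PreservesFiniteLimits L]
    [Limits.PreservesFiniteColimits L] [R.Additive] [Limits.PreservesFiniteLimits R]
    [Limits.PreservesFiniteColimits R] [K.Additive] [Limits.PreservesFiniteLimits K]
    [Limits.PreservesFiniteColimits K] (κ₁ : K ⋙ R ⟶ R ⋙ K) (κ₂ : L ⋙ K ⟶ K ⋙ L) {A B C : D}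
    {a b c d : ℕ} (η : Ext (K.obj A) A a) (θ : Ext B A b) (q : C ⟶ K.obj B) (h : b + a = c)
    (e : 0 + c = d) (t : R.obj A ⟶ L.obj A) (ω : R.obj B ⟶ L.obj B) (ω' : R.obj C ⟶ L.obj C)
    (hθ : (θ.mapExactFunctor R).comp (Ext.mk₀ t) (add_zero b) =
      (Ext.mk₀ ω).comp (θ.mapExactFunctor L) (zero_add b))
    (hη : (η.mapExactFunctor R).comp (Ext.mk₀ t) (add_zero a) =
      (Ext.mk₀ (κ₁.app A ≫ K.map t ≫ κ₂.app A)).comp (η.mapExactFunctor L) (zero_add a))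
    (hq : R.map q ≫ κ₁.app B ≫ K.map ω ≫ κ₂.app B = ω' ≫ L.map q) :
    (Ext.mapExactFunctor R ((Ext.mk₀ q).comp ((θ.mapExactFunctor K).comp η h) e)).comp
        (Ext.mk₀ t) (add_zero d) =
      (Ext.mk₀ ω').comp (Ext.mapExactFunctor L ((Ext.mk₀ q).comp
        ((θ.mapExactFunctor K).comp η h) e)) (zero_add d) := by
  obtain rfl : d = c := by omega
  have n₁ : (Ext.mapExactFunctor R (θ.mapExactFunctor K)).comp (Ext.mk₀ (κ₁.app A)) (add_zero b) =
      (Ext.mk₀ (κ₁.app B)).comp (Ext.mapExactFunctor K (θ.mapExactFunctor R)) (zero_add b) := by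
    have := mapExactFunctor_naturality (K ⋙ R) (R ⋙ K) κ₁ θ
    rwa [← mapExactFunctor_mapExactFunctor, ← mapExactFunctor_mapExactFunctor] at this
  have n₂ : (Ext.mapExactFunctor K (θ.mapExactFunctor L)).comp (Ext.mk₀ (κ₂.app A)) (add_zero b) =
      (Ext.mk₀ (κ₂.app B)).comp (Ext.mapExactFunctor L (θ.mapExactFunctor K)) (zero_add b) := by
    have := mapExactFunctor_naturality (L ⋙ K) (K ⋙ L) κ₂ θ
    rwa [← mapExactFunctor_mapExactFunctor, ← mapExactFunctor_mapExactFunctor] at this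
  have hθ' : (Ext.mapExactFunctor K (θ.mapExactFunctor R)).comp (Ext.mk₀ (K.map t)) (add_zero b) =
      (Ext.mk₀ (K.map ω)).comp (Ext.mapExactFunctor K (θ.mapExactFunctor L)) (zero_add b) := by
    rw [← Ext.mapExactFunctor_mk₀, ← Ext.mapExactFunctor_mk₀, ← Ext.mapExactFunctor_comp, hθ,
      Ext.mapExactFunctor_comp]
  have e₁ : (Ext.mapExactFunctor R (θ.mapExactFunctor K)).comp
      (Ext.mk₀ (κ₁.app A ≫ K.map t ≫ κ₂.app A)) (add_zero b) =
      (Ext.mk₀ (κ₁.app B ≫ K.map ω ≫ κ₂.app B)).comp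
        (Ext.mapExactFunctor L (θ.mapExactFunctor K)) (zero_add b) := by
    rw [← Ext.mk₀_comp_mk₀, ← Ext.mk₀_comp_mk₀, ← Ext.mk₀_comp_mk₀, ← Ext.mk₀_comp_mk₀,
      ← Ext.comp_assoc (a₁₂ := b) (a₂₃ := 0) _ (Ext.mk₀ (κ₁.app A)) _ (by omega) (by omega)
        (by omega), n₁,
      Ext.comp_assoc (a₁₂ := b) (a₂₃ := b) (Ext.mk₀ (κ₁.app B)) _ _ (by omega) (by omega) (by omega),
      ← Ext.comp_assoc (a₁₂ := b) (a₂₃ := 0) _ (Ext.mk₀ (K.map t)) _ (by omega) (by omega)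
        (by omega), hθ',
      Ext.comp_assoc (a₁₂ := b) (a₂₃ := b) (Ext.mk₀ (K.map ω)) _ _ (by omega) (by omega) (by omega),
      n₂,
      Ext.comp_assoc (a₁₂ := 0) (a₂₃ := b) (Ext.mk₀ (κ₁.app B)) _ _ (by omega) (by omega)
        (by omega),
      Ext.comp_assoc (a₁₂ := 0) (a₂₃ := b) (Ext.mk₀ (K.map ω)) _ _ (by omega) (by omega)
        (by omega)]
  rw [Ext.mapExactFunctor_comp, Ext.mapExactFunctor_comp, Ext.mapExactFunctor_mk₀,
    Ext.mapExactFunctor_comp, Ext.mapExactFunctor_comp, Ext.mapExactFunctor_mk₀,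
    Ext.comp_assoc (a₁₂ := d) (a₂₃ := d) (Ext.mk₀ (R.map q)) _ _ (by omega) (by omega) (by omega),
    Ext.comp_assoc (a₁₂ := d) (a₂₃ := a) _ _ (Ext.mk₀ t) (by omega) (by omega) (by omega), hη,
    ← Ext.comp_assoc (a₁₂ := b) (a₂₃ := a) (Ext.mapExactFunctor R _) (Ext.mk₀ _) _ (by omega)
      (by omega) (by omega), e₁,
    Ext.comp_assoc (a₁₂ := b) (a₂₃ := d) (Ext.mk₀ _) _ _ (by omega) (by omega) (by omega),
    ← Ext.comp_assoc (a₁₂ := 0) (a₂₃ := d) (Ext.mk₀ _) (Ext.mk₀ _) _ (by omega) (by omega)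
      (by omega), Ext.mk₀_comp_mk₀, hq, ← Ext.mk₀_comp_mk₀,
    Ext.comp_assoc (a₁₂ := 0) (a₂₃ := d) (Ext.mk₀ ω') _ _ (by omega) (by omega) (by omega)]

/-- The identification `_f(_gX) = _g(_fX)` for commuting `f` and `g`. -/
noncomputable def twComm {S : Type u} [Ring S] {f g : S →+* S} (h : g.comp f = f.comp g) :
    tw g ⋙ tw f ⟶ tw f ⋙ tw g :=
  (ModuleCat.restrictScalarsComp' f g _ rfl).inv ≫ (ModuleCat.restrictScalarsComp' g f _ h).hom

variable {k : Type v} {Λ : Type u} [CommRing k] [Ring Λ] [Algebra k Λ]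

theorem leftTw_pow_comp_rightTw (ψ ρ : Λ ≃ₐ[k] Λ) (n : ℕ) :
    (leftTw ψ ^ n).comp (rightTw ρ) = (rightTw ρ).comp (leftTw ψ ^ n) :=
  Commute.pow_left (leftTw_comp_rightTw ψ ρ) n

theorem leftTw_comp_leftTw_pow (ψ : Λ ≃ₐ[k] Λ) (n : ℕ) :
    (leftTw ψ).comp (leftTw ψ ^ n) = (leftTw ψ ^ n).comp (leftTw ψ) :=
  (Commute.refl (leftTw ψ)).pow_right n

/-- The isomorphism of bimodules `ψ : _{ψⁿ}Λ_{ψ⁻¹} → _ψ(_{ψⁿ}Λ_1)`. -/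
noncomputable def twistMap (ψ : Λ ≃ₐ[k] Λ) (n : ℕ) :
    (tw (rightTw ψ.symm)).obj (twReg ψ n) ⟶ (tw (leftTw ψ)).obj (twReg ψ n) :=
  (twComm (leftTw_pow_comp_rightTw ψ ψ.symm n)).app (regBimod k Λ) ≫
    (tw (leftTw ψ ^ n)).map (tgtTwist ψ) ≫
      (twComm (leftTw_comp_leftTw_pow ψ n)).app (regBimod k Λ)

theorem twComm_comp_map_comp {S : Type u} [Ring S] {f g h : S →+* S} (e : g.comp f = f.comp g)
    (e' : h.comp g = g.comp h) {X Y : ModuleCat.{u} S} (u : (tw f).obj X ⟶ (tw h).obj Y) (x : X) :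
    ((twComm e).app X ≫ (tw g).map u ≫ (twComm e').app Y).hom x = u.hom x := rfl

theorem twistMap_toReg (ψ : Λ ≃ₐ[k] Λ) (n : ℕ) (z : Λ) :
    (twistMap ψ n).hom (toReg k Λ z) = toReg k Λ (ψ z) :=
  (twComm_comp_map_comp (leftTw_pow_comp_rightTw ψ ψ.symm n) (leftTw_comp_leftTw_pow ψ n)
    (tgtTwist ψ) (toReg k Λ z)).trans (tgtTwist_apply ψ z)

/-- The identification `_ψ(_{ψⁿ}Λ_1) = _{ψⁿ⁺¹}Λ_1`. -/
noncomputable def twRegSucc (ψ : Λ ≃ₐ[k] Λ) (n : ℕ) :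
    twReg ψ (n + 1) ≅ (tw (leftTw ψ)).obj (twReg ψ n) :=
  ModuleCat.restrictScalarsComp'App (leftTw ψ) (leftTw ψ ^ n) (leftTw ψ ^ (n + 1)) (pow_succ _ _)
    (regBimod k Λ)

theorem twRegSucc_hom_toReg (ψ : Λ ≃ₐ[k] Λ) (n : ℕ) (z : Λ) :
    (twRegSucc ψ n).hom.hom (toReg k Λ z) = toReg k Λ z := rfl

theorem twRegSucc_inv_toReg (ψ : Λ ≃ₐ[k] Λ) (n : ℕ) (z : Λ) :
    (twRegSucc ψ n).inv.hom (toReg k Λ z) = toReg k Λ z := rfl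

theorem hom_ext_toReg {X Y : ModuleCat.{u} (Env k Λ)} (e : Λ → X) (he : Function.Surjective e)
    {f g : X ⟶ Y} (h : ∀ z, f.hom (e z) = g.hom (e z)) : f = g := by
  refine ModuleCat.hom_ext (LinearMap.ext fun x => ?_)
  obtain ⟨z, rfl⟩ := he x
  exact h z

theorem srcTwist_twistMap_toReg (ψ : Λ ≃ₐ[k] Λ) (n : ℕ) (z : Λ) :
    (srcTwist ψ n ≫ twistMap ψ n).hom (toReg k Λ z) = (twRegSucc ψ n).hom.hom (toReg k Λ z) :=
  ((hom_comp_apply (srcTwist ψ n) (twistMap ψ n) (toReg k Λ z)).trans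
    (congrArg (fun x => (twistMap ψ n).hom x) (srcTwist_apply ψ n z))).trans
    (((twistMap_toReg ψ n (ψ.symm z)).trans (congrArg (toReg k Λ) (ψ.apply_symm_apply z))).trans
      (twRegSucc_hom_toReg ψ n z).symm)

theorem srcTwist_twistMap (ψ : Λ ≃ₐ[k] Λ) (n : ℕ) :
    srcTwist ψ n ≫ twistMap ψ n = (twRegSucc ψ n).hom :=
  hom_ext_toReg (X := twReg ψ (n + 1)) (toReg k Λ) (toReg k Λ).surjective
    (srcTwist_twistMap_toReg ψ n)

theorem twistMap_srcTwist_toReg (ψ : Λ ≃ₐ[k] Λ) (n : ℕ) (z : Λ) :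
    ((twistMap ψ n ≫ (twRegSucc ψ n).inv) ≫ srcTwist ψ n).hom (toReg k Λ z) = toReg k Λ z :=
  ((hom_comp_apply (twistMap ψ n ≫ (twRegSucc ψ n).inv) (srcTwist ψ n) (toReg k Λ z)).trans
    (congrArg (fun x => (srcTwist ψ n).hom x)
      (((hom_comp_apply (twistMap ψ n) (twRegSucc ψ n).inv (toReg k Λ z)).trans
        (congrArg (fun x => (twRegSucc ψ n).inv.hom x) (twistMap_toReg ψ n z))).trans
        (twRegSucc_inv_toReg ψ n (ψ z))))).trans
    ((srcTwist_apply ψ n (ψ z)).trans (congrArg (toReg k Λ) (ψ.symm_apply_apply z)))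

theorem twistMap_srcTwist (ψ : Λ ≃ₐ[k] Λ) (n : ℕ) :
    (twistMap ψ n ≫ (twRegSucc ψ n).inv) ≫ srcTwist ψ n = 𝟙 _ :=
  hom_ext_toReg (X := (tw (rightTw ψ.symm)).obj (twReg ψ n)) (toReg k Λ) (toReg k Λ).surjective
    (twistMap_srcTwist_toReg ψ n)

/-- Cancelling the isomorphism `srcTwist` turns invariance into a commuting square from the right
twist to the left twist, a form that can be pasted along Yoneda products. -/
theorem twistInvariant_iff {ψ : Λ ≃ₐ[k] Λ} {t n : ℕ} (η : HHdeg ψ t n) :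
    TwistInvariant η ↔ (twExt (rightTw ψ.symm) η).comp (Ext.mk₀ (tgtTwist ψ)) (add_zero _) =
      (Ext.mk₀ (twistMap ψ n)).comp (twExt (leftTw ψ) η) (zero_add _) := by
  change (Ext.mk₀ (srcTwist ψ n)).comp _ _ = (Ext.mk₀ (twRegSucc ψ n).hom).comp _ _ ↔ _
  constructor
  · intro h
    have h' := congrArg (fun z => (Ext.mk₀ (twistMap ψ n ≫ (twRegSucc ψ n).inv)).comp z
      (zero_add _)) h
    rw [← Ext.comp_assoc (a₁₂ := 0) _ _ _ (by omega) (by omega) (by omega), Ext.mk₀_comp_mk₀,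
      twistMap_srcTwist, Ext.mk₀_id_comp,
      ← Ext.comp_assoc (a₁₂ := 0) _ _ _ (by omega) (by omega) (by omega), Ext.mk₀_comp_mk₀,
      Category.assoc, Iso.inv_hom_id, Category.comp_id] at h'
    exact h'
  · intro h
    rw [h, ← Ext.comp_assoc (a₁₂ := 0) _ _ _ (by omega) (by omega) (by omega), Ext.mk₀_comp_mk₀,
      srcTwist_twistMap]

theorem tw_map_twComp_twistMap_toReg (ψ : Λ ≃ₐ[k] Λ) (m n : ℕ) (z : Λ) :
    ((tw (rightTw ψ.symm)).map (twComp (pow_add_eq_comp (leftTw ψ) m n) (regBimod k Λ)) ≫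
      (twComm (leftTw_pow_comp_rightTw ψ ψ.symm m)).app (twReg ψ n) ≫
        (tw (leftTw ψ ^ m)).map (twistMap ψ n) ≫
          (twComm (leftTw_comp_leftTw_pow ψ m)).app (twReg ψ n)).hom (toReg k Λ z) =
      toReg k Λ (ψ z) :=
  (hom_comp_apply ((tw (rightTw ψ.symm)).map
      (twComp (pow_add_eq_comp (leftTw ψ) m n) (regBimod k Λ))) _ (toReg k Λ z)).trans
    ((twComm_comp_map_comp (leftTw_pow_comp_rightTw ψ ψ.symm m) (leftTw_comp_leftTw_pow ψ m)
      (twistMap ψ n) (toReg k Λ z)).trans (twistMap_toReg ψ n z))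

theorem twistMap_map_twComp_toReg (ψ : Λ ≃ₐ[k] Λ) (m n : ℕ) (z : Λ) :
    (twistMap ψ (m + n) ≫ (tw (leftTw ψ)).map
      (twComp (pow_add_eq_comp (leftTw ψ) m n) (regBimod k Λ))).hom (toReg k Λ z) =
      toReg k Λ (ψ z) :=
  (hom_comp_apply (twistMap ψ (m + n)) _ (toReg k Λ z)).trans
    ((congrArg (fun x => ((tw (leftTw ψ)).map
      (twComp (pow_add_eq_comp (leftTw ψ) m n) (regBimod k Λ))).hom x)
      (twistMap_toReg ψ (m + n) z)).trans (twComp_toReg ψ m n (ψ z)))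

/-- The compatibility needed to paste two squares: on elements of `Λ` both sides are `ψ`, and all
other maps are identities. -/
theorem twistMap_add (ψ : Λ ≃ₐ[k] Λ) (m n : ℕ) :
    (tw (rightTw ψ.symm)).map (twComp (pow_add_eq_comp (leftTw ψ) m n) (regBimod k Λ)) ≫
      (twComm (leftTw_pow_comp_rightTw ψ ψ.symm m)).app (twReg ψ n) ≫
        (tw (leftTw ψ ^ m)).map (twistMap ψ n) ≫
          (twComm (leftTw_comp_leftTw_pow ψ m)).app (twReg ψ n) =
    twistMap ψ (m + n) ≫ (tw (leftTw ψ)).map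
      (twComp (pow_add_eq_comp (leftTw ψ) m n) (regBimod k Λ)) :=
  hom_ext_toReg (X := (tw (rightTw ψ.symm)).obj (twReg ψ (m + n))) (toReg k Λ)
    (toReg k Λ).surjective fun z => (tw_map_twComp_twistMap_toReg ψ m n z).trans
      (twistMap_map_twComp_toReg ψ m n z).symm

theorem TwistInvariant.mul {ψ : Λ ≃ₐ[k] Λ} {t m n : ℕ} {η : HHdeg ψ t m} {θ : HHdeg ψ t n}
    (hη : TwistInvariant η) (hθ : TwistInvariant θ) : TwistInvariant (TwExt.mul η θ) := by
  rw [twistInvariant_iff] at hη hθ ⊢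
  exact twist_invariant_mul_aux (tw (leftTw ψ)) (tw (rightTw ψ.symm)) (tw (leftTw ψ ^ m))
    (twComm (leftTw_pow_comp_rightTw ψ ψ.symm m)) (twComm (leftTw_comp_leftTw_pow ψ m)) η θ
    (twComp (pow_add_eq_comp (leftTw ψ) m n) (regBimod k Λ)) rfl
    (show 0 + (t * n + t * m) = t * (m + n) by ring) (tgtTwist ψ) (twistMap ψ n)
    (twistMap ψ (m + n)) hθ hη (twistMap_add ψ m n)

theorem TwistInvariant.zero (ψ : Λ ≃ₐ[k] Λ) (t n : ℕ) :
    TwistInvariant (0 : HHdeg ψ t n) := by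
  rw [twistInvariant_iff, twExt_zero, twExt_zero, Ext.zero_comp, Ext.comp_zero]

theorem TwistInvariant.add {ψ : Λ ≃ₐ[k] Λ} {t n : ℕ} {η θ : HHdeg ψ t n}
    (hη : TwistInvariant η) (hθ : TwistInvariant θ) : TwistInvariant (η + θ) := by
  rw [twistInvariant_iff] at hη hθ ⊢
  rw [twExt_add, twExt_add, Ext.add_comp, Ext.comp_add, hη, hθ]

theorem TwistInvariant.neg {ψ : Λ ≃ₐ[k] Λ} {t n : ℕ} {η : HHdeg ψ t n}
    (hη : TwistInvariant η) : TwistInvariant (-η) := by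
  have h : ∀ f : Env k Λ →+* Env k Λ, twExt f (-η) = -twExt f η := fun f =>
    eq_neg_of_add_eq_zero_left (by rw [← twExt_add, neg_add_cancel, twExt_zero])
  rw [twistInvariant_iff] at hη ⊢
  rw [h, h, Ext.neg_comp, Ext.comp_neg, hη]

/-- The value at `1` of an endomorphism of the bimodule `Λ` is central. -/
theorem twReg_zero_hom_toReg (ψ : Λ ≃ₐ[k] Λ) (f : twReg ψ 0 ⟶ regBimod k Λ) (y : Λ) :
    f.hom (toReg k Λ y) = toReg k Λ (y * (toReg k Λ).symm (f.hom (toReg k Λ 1))) ∧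
      y * (toReg k Λ).symm (f.hom (toReg k Λ 1)) = (toReg k Λ).symm (f.hom (toReg k Λ 1)) * y := by
  have h : ∀ a b : Λ, f.hom (toReg k Λ (a * b)) =
      toReg k Λ (a * (toReg k Λ).symm (f.hom (toReg k Λ 1)) * b) := by
    intro a b
    have e : ((a ⊗ₜ[k] MulOpposite.op b : Env k Λ) • (show twReg ψ 0 from toReg k Λ 1) :
        twReg ψ 0) = toReg k Λ (a * b) := by
      change ((leftTw ψ ^ 0) (a ⊗ₜ[k] MulOpposite.op b) • toReg k Λ 1 : regBimod k Λ) = _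
      rw [leftTw_pow_tmul, smul_toReg, pow_zero, mul_one]
      rfl
    rw [← e, map_smul]
    exact smul_toReg a (MulOpposite.op b) ((toReg k Λ).symm (f.hom (toReg k Λ 1)))
  have h₁ := h y 1
  have h₂ := h 1 y
  rw [mul_one, mul_one] at h₁
  rw [one_mul, one_mul] at h₂
  exact ⟨h₁, (toReg k Λ).injective (h₁.symm.trans h₂)⟩

theorem srcTwist_map_tgtTwist_toReg (ψ : Λ ≃ₐ[k] Λ) {n : ℕ} (f : twReg ψ n ⟶ regBimod k Λ)
    (z : Λ) :
    (srcTwist ψ n ≫ (tw (rightTw ψ.symm)).map f ≫ tgtTwist ψ).hom (toReg k Λ z) =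
      toReg k Λ (ψ ((toReg k Λ).symm (f.hom (toReg k Λ (ψ.symm z))))) :=
  (hom_comp_apply (srcTwist ψ n) _ (toReg k Λ z)).trans
    ((congrArg (fun x => ((tw (rightTw ψ.symm)).map f ≫ tgtTwist ψ).hom x)
      (srcTwist_apply ψ n z)).trans
      ((hom_comp_apply ((tw (rightTw ψ.symm)).map f) (tgtTwist ψ) _).trans
        (tgtTwist_apply ψ ((toReg k Λ).symm (f.hom (toReg k Λ (ψ.symm z)))))))

/-- A class of degree zero is multiplication by a central element `c`. Its transported right twist
sends `z` to `ψ(ψ⁻¹(z) c) = z ψ(c)`, while its left twist sends `z` to `z c`, so it is enough that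
`ψ` fixes `c`. -/
theorem twistInvariant_of_degree_zero {ψ : Λ ≃ₐ[k] Λ} {t : ℕ}
    (hψ : ∀ z ∈ Subring.center Λ, ψ z = z) (η : HHdeg ψ t 0) : TwistInvariant η := by
  obtain ⟨f, rfl⟩ := (Ext.mk₀_bijective (twReg ψ 0) (regBimod k Λ)).2 η
  have h : srcTwist ψ 0 ≫ (tw (rightTw ψ.symm)).map f ≫ tgtTwist ψ =
      twComp (show leftTw ψ ^ (0 + 1) = (leftTw ψ ^ 0).comp (leftTw ψ) from pow_succ _ _)
        (regBimod k Λ) ≫ (tw (leftTw ψ)).map f := by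
    refine hom_ext_toReg (X := twReg ψ (0 + 1)) (toReg k Λ) (toReg k Λ).surjective fun z => ?_
    refine (srcTwist_map_tgtTwist_toReg ψ f z).trans
      (Eq.trans ?_ (twComp_comp_apply (pow_succ _ _) (regBimod k Λ)
        ((tw (leftTw ψ)).map f) (toReg k Λ z)).symm)
    refine Eq.trans ?_ (twReg_zero_hom_toReg ψ f z).1.symm
    have hc : (toReg k Λ).symm (f.hom (toReg k Λ 1)) ∈ Subring.center Λ :=
      Subring.mem_center_iff.2 fun y => (twReg_zero_hom_toReg ψ f y).2
    rw [(twReg_zero_hom_toReg ψ f (ψ.symm z)).1, AddEquiv.symm_apply_apply, map_mul,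
      AlgEquiv.apply_symm_apply, hψ _ hc]
  unfold TwistInvariant
  have e := fun g : Env k Λ →+* Env k Λ => twExt_mk₀ g f
  refine (congrArg (fun x => Ext.comp _ (Ext.comp (a := 0) x _ _) _) (e _)).trans ?_
  refine Eq.trans ?_ (congrArg (fun x => Ext.comp (b := 0) _ x _) (e _)).symm
  refine (congrArg (fun x => Ext.comp (b := 0) _ x _) (Ext.mk₀_comp_mk₀ _ _)).trans ?_
  refine (Ext.mk₀_comp_mk₀ _ _).trans (Eq.trans ?_ (Ext.mk₀_comp_mk₀ _ _).symm)
  exact congrArg Ext.mk₀ h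

end InvariantProducts

/-! ### Noetherian graded rings and subrings generated in one degree -/

section GradedNoetherian

variable {R : Type u} [CommRing R] (𝒜 : ℕ → AddSubgroup R) [GradedRing 𝒜]

/-- A Noetherian graded commutative ring is generated over its degree zero part by finitely many
homogeneous elements of positive degree. -/
theorem exists_homogeneous_generators [IsNoetherianRing R] :
    ∃ S : Finset R, Algebra.adjoin (𝒜 0) (S : Set R) = ⊤ ∧ ∀ g ∈ S, ∃ m, 0 < m ∧ g ∈ 𝒜 m := by
  classical
  -- The irrelevant ideal is finitely generated, and its generators can be picked among the
  -- homogeneous elements of positive degree that span it.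
  let T : Set R := {x | ∃ m, 0 < m ∧ x ∈ 𝒜 m}
  obtain ⟨S, hST, hS⟩ := (Submodule.fg_span_iff_fg_span_finset_subset (R := R) T).1
    (IsNoetherian.noetherian _)
  refine ⟨S, ?_, fun g hg => hST hg⟩
  have key : ∀ n, ∀ x ∈ 𝒜 n, x ∈ Algebra.adjoin (𝒜 0) (S : Set R) := by
    intro n
    induction n using Nat.strong_induction_on with
    | _ n ih =>
    intro x hx
    obtain rfl | hn := Nat.eq_zero_or_pos n
    · exact Subalgebra.algebraMap_mem _ (⟨x, hx⟩ : 𝒜 0)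
    have hxs : x ∈ Submodule.span R (S : Set R) := hS ▸ Submodule.subset_span ⟨n, hn, hx⟩
    obtain ⟨r, -, hr⟩ := Submodule.mem_span_finset.1 hxs
    -- Only the degree `n` part of each `r g * g` matters. It is the degree `n - m` part of the
    -- coefficient times `g`, and `m > 0` makes the induction apply to that coefficient.
    have hx' : x = ∑ g ∈ S, (decompose 𝒜 (r g * g) n : R) := by
      rw [← decompose_of_mem_same 𝒜 hx]
      nth_rewrite 1 [← hr]
      rw [decompose_sum, DFinsupp.finsetSum_apply]
      simp
    rw [hx']
    refine sum_mem fun g hg => ?_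
    obtain ⟨m, hm, hgm⟩ := hST hg
    by_cases h : m ≤ n
    · rw [coe_decompose_mul_of_right_mem_of_le 𝒜 hgm h]
      exact mul_mem (ih _ (by omega) _ (SetLike.coe_mem _)) (Algebra.subset_adjoin hg)
    · rw [coe_decompose_mul_of_right_mem_of_not_le 𝒜 hgm h]
      exact zero_mem _
  rw [eq_top_iff]
  intro x _
  rw [← sum_support_decompose 𝒜 x]
  exact sum_mem fun n _ => key n _ (SetLike.coe_mem _)

/-- In a Noetherian graded commutative ring, if `s` is a suitable positive multiple of `r`, then
every subring containing the elements of degree `0` and the products of two elements of degree `s`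
is Noetherian, and the ring is finite over it. -/
theorem exists_degree_noetherian_subring [IsNoetherianRing R] {r : ℕ} (hr : 0 < r) :
    ∃ s, 0 < s ∧ r ∣ s ∧ ∀ B : Subring R, (∀ x ∈ 𝒜 0, x ∈ B) →
      (∀ x ∈ 𝒜 s, ∀ y ∈ 𝒜 s, x * y ∈ B) → IsNoetherianRing B ∧ Module.Finite B R := by
  classical
  obtain ⟨S, hS, hdeg⟩ := exists_homogeneous_generators 𝒜
  choose! m hm hgm using hdeg
  -- A positive multiple of `r` divisible by the degree of every generator.
  refine ⟨r * ∏ g ∈ S, m g, Nat.mul_pos hr (Finset.prod_pos hm), dvd_mul_right _ _,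
    fun B h₀ h₁ => ?_⟩
  set s := r * ∏ g ∈ S, m g with hs
  have hsm : ∀ g ∈ S, m g ∣ s := fun g hg =>
    (Finset.dvd_prod_of_mem m hg).trans (dvd_mul_left _ _)
  have hs0 : 0 < s := Nat.mul_pos hr (Finset.prod_pos hm)
  have hpos : ∀ g ∈ S, 0 < s / m g := fun g hg =>
    Nat.div_pos (Nat.le_of_dvd hs0 (hsm g hg)) (hm g hg)
  -- The power `g ^ (s / m g)` has degree exactly `s`, so its square is one of the products that `B`
  -- is assumed to contain, and each generator is integral over the algebra of these squares.
  let pw : R → R := fun g => g ^ (s / m g) * g ^ (s / m g)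
  let A := Algebra.adjoin (𝒜 0) (S.image pw : Set R)
  have hA : A.toSubring ≤ B := by
    let B' : Subalgebra (𝒜 0) R := { B with algebraMap_mem' := fun z => h₀ _ z.2 }
    have : A ≤ B' := by
      refine Algebra.adjoin_le ?_
      intro x hx
      obtain ⟨g, hg, rfl⟩ := Finset.mem_image.1 (Finset.mem_coe.1 hx)
      have : g ^ (s / m g) ∈ 𝒜 s := by
        have := SetLike.pow_mem_graded (s / m g) (hgm g hg)
        rwa [smul_eq_mul, Nat.div_mul_cancel (hsm g hg)] at this
      exact h₁ _ this _ this
    exact this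
  have : IsNoetherianRing (𝒜 0) := GradedRing.GradeZero.isNoetherianRing 𝒜
  have : Algebra.FiniteType (𝒜 0) A :=
    (Subalgebra.fg_iff_finiteType A).1 ⟨S.image pw, rfl⟩
  have : IsNoetherianRing A := Algebra.FiniteType.isNoetherianRing (𝒜 0) A
  have hft : Algebra.FiniteType (𝒜 0) R := ⟨⟨S, hS⟩⟩
  have : Algebra.FiniteType A R := Algebra.FiniteType.of_restrictScalars_finiteType (𝒜 0) A R
  have hint : Algebra.IsIntegral A R := by
    refine ⟨fun x => ?_⟩
    have hx : x ∈ Algebra.adjoin (𝒜 0) (S : Set R) := hS ▸ Algebra.mem_top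
    induction hx using Algebra.adjoin_induction with
    | mem g hg =>
      refine IsIntegral.of_pow (n := s / m g + s / m g) (by have := hpos g hg; omega) ?_
      rw [pow_add]
      exact isIntegral_algebraMap (R := A)
        (x := ⟨pw g, Algebra.subset_adjoin (Finset.mem_coe.2 (Finset.mem_image_of_mem pw hg))⟩)
    | algebraMap z => exact isIntegral_algebraMap (R := A) (x := algebraMap (𝒜 0) A z)
    | add x y _ _ hx hy => exact hx.add hy
    | mul x y _ _ hx hy => exact hx.mul hy
  have hfin : Module.Finite A R := Algebra.finite_iff_isIntegral_and_finiteType.2 ⟨hint, this⟩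
  let i : A →+* B := Subring.inclusion hA
  let _ : Algebra A B := i.toAlgebra
  have : IsScalarTower A B R := ⟨fun a b x => mul_assoc (a : R) (b : R) x⟩
  refine ⟨?_, Module.Finite.of_restrictScalars_finite A B R⟩
  -- Nothing is known about generators of `B`; it is Noetherian because it lies between the
  -- Noetherian ring `A` and the finite `A`-module `R`, and its ideals are `A`-submodules.
  have hN : IsNoetherian A R := isNoetherian_of_isNoetherianRing_of_finite A R
  let f : B →ₗ[A] R :=
    { toFun := fun b => b
      map_add' := fun _ _ => rfl
      map_smul' := fun _ _ => rfl }
  have : IsNoetherian A B := isNoetherian_of_injective f Subtype.val_injective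
  exact isNoetherian_of_tower A this

end GradedNoetherian

/-! ### Graded subrings of a direct sum as internally graded rings -/

section GradedSubring

variable {A : ℕ → Type u} [∀ n, AddCommGroup (A n)] [DirectSum.GRing A]

/-- The homogeneous elements of degree `n` of a subring of `⨁ n, A n`. -/
def gradedPart (H : Subring (⨁ n, A n)) (n : ℕ) : AddSubgroup H :=
  (of A n).range.comap H.subtype.toAddMonoidHom

theorem mem_gradedPart {H : Subring (⨁ n, A n)} {n : ℕ} {x : H} :
    x ∈ gradedPart H n ↔ ∃ a : A n, of A n a = x := Iff.rfl

theorem coe_gradedPart_apply {H : Subring (⨁ n, A n)} (x : ⨁ n, gradedPart H n) (n : ℕ) :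
    ((DirectSum.coeAddMonoidHom (gradedPart H) x : H) : ⨁ n, A n) n =
      ((x n : H) : ⨁ n, A n) n := by
  induction x using DirectSum.induction_on with
  | zero => rw [map_zero]; rfl
  | add x y hx hy =>
    rw [map_add]
    exact congrArg₂ (· + ·) hx hy
  | of m x =>
    rw [DirectSum.coeAddMonoidHom_of]
    obtain rfl | h := eq_or_ne m n
    · rw [of_eq_same]
    · rw [of_eq_of_ne _ _ _ h.symm]
      obtain ⟨a, ha⟩ := mem_gradedPart.1 x.2
      rw [← ha]
      exact of_eq_of_ne _ _ _ h.symm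

/-- Components in `H` agree with components in the ambient direct sum, which gives uniqueness; the
hypothesis that `H` contains the components of its elements gives existence. -/
theorem gradedPart_isInternal {H : Subring (⨁ n, A n)}
    (hH : ∀ x ∈ H, ∀ n, of A n (x n) ∈ H) : DirectSum.IsInternal (gradedPart H) := by
  classical
  refine ⟨fun x y h => ?_, fun x => ?_⟩
  · refine DFinsupp.ext fun n => Subtype.ext (Subtype.ext ?_)
    have e : ((x n : H) : ⨁ n, A n) n = ((y n : H) : ⨁ n, A n) n := by
      rw [← coe_gradedPart_apply, ← coe_gradedPart_apply, h]
    obtain ⟨a, ha⟩ := mem_gradedPart.1 (x n).2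
    obtain ⟨b, hb⟩ := mem_gradedPart.1 (y n).2
    rw [← ha, ← hb, of_eq_same, of_eq_same] at e
    rw [← ha, ← hb, e]
  · refine ⟨∑ n ∈ DFinsupp.support x.1,
      of (fun n => gradedPart H n) n ⟨⟨of A n (x.1 n), hH _ x.2 n⟩, ⟨_, rfl⟩⟩, ?_⟩
    rw [map_sum]
    refine Subtype.ext ((map_sum H.subtype _ _).trans ?_)
    refine Eq.trans (Finset.sum_congr rfl fun n _ => ?_) (DirectSum.sum_support_of x.1)
    rw [DirectSum.coeAddMonoidHom_of]
    rfl

/-- A graded subring of `⨁ n, A n` is a graded ring. -/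
noncomputable abbrev gradedPartGradedRing {H : Subring (⨁ n, A n)}
    (hH : ∀ x ∈ H, ∀ n, of A n (x n) ∈ H) : GradedRing (gradedPart H) :=
  { (gradedPart_isInternal hH).chooseDecomposition with
    one_mem := mem_gradedPart.2 ⟨GradedMonoid.GOne.one, rfl⟩
    mul_mem := fun m n x y hx hy => by
      obtain ⟨a, ha⟩ := mem_gradedPart.1 hx
      obtain ⟨b, hb⟩ := mem_gradedPart.1 hy
      refine mem_gradedPart.2 ⟨GradedMonoid.GMul.mul a b, ?_⟩
      rw [← of_mul_of, ha, hb]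
      rfl }

/-- In a commutative Noetherian graded subring `H` of `⨁ n, A n`, if `s` is a suitable positive
multiple of `r`, then every subring of `H` containing the elements of degree `0` and the products
of two elements of degree `s` is Noetherian, and `H` is finite over it. -/
theorem exists_degree_noetherian_of_graded_subring (H : Subring (⨁ n, A n))
    (hH : ∀ x ∈ H, ∀ n, of A n (x n) ∈ H) (hcomm : ∀ x ∈ H, ∀ y ∈ H, x * y = y * x)
    (hN : IsNoetherianRing H) {r : ℕ} (hr : 0 < r) :
    ∃ s, 0 < s ∧ r ∣ s ∧ ∀ B : Subring H, (∀ x ∈ gradedPart H 0, x ∈ B) →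
      (∀ x ∈ gradedPart H s, ∀ y ∈ gradedPart H s, x * y ∈ B) →
        IsNoetherianRing B ∧ Module.Finite B H := by
  let _ : CommRing H :=
    { (inferInstance : Ring H) with
      mul_comm := fun x y => Subtype.ext (hcomm _ x.2 _ y.2) }
  let _ : GradedRing (gradedPart H) := gradedPartGradedRing hH
  have : IsNoetherianRing H := hN
  exact exists_degree_noetherian_subring (gradedPart H) hr

end GradedSubring

/-! ### The invariant subring and descent of finite generation -/

section InvariantSubring

variable {k : Type v} {Λ : Type u} [CommRing k] [Ring Λ] [Algebra k Λ]

/-- Associativity and unit laws hold only up to a change of index, so invariance has to be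
transported along equality in the graded monoid. -/
theorem twistInvariant_congr {ψ : Λ ≃ₐ[k] Λ} {t m n : ℕ} {η : HHdeg ψ t m} {θ : HHdeg ψ t n}
    (h : GradedMonoid.mk (A := HHdeg ψ t) m η = GradedMonoid.mk n θ) :
    TwistInvariant (ψ := ψ) (t := t) (n := m) η ↔ TwistInvariant (ψ := ψ) (t := t) (n := n) θ := by
  obtain ⟨rfl, h⟩ := Sigma.mk.inj_iff.1 h
  obtain rfl := eq_of_heq h
  exact Iff.rfl

theorem twistInvariant_mul_assoc {ψ : Λ ≃ₐ[k] Λ} {t a b c : ℕ} (x : HHdeg ψ t a)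
    (y : HHdeg ψ t b) (z : HHdeg ψ t c)
    (h : TwistInvariant (ψ := ψ) (t := t) (n := a + b + c) (TwExt.mul (TwExt.mul x y) z)) :
    TwistInvariant (ψ := ψ) (t := t) (n := a + (b + c)) (TwExt.mul x (TwExt.mul y z)) :=
  (twistInvariant_congr (TwExt.mul_assoc' x y z)).1 h

theorem twistInvariant_mul_of_eq {ψ : Λ ≃ₐ[k] Λ} {t a b n : ℕ} (h : a = b) (x : HHdeg ψ t a)
    (θ : HHdeg ψ t n)
    (hy : ∀ y : HHdeg ψ t b, TwistInvariant (ψ := ψ) (t := t) (n := b + n) (TwExt.mul y θ)) :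
    TwistInvariant (ψ := ψ) (t := t) (n := a + n) (TwExt.mul x θ) := by
  subst h
  exact hy x

/-- The elements `x` of `HH^{t*}(_{ψ^*}Λ_1, Λ)` such that the components of positive degree of `zx`
are invariant for all `z` of degree `0`. -/
def invariantSubgroup (ψ : Λ ≃ₐ[k] Λ) (t : ℕ) : AddSubgroup (HHtw ψ t) where
  carrier := {x | ∀ n, 0 < n → ∀ z : HHdeg ψ t 0, TwistInvariant (TwExt.mul z (x n))}
  zero_mem' n _ z := by
    have h : TwExt.mul z ((0 : HHtw ψ t) n) = 0 := TwExt.mul_zero' z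
    rw [h]
    exact TwistInvariant.zero _ _ _
  add_mem' {x y} hx hy n hn z := by
    have h : TwExt.mul z ((x + y) n) = TwExt.mul z (x n) + TwExt.mul z (y n) :=
      TwExt.mul_add' z _ _
    rw [h]
    exact (hx n hn z).add (hy n hn z)
  neg_mem' {x} hx n hn z := by
    have h : TwExt.mul z ((-x) n) = -TwExt.mul z (x n) := eq_neg_of_add_eq_zero_left (by
      rw [← TwExt.mul_add', DFinsupp.neg_apply, neg_add_cancel, TwExt.mul_zero'])
    rw [h]
    exact (hx n hn z).neg

theorem of_mem_invariantSubgroup {ψ : Λ ≃ₐ[k] Λ} {t n : ℕ} {η : HHdeg ψ t n} :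
    of (HHdeg ψ t) n η ∈ invariantSubgroup ψ t ↔
      (0 < n → ∀ z : HHdeg ψ t 0, TwistInvariant (TwExt.mul z η)) := by
  refine ⟨fun h hn z => ?_, fun h m hm z => ?_⟩
  · have := h n hn z
    rwa [of_eq_same] at this
  · obtain rfl | hmn := eq_or_ne m n
    · rw [of_eq_same]
      exact h hm z
    · rw [of_eq_of_ne _ _ _ hmn, TwExt.mul_zero']
      exact TwistInvariant.zero _ _ _

theorem twistInvariant_of_mem {ψ : Λ ≃ₐ[k] Λ} {t n : ℕ} {η : HHdeg ψ t n}
    (h : of (HHdeg ψ t) n η ∈ invariantSubgroup ψ t) (hn : 0 < n) : TwistInvariant η :=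
  (twistInvariant_congr (TwExt.one_mul' η)).1
    (of_mem_invariantSubgroup.1 h hn (TwExt.one (leftTw ψ) t (regBimod k Λ)))

theorem of_zero_mem_invariantSubgroup {ψ : Λ ≃ₐ[k] Λ} {t : ℕ} (z : HHdeg ψ t 0) :
    of (HHdeg ψ t) 0 z ∈ invariantSubgroup ψ t :=
  of_mem_invariantSubgroup.2 fun h => absurd h (lt_irrefl 0)

theorem HHtw_of_mul_of {ψ : Λ ≃ₐ[k] Λ} {t m n : ℕ} (η : HHdeg ψ t m) (θ : HHdeg ψ t n) :
    of (HHdeg ψ t) m η * of (HHdeg ψ t) n θ = of (HHdeg ψ t) (m + n) (TwExt.mul η θ) :=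
  of_mul_of η θ

theorem of_zero_mul_mem {ψ : Λ ≃ₐ[k] Λ} {t n : ℕ} (z : HHdeg ψ t 0) {η : HHdeg ψ t n}
    (hη : of (HHdeg ψ t) n η ∈ invariantSubgroup ψ t) :
    of (HHdeg ψ t) 0 z * of (HHdeg ψ t) n η ∈ invariantSubgroup ψ t := by
  rw [HHtw_of_mul_of]
  refine of_mem_invariantSubgroup.2 fun hn w => ?_
  exact twistInvariant_mul_assoc w z η (twistInvariant_mul_of_eq (add_zero 0) (TwExt.mul w z) η
    (of_mem_invariantSubgroup.1 hη (by omega)))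

/-- In positive degrees `w(ηθ) = (wη)θ` is a product of two invariant elements. If `η` has degree
zero then `w(ηθ) = (wη)θ` with `wη` of degree zero, covered by the condition on `θ`; if `θ` has
degree zero, commutation reduces to that case. -/
theorem of_mul_of_mem {ψ : Λ ≃ₐ[k] Λ} {t m n : ℕ} {η : HHdeg ψ t m} {θ : HHdeg ψ t n}
    (hη : of (HHdeg ψ t) m η ∈ invariantSubgroup ψ t)
    (hθ : of (HHdeg ψ t) n θ ∈ invariantSubgroup ψ t)
    (hc : of (HHdeg ψ t) m η * of (HHdeg ψ t) n θ = of (HHdeg ψ t) n θ * of (HHdeg ψ t) m η) :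
    of (HHdeg ψ t) m η * of (HHdeg ψ t) n θ ∈ invariantSubgroup ψ t := by
  obtain rfl | hm := Nat.eq_zero_or_pos m
  · exact of_zero_mul_mem η hθ
  obtain rfl | hn := Nat.eq_zero_or_pos n
  · rw [hc]
    exact of_zero_mul_mem θ hη
  rw [HHtw_of_mul_of]
  refine of_mem_invariantSubgroup.2 fun _ w => ?_
  exact twistInvariant_mul_assoc w η θ
    ((of_mem_invariantSubgroup.1 hη hm w).mul (twistInvariant_of_mem hθ hn))

/-- For `w` of degree zero, `w(ηθ) = (wη)θ` is again a product of two elements of index `1`, so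
`twistInvariant_mul` covers every such multiple, whether or not `w` itself is invariant. -/
theorem of_one_mul_of_one_mem [Module.Projective k Λ] {ψ : Λ ≃ₐ[k] Λ} {t : ℕ}
    (η θ : HHdeg ψ t 1) :
    of (HHdeg ψ t) 1 η * of (HHdeg ψ t) 1 θ ∈ invariantSubgroup ψ t := by
  rw [HHtw_of_mul_of]
  refine of_mem_invariantSubgroup.2 fun _ w => ?_
  exact twistInvariant_mul_assoc w η θ (twistInvariant_mul_of_eq (zero_add 1) (TwExt.mul w η) θ
    fun y => twistInvariant_mul y θ)

/-- The subring of `HH^{ts*}(_{(ψˢ)^*}Λ_1, Λ)` of the elements of a commutative graded subring `H`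
of `HH^{t*}(_{ψ^*}Λ_1, Λ)` which lie in the invariant subgroup. -/
noncomputable def invariantSubring [Module.Projective k Λ] {ψ : Λ ≃ₐ[k] Λ} {t s : ℕ} (hs : 0 < s)
    (H : Subring (HHtw ψ t)) (hH : ∀ x ∈ H, ∀ n : ℕ, of (HHdeg ψ t) n (x n) ∈ H)
    (hc : ∀ x ∈ H, ∀ y ∈ H, x * y = y * x) : Subring (HHtw (ψ ^ s) (t * s)) where
  carrier := {x | veronese ψ t s x ∈ H ∧ x ∈ invariantSubgroup (ψ ^ s) (t * s)}
  zero_mem' := ⟨by rw [map_zero]; exact zero_mem H, zero_mem _⟩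
  one_mem' := ⟨by rw [map_one]; exact one_mem H, of_zero_mem_invariantSubgroup _⟩
  add_mem' hx hy := ⟨by rw [map_add]; exact add_mem hx.1 hy.1, add_mem hx.2 hy.2⟩
  neg_mem' hx := ⟨by rw [map_neg]; exact neg_mem hx.1, neg_mem hx.2⟩
  mul_mem' {x y} hx hy := by
    classical
    refine ⟨by rw [map_mul]; exact mul_mem hx.1 hy.1, ?_⟩
    have hm : ∀ {x : HHtw (ψ ^ s) (t * s)}, x ∈ invariantSubgroup (ψ ^ s) (t * s) → ∀ n,
        of (HHdeg (ψ ^ s) (t * s)) n (x n) ∈ invariantSubgroup (ψ ^ s) (t * s) := fun h n =>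
      of_mem_invariantSubgroup.2 (h n)
    have hv : ∀ {x : HHtw (ψ ^ s) (t * s)}, veronese ψ t s x ∈ H → ∀ n,
        veronese ψ t s (of (HHdeg (ψ ^ s) (t * s)) n (x n)) ∈ H := fun {x} h n => by
      rw [veronese_of, ← veronese_apply ψ t hs n x]
      exact hH _ h _
    -- The product is expanded into products of homogeneous components. These commute because their
    -- images lie in the commutative graded ring `H` and the inclusion is injective.
    rw [← DirectSum.sum_support_of x, ← DirectSum.sum_support_of y, Finset.sum_mul_sum]
    refine sum_mem fun i _ => sum_mem fun j _ => of_mul_of_mem (hm hx.2 i) (hm hy.2 j) ?_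
    refine veronese_injective ψ t hs ?_
    rw [map_mul, map_mul]
    exact hc _ (hv hx.1 i) _ (hv hy.1 j)

variable [Module.Projective k Λ]

theorem exists_veronese_of_eq {ψ : Λ ≃ₐ[k] Λ} {t s n m : ℕ} (h : s * n = m) (η : HHdeg ψ t m) :
    ∃ η' : HHdeg (ψ ^ s) (t * s) n, veronese ψ t s (of _ n η') = of (HHdeg ψ t) m η := by
  subst h
  obtain ⟨η', rfl⟩ := (TwExt.incl_bijective (leftTw_pow ψ s) t n).2 η
  exact ⟨η', veronese_of ψ t s n η'⟩

theorem actHom_mem {ψ : Λ ≃ₐ[k] Λ} {t : ℕ} (M N : ModuleCat.{u} Λ) {H : Subring (HHtw ψ t)}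
    (hH : ∀ x ∈ H, ∀ n : ℕ, of (HHdeg ψ t) n (x n) ∈ H)
    {V : AddSubgroup (⨁ m, TwExt (ψ : Λ →+* Λ) t M N m)}
    (hV : ∀ (n : ℕ) (η : HHdeg ψ t n), DirectSum.of (HHdeg ψ t) n η ∈ H →
        ∀ ζ ∈ V, actRight M N η ζ ∈ V) {x : HHtw ψ t} (hx : x ∈ H)
    {ζ : ⨁ m, TwExt (ψ : Λ →+* Λ) t M N m} (hζ : ζ ∈ V) : actHom M N x ζ ∈ V := by
  classical
  rw [← DirectSum.sum_support_of x, map_sum, AddMonoidHom.finsetSum_apply]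
  refine sum_mem fun n _ => ?_
  rw [actHom_of]
  exact hV n _ (hH x hx n) ζ hζ

theorem actHom_mul_mem {ψ : Λ ≃ₐ[k] Λ} {t s : ℕ} (M N : ModuleCat.{u} Λ)
    {π : (⨁ m, TwExt (ψ : Λ →+* Λ) t M N m) →+
      ⨁ m, TwExt ((ψ ^ s : Λ ≃ₐ[k] Λ) : Λ →+* Λ) (t * s) M N m}
    (hπ : ∀ h ζ, π (actHom M N (veronese ψ t s h) ζ) = actHom M N h (π ζ))
    {H' : Subring (HHtw (ψ ^ s) (t * s))}
    (hH' : ∀ x ∈ H', ∀ n : ℕ, of (HHdeg (ψ ^ s) (t * s)) n (x n) ∈ H')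
    {V : AddSubgroup (⨁ m, TwExt ((ψ ^ s : Λ ≃ₐ[k] Λ) : Λ →+* Λ) (t * s) M N m)}
    (hV : ∀ (n : ℕ) (η : HHdeg (ψ ^ s) (t * s) n), of (HHdeg (ψ ^ s) (t * s)) n η ∈ H' →
        ∀ ζ ∈ V, actRight M N η ζ ∈ V)
    {x : HHtw ψ t} {b : HHtw (ψ ^ s) (t * s)} (hb : b ∈ H')
    {ζ : ⨁ m, TwExt (ψ : Λ →+* Λ) t M N m} (hζ : π (actHom M N x ζ) ∈ V) :
    π (actHom M N (x * veronese ψ t s b) ζ) ∈ V := by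
  rw [actHom_mul, AddMonoidHom.comp_apply, hπ]
  exact actHom_mem M N hH' hV hb hζ

/-- Finite generation of `Ext_Λ^{t*}(_{ψ^*}M, N)` passes from `H` to a subring over which `H` is
finite. -/
theorem extFG_of_finite {ψ : Λ ≃ₐ[k] Λ} {t s : ℕ} (hs : 0 < s) (M N : ModuleCat.{u} Λ)
    {H : Subring (HHtw ψ t)} (hc : ∀ x ∈ H, ∀ y ∈ H, x * y = y * x) (hfg : ExtFG M N H)
    {H' : Subring (HHtw (ψ ^ s) (t * s))}
    (hH' : ∀ x ∈ H', ∀ n : ℕ, of (HHdeg (ψ ^ s) (t * s)) n (x n) ∈ H')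
    {B : Subring H} (hB : ∀ b ∈ B, ∃ x ∈ H', veronese ψ t s x = b) [hfin : Module.Finite B H] :
    ExtFG M N H' := by
  classical
  obtain ⟨S, hS⟩ := hfg
  obtain ⟨F, hF⟩ := hfin.fg_top
  obtain ⟨π, hπ, hπ'⟩ := exists_veronese_projection M N ψ t hs
  refine ⟨Finset.image₂ (fun (f : H) ζ => π (actHom M N f.1 ζ)) F S, fun V hSV hV => ?_⟩
  -- The candidate generators are the projections of `ζ f`, with `ζ` a generator of Ext over `H` and
  -- `f` a generator of `H` over `B`. To see that they generate, `W` collects the `ζ` for which all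
  -- `π(ζ f)` lie in `V`, and the plan is to show that `W` is an `H`-submodule.
  let W : AddSubgroup (⨁ m, TwExt (ψ : Λ →+* Λ) t M N m) :=
    { carrier := {ζ | ∀ f ∈ F, π (actHom M N f.1 ζ) ∈ V}
      zero_mem' := fun f _ => by rw [map_zero, map_zero]; exact zero_mem V
      add_mem' := fun hx hy f hf => by rw [map_add, map_add]; exact add_mem (hx f hf) (hy f hf)
      neg_mem' := fun hx f hf => by rw [map_neg, map_neg]; exact neg_mem (hx f hf) }
  have key : ∀ x : H, ∀ ζ ∈ W, π (actHom M N x.1 ζ) ∈ V := by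
    intro x ζ hζ
    have hx : x ∈ Submodule.span B (F : Set H) := hF ▸ Submodule.mem_top
    induction hx using Submodule.span_induction with
    | mem f hf => exact hζ f hf
    | zero =>
      rw [ZeroMemClass.coe_zero, map_zero, AddMonoidHom.zero_apply, map_zero]
      exact zero_mem V
    | add x y _ _ hx hy =>
      rw [Subring.coe_add, map_add, AddMonoidHom.add_apply, map_add]
      exact add_mem hx hy
    | smul b x _ hx =>
      obtain ⟨b', hb', hb⟩ := hB b.1 b.2
      -- The action is on the right, so the element coming from `H'` must be the last to act before
      -- `π` can be moved past it; commutativity of `H` puts it there.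
      have e : ((b • x : H) : HHtw ψ t) = x.1 * veronese ψ t s b' := by
        rw [hb]
        exact hc _ b.1.2 _ x.2
      rw [e]
      exact actHom_mul_mem M N hπ' hH' hV hb' hx
  have hW : W = ⊤ := by
    -- Stability of `W` under `η` uses `key` for the element `η f` of `H`, which acts as `η`
    -- followed by `f`.
    refine hS W (fun ζ hζ f hf => hSV _ (Finset.mem_image₂_of_mem hf hζ)) fun n η hη ζ hζ f hf => ?_
    have h := key (⟨_, hη⟩ * f) ζ hζ
    rwa [Subring.coe_mul, actHom_mul, AddMonoidHom.comp_apply, actHom_of] at h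
  refine eq_top_iff.2 fun x _ => ?_
  obtain ⟨ζ, rfl⟩ := hπ x
  have h := key 1 ζ (hW ▸ AddSubgroup.mem_top ζ)
  rwa [Subring.coe_one, actHom_one] at h

end InvariantSubring

/-! ### The invariant subring meets the finiteness criteria -/

section Veronese

variable {k : Type v} {Λ : Type u} [CommRing k] [Ring Λ] [Algebra k Λ] [Module.Projective k Λ]
  {ψ : Λ ≃ₐ[k] Λ} {t s : ℕ} (hs : 0 < s) {H : Subring (HHtw ψ t)}
  (hH : ∀ x ∈ H, ∀ n : ℕ, of (HHdeg ψ t) n (x n) ∈ H) (hc : ∀ x ∈ H, ∀ y ∈ H, x * y = y * x)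

/-- The inclusion of the invariant subring in `H`. -/
noncomputable def invariantSubringHom : invariantSubring hs H hH hc →+* H :=
  ((veronese ψ t s).comp (invariantSubring hs H hH hc).subtype).codRestrict H fun x => x.2.1

theorem invariantSubringHom_injective : Function.Injective (invariantSubringHom hs hH hc) :=
  fun _ _ h => Subtype.ext (veronese_injective ψ t hs (congrArg Subtype.val h))

theorem mem_range_of_mem_gradedPart_zero {x : H} (hx : x ∈ gradedPart H 0) :
    x ∈ (invariantSubringHom hs hH hc).range := by
  obtain ⟨a, ha⟩ := mem_gradedPart.1 hx
  obtain ⟨η, hη⟩ := exists_veronese_of_eq (mul_zero s) a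
  rw [ha] at hη
  exact ⟨⟨_, by rw [hη]; exact x.2, of_zero_mem_invariantSubgroup η⟩, Subtype.ext hη⟩

/-- Index `s` in the larger ring is index `1` in the smaller one, where products of two elements of
index `1` are invariant. Together with `mem_range_of_mem_gradedPart_zero` this supplies the
hypotheses of `exists_degree_noetherian_of_graded_subring`. -/
theorem mul_mem_range_of_mem_gradedPart {x y : H} (hx : x ∈ gradedPart H s)
    (hy : y ∈ gradedPart H s) : x * y ∈ (invariantSubringHom hs hH hc).range := by
  obtain ⟨a, ha⟩ := mem_gradedPart.1 hx
  obtain ⟨b, hb⟩ := mem_gradedPart.1 hy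
  obtain ⟨η, hη⟩ := exists_veronese_of_eq (mul_one s) a
  obtain ⟨θ, hθ⟩ := exists_veronese_of_eq (mul_one s) b
  have h := congrArg₂ (· * ·) (hη.trans ha) (hθ.trans hb)
  have e : veronese ψ t s (of _ 1 η * of _ 1 θ) = ((x * y : H) : HHtw ψ t) :=
    (map_mul (veronese ψ t s) _ _).trans h
  exact ⟨⟨_, by rw [e]; exact (x * y).2, of_one_mul_of_one_mem η θ⟩, Subtype.ext e⟩

theorem of_mem_invariantSubring {n : ℕ} {η : HHdeg (ψ ^ s) (t * s) n} :
    of (HHdeg (ψ ^ s) (t * s)) n η ∈ invariantSubring hs H hH hc ↔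
      of (HHdeg ψ t) (s * n) (HHincl ψ t s n η) ∈ H ∧
        of (HHdeg (ψ ^ s) (t * s)) n η ∈ invariantSubgroup (ψ ^ s) (t * s) := by
  rw [← veronese_of]
  rfl

/-- The invariant subring of `H` satisfies the finite generation hypothesis as soon as `H` does and
`H` is finite over it. -/
theorem fgCommutative_invariantSubring {M : ModuleCat.{u} Λ} (h : FgCommutative M H)
    (hN : IsNoetherianRing (invariantSubringHom hs hH hc).range)
    (hfin : Module.Finite (invariantSubringHom hs hH hc).range H) :
    FgCommutative M (invariantSubring hs H hH hc) where
  graded x hx n := by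
    refine (of_mem_invariantSubring hs hH hc).2 ⟨?_, of_mem_invariantSubgroup.2 (hx.2 n)⟩
    rw [← veronese_apply ψ t hs n x]
    exact hH _ hx.1 _
  comm x hx y hy := veronese_injective ψ t hs (by
    rw [map_mul, map_mul]
    exact hc _ hx.1 _ hy.1)
  noetherian := isNoetherianRing_of_ringEquiv (invariantSubringHom hs hH hc).range
    (RingEquiv.ofBijective (invariantSubringHom hs hH hc).rangeRestrict
      ⟨fun _ _ e => invariantSubringHom_injective hs hH hc (congrArg Subtype.val e),
        RingHom.rangeRestrict_surjective _⟩).symm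
  degree_zero z := by
    refine (of_mem_invariantSubring hs hH hc).2 ⟨?_, of_zero_mem_invariantSubgroup z⟩
    have e : ∀ {m : ℕ} (_ : m = 0) (w : HHdeg ψ t m), of (HHdeg ψ t) m w ∈ H := by
      rintro _ rfl w
      exact h.degree_zero w
    exact e (mul_zero s) _
  finite := by
    refine extFG_of_finite hs M _ hc h.finite (fun x hx n => ?_)
      (B := (invariantSubringHom hs hH hc).range) ?_
    · refine (of_mem_invariantSubring hs hH hc).2 ⟨?_, of_mem_invariantSubgroup.2 (hx.2 n)⟩
      rw [← veronese_apply ψ t hs n x]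
      exact hH _ hx.1 _
    · rintro _ ⟨x, rfl⟩
      exact ⟨x, x.2, rfl⟩

end Veronese

/-! ### Choice of s and conclusion -/

theorem algEquiv_pow_apply_eq_self {k : Type v} {Λ : Type u} [CommRing k] [Ring Λ] [Algebra k Λ]
    {ψ : Λ ≃ₐ[k] Λ} {r s : ℕ} (h : r ∣ s) {z : Λ} (hz : (ψ ^ r) z = z) : (ψ ^ s) z = z := by
  obtain ⟨q, rfl⟩ := h
  induction q with
  | zero => rfl
  | succ q ih =>
    rw [Nat.mul_succ, pow_add, AlgEquiv.mul_apply, hz, ih]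

theorem mainTheorem9 {k : Type v} {Λ : Type u} [CommRing k] [IsArtinianRing k]
    [Ring Λ] [Nontrivial Λ] [Algebra k Λ] [Module.Finite k Λ] [Module.Projective k Λ]
    (hΛ : ∀ e ∈ Subring.center Λ, IsIdempotentElem e → e = 0 ∨ e = 1)
    (ψ : Λ ≃ₐ[k] Λ) (t : ℕ) (ht : 0 < t)
    (M : Type u) [AddCommGroup M] [Module Λ M] [Module.Finite Λ M] [Nontrivial M]
    (H : Subring (HHtw ψ t)) (hH : FgCommutative (ModuleCat.of Λ M) H) :
    ∃ s : ℕ, 0 < s ∧ ∃ H' : Subring (HHtw (ψ ^ s) (t * s)),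
      (∀ (n : ℕ) (η : HHdeg (ψ ^ s) (t * s) n),
        DirectSum.of (HHdeg (ψ ^ s) (t * s)) n η ∈ H' →
          DirectSum.of (HHdeg ψ t) (s * n) (HHincl ψ t s n η) ∈ H) ∧
      FgCommutative (ModuleCat.of Λ M) H' ∧
      (∀ (n : ℕ) (η : HHdeg (ψ ^ s) (t * s) n), 0 < n →
        DirectSum.of (HHdeg (ψ ^ s) (t * s)) n η ∈ H' → TwistInvariant η) ∧
      ((∃ r : ℕ, 0 < r ∧ ∀ z ∈ Subring.center Λ, (ψ ^ r) z = z) →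
        Fg (ModuleCat.of Λ M) (ψ ^ s) (t * s) H') := by
  -- One `s` and one `H'` have to serve both conclusions, so `r` is fixed beforehand: an exponent
  -- for which the power of `ψ` fixes the centre if there is one, and otherwise `1`, which imposes
  -- no condition on `s`.
  have hr : ∃ r, 0 < r ∧ ((∃ r : ℕ, 0 < r ∧ ∀ z ∈ Subring.center Λ, (ψ ^ r) z = z) →
      ∀ z ∈ Subring.center Λ, (ψ ^ r) z = z) := by
    by_cases h : ∃ r : ℕ, 0 < r ∧ ∀ z ∈ Subring.center Λ, (ψ ^ r) z = z
    · obtain ⟨r, hr, hz⟩ := h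
      exact ⟨r, hr, fun _ => hz⟩
    · exact ⟨1, one_pos, fun h' => absurd h' h⟩
  obtain ⟨r, hr, hz⟩ := hr
  obtain ⟨s, hs, hrs, hB⟩ :=
    exists_degree_noetherian_of_graded_subring H hH.graded hH.comm hH.noetherian hr
  obtain ⟨hN, hfin⟩ := hB (invariantSubringHom hs hH.graded hH.comm).range
    (fun x hx => mem_range_of_mem_gradedPart_zero hs hH.graded hH.comm hx)
    (fun x hx y hy => mul_mem_range_of_mem_gradedPart hs hH.graded hH.comm hx hy)
  have hFg := fgCommutative_invariantSubring hs hH.graded hH.comm hH hN hfin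
  have hinv : ∀ (n : ℕ) (η : HHdeg (ψ ^ s) (t * s) n), 0 < n →
      DirectSum.of (HHdeg (ψ ^ s) (t * s)) n η ∈ invariantSubring hs H hH.graded hH.comm →
        TwistInvariant η := fun n η hn hη => twistInvariant_of_mem hη.2 hn
  refine ⟨s, hs, invariantSubring hs H hH.graded hH.comm,
    fun n η hη => ((of_mem_invariantSubring hs hH.graded hH.comm).1 hη).1, hFg, hinv,
    fun h => ⟨hFg, hFg.comm, fun n η hη => ?_⟩⟩
  obtain rfl | hn := Nat.eq_zero_or_pos n
  -- Since `r` divides `s`, the automorphism `ψˢ` also fixes the centre pointwise.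
  · exact twistInvariant_of_degree_zero
      (fun z hzc => algEquiv_pow_apply_eq_self hrs (hz h z hzc)) η
  · exact hinv n η hn hη
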